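/- **Setting.** Let $E$ be a nonempty measurable space, $\Pi$ a Markov kernel on $E$, $\alpha\in(0,1)$, and $f,g,h:E\to\mathbb R$ measurable. Let $(\Omega,\mathcal F,(\mathbb P_x)_{x\in E})$ carry a Markov chain $X=(X_n)_{n\ge 0}$ with kernel $\Pi$ and $X_0=x$ under $\mathbb P_x$; sequences $(\xi^{(1)}_n)_{n\ge0}$ and $(\xi^{(2)}_n)_{n\ge0}$ of i.i.d. $U(0,1)$ variables; and i.i.d. survival coins with success probability $\alpha$; all of these independent. The killed chain $\tilde X$ starts in $X_0$; at each time $n\ge1$ it is killed with probability $1-\alpha$ (when the $n$-th coin fails), i.e. sent forever to a cemetery $K$, where $f,g,h$ are set to $0$; otherwise $\tilde X_n=X_n$. Assume that $\sup_n|f(\tilde X_n)|$, $\sup_n|g(\tilde X_n)|$, $\sup_n|h(\tilde X_n)|$ are integrable under $\mathbb P_x$ for every $x\in E$. For measurable $p:E\to[0,1]$ put $\tau^{p,i}=\inf\{n\ge0:p(X_n)\ge\xi^{(i)}_n\}$ ($\inf\emptyset=\infty$). Let $\mathcal T_1$ be the set of all ($[0,\infty]$-valued) stopping times of the filtration $\sigma(X_0,\dots,X_n,\xi^{(1)}_0,\dots,\xi^{(1)}_n)$.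 Fix a measurable $p_2:E\to[0,1]$ (the strategy of player 2), put $\tau_2=\tau^{p_2,2}$ and $$J_1(x;\tau,\tau_2)=\mathbb E_x\big[\alpha^{\tau}f(X_\tau)1_{\{\tau<\tau_2\}}+\alpha^{\tau_2}g(X_{\tau_2})1_{\{\tau_2<\tau\}}+\alpha^{\tau}h(X_\tau)1_{\{\tau=\tau_2<\infty\}}\big].$$ Problem (1) from $x\in E$ is to maximize $J_1(x;\tau,\tau_2)$ over $\tau\in\mathcal T_1$. *Auxiliary chain.* On $\hat E=(E\times\{C,S\})\cup\{K\}$, with absorbing set $\hat A=(E\times\{S\})\cup\{K\}$, define $\hat X$ pathwise by $\hat X_0=(X_0,C)$ and, if $\hat X_n=(X_n,C)$, $$\hat X_{n+1}=\begin{cases}(X_n,S)&\text{if }\tau_2=n,\\ K&\text{if }\tau_2>n,\ \tilde X_{n+1}=K,\\ (X_{n+1},C)&\text{if }\tau_2>n,\ \tilde X_{n+1}\ne K,\end{cases}$$ while states in $\hat A$ are kept forever. Under $\mathbb P_{(x,C)}:=\mathbb P_x$ this is the chain started in $(x,C)$; started in $\hat x\in\hat A$ the chain is constantly $\hat x$.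 Its kernel is $\hat\Pi(\hat x,\cdot)=\delta_{\hat x}$ for $\hat x\in\hat A$ and $$\hat\Pi((x,C),B)=p_2(x)\delta_{(x,S)}(B)+(1-p_2(x))(1-\alpha)\delta_K(B)+(1-p_2(x))\,\alpha\,\Pi(x,\{y:(y,C)\in B\}).$$ Let $\hat r(x,C)=(1-p_2(x))f(x)+p_2(x)h(x)$, $\hat r(x,S)=g(x)$, $\hat r(K)=0$. Let $\hat{\mathcal T}_1$ be the set of a.s. finite stopping times of the filtration $\sigma(\hat X_0,\dots,\hat X_n,\xi^{(1)}_0,\dots,\xi^{(1)}_n)$. Problem (2) from $\hat x\in\hat E$ is to maximize $\mathbb E_{\hat x}[\hat r(\hat X_\tau)]$ over $\tau\in\hat{\mathcal T}_1$; its value is $\hat V(\hat x)$. Put $\hat\Pi\hat V(\hat x)=\int\hat V\,d\hat\Pi(\hat x,\cdot)$ and $$\hat D=\{(x,C):\hat\Pi\hat V(x,C)<\hat r(x,C)\},\qquad \hat I=\{(x,C):\hat\Pi\hat V(x,C)=\hat r(x,C)\}.$$ Write $\tau_B=\inf\{n:\hat X_n\in B\}$ and, for measurable $p:E\to[0,1]$,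 $\hat\tau^{(p)}=\tau^{p,1}\wedge\tau_{\hat A}$. **Proposition.** For every measurable $p:E\to[0,1]$, $\tau^{p,1}\in\mathcal T_1$ and $\hat\tau^{(p)}\in\hat{\mathcal T}_1$; the random rewards in both problems are integrable for all admissible stopping times, the values of both problems are finite, and $\hat V$ is $\hat\Pi(\hat x,\cdot)$-integrable for every $\hat x\in\hat E$. Moreover: (Ai) For every initial state $\hat x\in\hat E$, $\tau_{\hat D\cup\hat I\cup\hat A}$ is optimal in problem (2), and $\hat V(\hat x)=\max\{\hat\Pi\hat V(\hat x),\hat r(\hat x)\}$. (Aii) The function $p$ with $p(y)=1$ if $(y,C)\in\hat D\cup\hat I$ and $p(y)=0$ otherwise is measurable, and $\tau_{\hat D\cup\hat I\cup\hat A}=\hat\tau^{(p)}$ almost surely for every initial state $\hat x\in\hat E$. (Aiii) Let $p:E\to[0,1]$ be measurable. Then $\hat\tau^{(p)}$ is optimal in problem (2) for all initial states $(x,C)$, $x\in E$, if and only if $p(y)=1$ for all $y$ with $(y,C)\in\hat D$ and $p(y)=0$ for all $y$ with $(y,C)\notin\hat D\cup\hat I$ ($p(y)\in[0,1]$ being arbitrary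 when $(y,C)\in\hat I$). (B) Let $p:E\to[0,1]$ be measurable and $x\in E$. Then $\tau^{p,1}$ is optimal in problem (1) from $x$ if and only if $\hat\tau^{(p)}$ is optimal in problem (2) from $(x,C)$. Moreover, $\sup_{\tau\in\mathcal T_1}J_1(x;\tau,\tau_2)=\hat V(x,C)$ for every $x\in E$. -/

import Mathlib

open MeasureTheory ProbabilityTheory

namespace DynkinGame

/-- The law on `ℕ → S` of the homogeneous Markov chain with transition kernel `κ` started at `x`. -/
noncomputable def chainLaw {S : Type*} [MeasurableSpace S] (κ : Kernel S S) [IsMarkovKernel κ]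
    (x : S) : Measure (ℕ → S) :=
  Kernel.traj (X := fun _ => S)
    (fun n => κ.comap (fun h : (Finset.Iic n → S) => h ⟨n, Finset.mem_Iic.2 le_rfl⟩)
      (measurable_pi_apply _)) 0 (fun _ => x)

/-- A probability space carrying a Markov chain `X` with kernel `κ` (started at `x` under `P x`),
two sequences of iid uniform randomization devices `ξ₁`, `ξ₂`, and iid survival coins `c`
(with `c n = true` with probability `α`), all of these being independent. -/
structure GameSpace {E : Type*} [MeasurableSpace E] (κ : Kernel E E) [IsMarkovKernel κ]
    (α : unitInterval) (Ω : Type*) [MeasurableSpace Ω] where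
  P : E → Measure Ω
  X : ℕ → Ω → E
  ξ₁ : ℕ → Ω → unitInterval
  ξ₂ : ℕ → Ω → unitInterval
  c : ℕ → Ω → Bool
  measurable_X : ∀ n, Measurable (X n)
  measurable_ξ₁ : ∀ n, Measurable (ξ₁ n)
  measurable_ξ₂ : ∀ n, Measurable (ξ₂ n)
  measurable_c : ∀ n, Measurable (c n)
  law : ∀ x, (P x).map (fun ω => (fun n => X n ω, fun n => (ξ₁ n ω, ξ₂ n ω, c n ω))) =
    (chainLaw κ x).prod (Measure.infinitePi fun _ : ℕ =>
      (volume : Measure unitInterval).prod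
        ((volume : Measure unitInterval).prod (bernoulliMeasure true false α)))

/-- Markovian stopping strategies: measurable functions `E → [0,1]`. -/
abbrev Strategy (E : Type*) [MeasurableSpace E] := {p : E → unitInterval // Measurable p}

/-- The filtration `σ(Y 0, …, Y n, ξ 0, …, ξ n)`. -/
def obsFiltration {Ω S : Type*} [mΩ : MeasurableSpace Ω] [mS : MeasurableSpace S]
    (Y : ℕ → Ω → S) (hY : ∀ n, Measurable (Y n))
    (ξ : ℕ → Ω → unitInterval) (hξ : ∀ n, Measurable (ξ n)) : Filtration ℕ mΩ where
  seq n := ⨆ k ≤ n, (MeasurableSpace.comap (Y k) mS ⊔ MeasurableSpace.comap (ξ k) inferInstance)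
  mono' _ _ hij := biSup_mono fun _ hk => hk.trans hij
  le' _ := iSup₂_le fun k _ => sup_le (hY k).comap_le (hξ k).comap_le

/-- The Markovian randomized stopping time `inf {n : p (X n) ≥ ξ n}`. -/
noncomputable def markovTime {Ω E : Type*} [MeasurableSpace E] (X : ℕ → Ω → E)
    (ξ : ℕ → Ω → unitInterval) (p : Strategy E) : Ω → WithTop ℕ :=
  hittingAfter (fun n ω => (X n ω, ξ n ω)) {z : E × unitInterval | p.1 z.1 ≥ z.2} 0

theorem measurableSet_markovTime_eq {Ω E : Type*} [MeasurableSpace Ω] [MeasurableSpace E]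
    (X : ℕ → Ω → E) (hX : ∀ n, Measurable (X n)) (ξ : ℕ → Ω → unitInterval)
    (hξ : ∀ n, Measurable (ξ n)) (p : Strategy E) (n : ℕ) :
    MeasurableSet {ω | markovTime X ξ p ω = n} := by
  have hs : MeasurableSet {z : E × unitInterval | p.1 z.1 ≥ z.2} :=
    measurableSet_le measurable_snd (p.2.comp measurable_fst)
  have had : Adapted (obsFiltration X hX ξ hξ) (fun n ω => (X n ω, ξ n ω)) := by
    intro k
    have hle : MeasurableSpace.comap (X k) inferInstance ⊔ MeasurableSpace.comap (ξ k) inferInstance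
        ≤ (obsFiltration X hX ξ hξ) k :=
      le_iSup₂_of_le (f := fun j (_ : j ≤ k) => MeasurableSpace.comap (X j) inferInstance ⊔
        MeasurableSpace.comap (ξ j) inferInstance) k le_rfl le_rfl
    refine Measurable.prodMk ?_ ?_
    · exact measurable_iff_comap_le.2 (le_sup_left.trans hle)
    · exact measurable_iff_comap_le.2 (le_sup_right.trans hle)
  exact (obsFiltration X hX ξ hξ).le n _ ((had.isStoppingTime_hittingAfter hs).measurableSet_eq n)

/-- The state space `E × {C, S} ∪ {K}`. -/
abbrev HatState (E : Type*) := E ⊕ E ⊕ Unit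

/-- The state `(x, C)`: neither stopped by player 2 nor killed. -/
abbrev stC {E : Type*} (x : E) : HatState E := Sum.inl x

/-- The state `(x, S)`: player 2 has stopped, in the state `x`. -/
abbrev stS {E : Type*} (x : E) : HatState E := Sum.inr (Sum.inl x)

/-- The cemetery `K`. -/
abbrev stK {E : Type*} : HatState E := Sum.inr (Sum.inr ())

/-- The absorbing states: `K` and all `(x, S)`. -/
def absorbing (E : Type*) : Set (HatState E) := {z | z = stK ∨ ∃ x : E, z = stS x}

/-- The reward function of the auxiliary stopping problem. -/
noncomputable def hatReward {E : Type*} [MeasurableSpace E] (f g h : E → ℝ) (p₂ : Strategy E) :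
    HatState E → ℝ
  | Sum.inl x => (1 - (p₂.1 x : ℝ)) * f x + (p₂.1 x : ℝ) * h x
  | Sum.inr (Sum.inl x) => g x
  | Sum.inr (Sum.inr _) => 0

/-- The transition kernel of the killed and absorbed chain. -/
noncomputable def hatKernel {E : Type*} [MeasurableSpace E] (κ : Kernel E E) [IsMarkovKernel κ]
    (α : unitInterval) (p₂ : Strategy E) : Kernel (HatState E) (HatState E) where
  toFun
    | Sum.inl x =>
        ENNReal.ofReal (p₂.1 x) • Measure.dirac (stS x) +
        ENNReal.ofReal ((1 - (p₂.1 x : ℝ)) * (1 - (α : ℝ))) • Measure.dirac stK +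
        ENNReal.ofReal ((1 - (p₂.1 x : ℝ)) * (α : ℝ)) • (κ x).map stC
    | Sum.inr (Sum.inl x) => Measure.dirac (stS x)
    | Sum.inr (Sum.inr _) => Measure.dirac stK
  measurable' := by
    have hp : Measurable fun x => (p₂.1 x : ℝ) := measurable_subtype_coe.comp p₂.2
    have hS : Measurable fun x : E => (Measure.dirac (stS x) : Measure (HatState E)) :=
      Measure.measurable_dirac.comp (measurable_inr.comp measurable_inl)
    refine measurable_fun_sum ?_ (measurable_fun_sum hS measurable_const)
    refine Measure.measurable_of_measurable_coe _ fun s hs => ?_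
    have h1 : Measurable fun x : E => (Measure.dirac (stS x) : Measure (HatState E)) s :=
      (Measure.measurable_coe hs).comp hS
    have h2 : Measurable fun x : E => ((κ x).map stC : Measure (HatState E)) s :=
      (Measure.measurable_coe hs).comp ((Measure.measurable_map _ measurable_inl).comp κ.measurable)
    change Measurable fun x : E =>
      ENNReal.ofReal (p₂.1 x) * (Measure.dirac (stS x) : Measure (HatState E)) s +
      ENNReal.ofReal ((1 - (p₂.1 x : ℝ)) * (1 - (α : ℝ))) *
        (Measure.dirac stK : Measure (HatState E)) s +
      ENNReal.ofReal ((1 - (p₂.1 x : ℝ)) * (α : ℝ)) * ((κ x).map stC : Measure (HatState E)) s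
    fun_prop

namespace GameSpace

variable {E Ω : Type*} [MeasurableSpace E] [MeasurableSpace Ω] {κ : Kernel E E} [IsMarkovKernel κ]
  {α : unitInterval} (G : GameSpace κ α Ω)

open scoped Classical in
/-- The chain killed at each `n ≥ 1` with probability `1 - α`; `none` is the cemetery. -/
noncomputable def killed (n : ℕ) (ω : Ω) : Option E :=
  if ∀ k, 1 ≤ k → k ≤ n → G.c k ω = true then some (G.X n ω) else none

/-- `sup_n |φ (X̃ n)|` is integrable under every `P x`, where `φ` vanishes at the cemetery. -/
def SupIntegrable (φ : E → ℝ) : Prop :=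
  ∀ x, ∫⁻ ω, ⨆ n, ‖(G.killed n ω).elim 0 φ‖ₑ ∂(G.P x) < ⊤

/-! ### The stopping problem of player 1 -/

/-- The admissible stopping times of player 1. -/
def admissible : Set (Ω → WithTop ℕ) :=
  {τ | IsStoppingTime (obsFiltration G.X G.measurable_X G.ξ₁ G.measurable_ξ₁) τ}

open scoped Classical in
/-- The random payoff of player 1 when the players use `τ₁` and `τ₂`. -/
noncomputable def payoff (f g h : E → ℝ) (τ₁ τ₂ : Ω → WithTop ℕ) (ω : Ω) : ℝ :=
  (if τ₁ ω < τ₂ ω then (α : ℝ) ^ (τ₁ ω).untopA * f (G.X (τ₁ ω).untopA ω) else 0) +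
  (if τ₂ ω < τ₁ ω then (α : ℝ) ^ (τ₂ ω).untopA * g (G.X (τ₂ ω).untopA ω) else 0) +
  (if τ₁ ω = τ₂ ω ∧ τ₁ ω < ⊤ then (α : ℝ) ^ (τ₁ ω).untopA * h (G.X (τ₁ ω).untopA ω) else 0)

/-- The expected reward of player 1. -/
noncomputable def J (f g h : E → ℝ) (x : E) (τ₁ τ₂ : Ω → WithTop ℕ) : ℝ :=
  ∫ ω, G.payoff f g h τ₁ τ₂ ω ∂(G.P x)

/-- The Markovian randomized stopping time of player 1 with strategy `p`. -/
noncomputable def time₁ (p : Strategy E) : Ω → WithTop ℕ := markovTime G.X G.ξ₁ p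

/-- The Markovian randomized stopping time of player 2 with strategy `p`. -/
noncomputable def time₂ (p : Strategy E) : Ω → WithTop ℕ := markovTime G.X G.ξ₂ p

/-- The set of expected rewards that player 1 can reach from `x` against `p₂`. -/
def gameRewards (f g h : E → ℝ) (p₂ : Strategy E) (x : E) : Set ℝ :=
  (fun τ => G.J f g h x τ (G.time₂ p₂)) '' G.admissible

/-- `τ` is optimal for player 1 from `x` against `p₂`. -/
def IsOptimal (f g h : E → ℝ) (p₂ : Strategy E) (x : E) (τ : Ω → WithTop ℕ) : Prop :=
  τ ∈ G.admissible ∧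
    ∀ σ ∈ G.admissible, G.J f g h x σ (G.time₂ p₂) ≤ G.J f g h x τ (G.time₂ p₂)

/-! ### The killed and absorbed chain -/

open scoped Classical in
/-- The killed and absorbed chain, constructed path by path. The first explicit state `z` is the
initial state: an absorbing one is kept forever, and from `z = (x, C)` the chain starts in
`(X 0, C)`, where `X 0 = x` under `P x`. -/
noncomputable def hatX (p₂ : Strategy E) (z : HatState E) : ℕ → Ω → HatState E
  | 0, ω => if z ∈ absorbing E then z else stC (G.X 0 ω)
  | n + 1, ω =>
    if hatX p₂ z n ω ∈ absorbing E then hatX p₂ z n ω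
    else if G.time₂ p₂ ω = n then stS (G.X n ω)
    else (G.killed (n + 1) ω).elim stK stC

theorem measurable_hatX (p₂ : Strategy E) (z : HatState E) (n : ℕ) :
    Measurable (G.hatX p₂ z n) := by
  have hA : MeasurableSet (absorbing E) := by
    have : absorbing E = Set.range Sum.inr := by
      ext y
      rcases y with y | y | y <;> simp [absorbing]
    rw [this]
    exact measurableSet_range_inr
  have hC : ∀ k, Measurable fun ω => (stC (G.X k ω) : HatState E) :=
    fun k => measurable_inl.comp (G.measurable_X k)
  induction n with
  | zero =>
    simp only [hatX]
    split_ifs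
    · exact measurable_const
    · exact hC 0
  | succ n ih =>
    simp only [hatX]
    refine Measurable.ite (ih hA) ih (Measurable.ite ?_ ?_ ?_)
    · exact measurableSet_markovTime_eq G.X G.measurable_X G.ξ₂ G.measurable_ξ₂ p₂ n
    · exact (measurable_inr.comp measurable_inl).comp (G.measurable_X n)
    · have hs : MeasurableSet {ω | ∀ k, 1 ≤ k → k ≤ n + 1 → G.c k ω = true} := by
        simp only [Set.ofPred_forall]
        exact MeasurableSet.iInter fun k => MeasurableSet.iInter fun _ =>
          MeasurableSet.iInter fun _ => G.measurable_c k (measurableSet_singleton true)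
      have : (fun ω => (G.killed (n + 1) ω).elim stK stC) = fun ω =>
          if ω ∈ {ω | ∀ k, 1 ≤ k → k ≤ n + 1 → G.c k ω = true} then
            (stC (G.X (n + 1) ω) : HatState E) else stK := by
        funext ω
        simp only [killed, Set.mem_ofPred_eq]
        split_ifs <;> rfl
      rw [this]
      exact Measurable.ite hs (hC _) measurable_const

/-- The measure `P_z` for an initial state `z`. From `K` the chain stays in `K`, so that it does not
matter which of the measures `P x` is taken there. -/
noncomputable def hatP [Nonempty E] : HatState E → Measure Ω
  | Sum.inl x => G.P x
  | Sum.inr (Sum.inl x) => G.P x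
  | Sum.inr (Sum.inr _) => G.P (Classical.arbitrary E)

variable [Nonempty E]

/-- The almost surely finite stopping times for the filtration generated by the killed and absorbed
chain started in `z` and by the randomization device of player 1. -/
def hatAdmissible (p₂ : Strategy E) (z : HatState E) : Set (Ω → WithTop ℕ) :=
  {τ | IsStoppingTime
      (obsFiltration (G.hatX p₂ z) (G.measurable_hatX p₂ z) G.ξ₁ G.measurable_ξ₁) τ ∧
    ∀ᵐ ω ∂(G.hatP z), τ ω < ⊤}

/-- The expected reward of `τ` in the auxiliary problem. -/
noncomputable def hatJ (f g h : E → ℝ) (p₂ : Strategy E) (z : HatState E) (τ : Ω → WithTop ℕ) : ℝ :=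
  ∫ ω, hatReward f g h p₂ (stoppedValue (G.hatX p₂ z) τ ω) ∂(G.hatP z)

/-- The set of expected rewards that can be reached from `z` in the auxiliary problem. -/
def hatRewards (f g h : E → ℝ) (p₂ : Strategy E) (z : HatState E) : Set ℝ :=
  G.hatJ f g h p₂ z '' G.hatAdmissible p₂ z

/-- The optimal value of the auxiliary problem. -/
noncomputable def hatV (f g h : E → ℝ) (p₂ : Strategy E) (z : HatState E) : ℝ :=
  sSup (G.hatRewards f g h p₂ z)

/-- `τ` is optimal in the auxiliary problem from `z`. -/
def IsHatOptimal (f g h : E → ℝ) (p₂ : Strategy E) (z : HatState E) (τ : Ω → WithTop ℕ) : Prop :=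
  τ ∈ G.hatAdmissible p₂ z ∧
    ∀ σ ∈ G.hatAdmissible p₂ z, G.hatJ f g h p₂ z σ ≤ G.hatJ f g h p₂ z τ

/-- The expected optimal value after one step, `Π̂ V̂`. -/
noncomputable def hatPV (f g h : E → ℝ) (p₂ : Strategy E) (z : HatState E) : ℝ :=
  ∫ y, G.hatV f g h p₂ y ∂(hatKernel κ α p₂ z)

/-- The strict stopping set. -/
def hatD (f g h : E → ℝ) (p₂ : Strategy E) : Set (HatState E) :=
  {z | ∃ x : E, z = stC x ∧ G.hatPV f g h p₂ z < hatReward f g h p₂ z}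

/-- The indifference set. -/
def hatI (f g h : E → ℝ) (p₂ : Strategy E) : Set (HatState E) :=
  {z | ∃ x : E, z = stC x ∧ G.hatPV f g h p₂ z = hatReward f g h p₂ z}

/-- The first entry time of the chain started in `z` into a set `A`. -/
noncomputable def entryTime (p₂ : Strategy E) (z : HatState E) (A : Set (HatState E)) :
    Ω → WithTop ℕ :=
  hittingAfter (G.hatX p₂ z) A 0

/-- The stopping time `inf {n : p (X n) ≥ ξ₁ n}`, capped at the time of absorption. -/
noncomputable def hatTime (p₂ : Strategy E) (z : HatState E) (p : Strategy E) : Ω → WithTop ℕ :=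
  fun ω => min (G.time₁ p ω) (G.entryTime p₂ z (absorbing E) ω)

end GameSpace

end DynkinGame

/-! The opponent's stop and the discount are both coded as absorption: `S` records that player 2 has
stopped, `K` that a coin has failed. Problem (1) then becomes undiscounted optimal stopping of a
single Markov chain. Three facts carry the proof.

General theory. Let `Y` be a chain with kernel `K` and reward `r` such that sup |r(Y_m)| is
integrable. The limit v of value iteration solves v = max(r, Kv) (`value_eq_max`). For an a.s.
finite stopping time τ, the gap v(z) - E r(Y_τ) is the sum over n of the loss from stopping, v - r
on {τ = n}, and the loss from continuing, v - Kv on {τ > n} (`IsChain.hasSum_loss`). All losses are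
nonnegative, so v bounds every reward, and τ attains v exactly when every loss vanishes.
Integrability comes from the least excessive majorant of |r|: its integral along the chain over an
event of the past is at most that of sup |r(Y_m)|.

The auxiliary chain fits this theory (`isChain_hatX`). At time n it has used the devices of player 2
only before n and the coins only up to n, so the next device, coin and move of `X` can be integrated
out separately. As α < 1, absorption is certain, hence the entry time into the set where stopping is
at least as good as continuing is a.s. finite, and it is lossless. From (y, C) a Markovian rule
stops at time 0 with probability p(y), so vanishing of the loss at time 0 forces p(y) = 1 on D and
p(y) = 0 off D ∪ I; conversely these values remove every loss.

Comparison of the problems (`integral_payoff_eq`). The game reward of τ is the auxiliary reward of τ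
capped at absorption. Integrating out the device of player 2 on {τ = n ≤ τ₂} gives (1 - p₂) f + p₂
h, and α^n is the probability that n coins succeed, independently of the rest. The capped time is
admissible because `X` is visible in the auxiliary chain until absorption. Hence the value of (1) is
at most that of (2), with equality because an optimal time in (2) is a capped Markovian one. -/

namespace OptimalStopping

open Filter Topology
open scoped ENNReal

/-! ### Chains relative to a filtration and excessive majorants. -/

variable {S : Type*} [MeasurableSpace S]

/-- `Y` is a Markov chain with kernel `K` started in `z`, relative to the filtration `ℱ`. -/
structure IsChain (K : Kernel S S) (z : S) {Ω : Type*} [mΩ : MeasurableSpace Ω] (P : Measure Ω)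
    (ℱ : Filtration ℕ mΩ) (Y : ℕ → Ω → S) : Prop where
  adapted : ∀ n, Measurable[ℱ n] (Y n)
  start : P.map (Y 0) = Measure.dirac z
  step : ∀ n A, MeasurableSet[ℱ n] A → ∀ ψ : S → ℝ≥0∞, Measurable ψ →
    ∫⁻ ω in A, ψ (Y (n + 1) ω) ∂P = ∫⁻ ω in A, ∫⁻ y, ψ y ∂(K (Y n ω)) ∂P

/-- Value iteration for a nonnegative reward. -/
noncomputable def envelopeIter (K : Kernel S S) (φ : S → ℝ≥0∞) : ℕ → S → ℝ≥0∞
  | 0, z => φ z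
  | n + 1, z => max (φ z) (∫⁻ y, envelopeIter K φ n y ∂(K z))

/-- The least excessive majorant of a nonnegative reward. -/
noncomputable def envelope (K : Kernel S S) (φ : S → ℝ≥0∞) (z : S) : ℝ≥0∞ :=
  ⨆ n, envelopeIter K φ n z

section Envelope

variable (K : Kernel S S) {φ : S → ℝ≥0∞}

theorem measurable_envelopeIter (hφ : Measurable φ) (n : ℕ) : Measurable (envelopeIter K φ n) := by
  induction n with
  | zero => exact hφ
  | succ n ih => exact hφ.max ih.lintegral_kernel

theorem measurable_envelope (hφ : Measurable φ) : Measurable (envelope K φ) :=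
  Measurable.iSup (measurable_envelopeIter K hφ)

theorem monotone_envelopeIter : Monotone (envelopeIter K φ) := by
  refine monotone_nat_of_le_succ fun n => ?_
  induction n with
  | zero => exact fun z => le_max_left _ _
  | succ n ih => exact fun z => max_le_max le_rfl (lintegral_mono ih)

theorem lintegral_envelope_le (hφ : Measurable φ) (z : S) :
    ∫⁻ y, envelope K φ y ∂(K z) ≤ envelope K φ z := by
  unfold envelope
  rw [lintegral_iSup (measurable_envelopeIter K hφ) (monotone_envelopeIter K)]
  exact iSup_le fun n => le_iSup_of_le (n + 1) (le_max_right _ _)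

variable {K} {z : S} {Ω : Type*} [mΩ : MeasurableSpace Ω] {P : Measure Ω}
  {ℱ : Filtration ℕ mΩ} {Y : ℕ → Ω → S}

theorem IsChain.measurable (hY : IsChain K z P ℱ Y) (n : ℕ) : Measurable (Y n) :=
  (hY.adapted n).mono (ℱ.le n) le_rfl

/-- Split `A` according to whether the reward or the continuation is larger. Where the reward wins,
it is one of the terms of the supremum; elsewhere the Markov property moves to time `n + 1` with one
iteration fewer. The induction therefore needs all times and all events of the past. -/
theorem IsChain.setLIntegral_envelopeIter_le (hY : IsChain K z P ℱ Y) (hφ : Measurable φ)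
    (N n : ℕ) {A : Set Ω} (hA : MeasurableSet[ℱ n] A) :
    ∫⁻ ω in A, envelopeIter K φ N (Y n ω) ∂P ≤ ∫⁻ ω in A, ⨆ m, φ (Y m ω) ∂P := by
  induction N generalizing n A with
  | zero => exact lintegral_mono fun ω => le_iSup (fun m => φ (Y m ω)) n
  | succ N ih =>
    set ψ := fun z => ∫⁻ y, envelopeIter K φ N y ∂(K z) with hψ
    have hψm : Measurable ψ := (measurable_envelopeIter K hφ N).lintegral_kernel
    set B := {ω | ψ (Y n ω) ≤ φ (Y n ω)} with hB
    have hBm : MeasurableSet[ℱ n] B :=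
      (measurableSet_le hψm hφ).preimage (hY.adapted n)
    rw [← lintegral_inter_add_sdiff _ A (ℱ.le n _ hBm),
      ← lintegral_inter_add_sdiff (fun ω => ⨆ m, φ (Y m ω)) A (ℱ.le n _ hBm)]
    have hAB := hA.inter hBm
    have hAB' := hA.diff hBm
    refine add_le_add ?_ ?_
    · refine setLIntegral_mono' (ℱ.le n _ hAB) fun ω hω => ?_
      exact (max_le le_rfl hω.2).trans (le_iSup (fun m => φ (Y m ω)) n)
    · calc ∫⁻ ω in A \ B, envelopeIter K φ (N + 1) (Y n ω) ∂P
          ≤ ∫⁻ ω in A \ B, ψ (Y n ω) ∂P := by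
            refine setLIntegral_mono' (ℱ.le n _ hAB') fun ω hω => ?_
            exact max_le (not_le.1 hω.2).le le_rfl
        _ = ∫⁻ ω in A \ B, envelopeIter K φ N (Y (n + 1) ω) ∂P :=
            (hY.step n _ hAB' _ (measurable_envelopeIter K hφ N)).symm
        _ ≤ _ := ih (n + 1) (ℱ.mono n.le_succ _ hAB')

/-- The domination behind all limits: with `A` the whole space it gives integrability of the value
along the chain, with `A` = {τ ≥ n} it makes the remainder at time `n` vanish. -/
theorem IsChain.setLIntegral_envelope_le (hY : IsChain K z P ℱ Y) (hφ : Measurable φ)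
    (n : ℕ) {A : Set Ω} (hA : MeasurableSet[ℱ n] A) :
    ∫⁻ ω in A, envelope K φ (Y n ω) ∂P ≤ ∫⁻ ω in A, ⨆ m, φ (Y m ω) ∂P := by
  unfold envelope
  rw [lintegral_iSup (f := fun N ω => envelopeIter K φ N (Y n ω))
    (fun N => (measurable_envelopeIter K hφ N).comp (hY.measurable n))
    (fun _ _ h _ => monotone_envelopeIter K h _)]
  exact iSup_le fun N => hY.setLIntegral_envelopeIter_le hφ N n hA

theorem IsChain.lintegral_start (hY : IsChain K z P ℱ Y) {ψ : S → ℝ≥0∞} (hψ : Measurable ψ) :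
    ∫⁻ ω, ψ (Y 0 ω) ∂P = ψ z := by
  rw [← lintegral_map hψ (hY.measurable 0), hY.start, lintegral_dirac' _ hψ]

theorem IsChain.envelope_le (hY : IsChain K z P ℱ Y) (hφ : Measurable φ) :
    envelope K φ z ≤ ∫⁻ ω, ⨆ m, φ (Y m ω) ∂P := by
  have h := hY.setLIntegral_envelope_le hφ 0 MeasurableSet.univ
  rwa [setLIntegral_univ, setLIntegral_univ, hY.lintegral_start (measurable_envelope K hφ)] at h

end Envelope

/-! ### Value iteration and the Wald-Bellman equation. -/

/-- Value iteration. -/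
noncomputable def valueIter (K : Kernel S S) (r : S → ℝ) : ℕ → S → ℝ
  | 0, z => r z
  | n + 1, z => max (r z) (∫ y, valueIter K r n y ∂(K z))

/-- The value function of the problem of stopping a chain with kernel `K` and reward `r`. -/
noncomputable def value (K : Kernel S S) (r : S → ℝ) (z : S) : ℝ := ⨆ n, valueIter K r n z

section Value

variable (K : Kernel S S) {r : S → ℝ}

theorem measurable_valueIter (hr : Measurable r) (n : ℕ) : Measurable (valueIter K r n) := by
  induction n with
  | zero => exact hr
  | succ n ih => exact hr.max (ih.stronglyMeasurable.integral_kernel (κ := K)).measurable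

theorem measurable_value (hr : Measurable r) : Measurable (value K r) :=
  Measurable.iSup (measurable_valueIter K hr)

theorem enorm_valueIter_le (n : ℕ) (z : S) :
    ‖valueIter K r n z‖ₑ ≤ envelopeIter K (fun z => ‖r z‖ₑ) n z := by
  induction n generalizing z with
  | zero => exact le_rfl
  | succ n ih =>
    have h : ‖∫ y, valueIter K r n y ∂(K z)‖ₑ ≤
        ∫⁻ y, envelopeIter K (fun z => ‖r z‖ₑ) n y ∂(K z) :=
      (enorm_integral_le_lintegral_enorm _).trans (lintegral_mono ih)
    rcases le_total (r z) (∫ y, valueIter K r n y ∂(K z)) with hc | hc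
    · simp only [valueIter, max_eq_right hc]
      exact h.trans (le_max_right _ _)
    · simp only [valueIter, max_eq_left hc]
      exact le_max_left _ _

variable {K}

theorem enorm_valueIter_le_envelope (n : ℕ) (z : S) :
    ‖valueIter K r n z‖ₑ ≤ envelope K (fun z => ‖r z‖ₑ) z :=
  (enorm_valueIter_le K n z).trans (le_iSup (fun n => envelopeIter K (fun z => ‖r z‖ₑ) n z) n)

variable (hr : Measurable r) (hu : ∀ z, envelope K (fun z => ‖r z‖ₑ) z < ⊤)

include hu in
theorem norm_valueIter_le (n : ℕ) (z : S) :
    ‖valueIter K r n z‖ ≤ (envelope K (fun z => ‖r z‖ₑ) z).toReal := by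
  rw [← toReal_enorm]
  exact ENNReal.toReal_mono (hu z).ne (enorm_valueIter_le_envelope n z)

include hu in
theorem bddAbove_valueIter (z : S) : BddAbove (Set.range fun n => valueIter K r n z) :=
  ⟨(envelope K (fun z => ‖r z‖ₑ) z).toReal, by
    rintro _ ⟨n, rfl⟩
    exact (le_abs_self _).trans (norm_valueIter_le hu n z)⟩

include hr hu in
theorem integrable_toReal_envelope (z : S) :
    Integrable (fun y => (envelope K (fun z => ‖r z‖ₑ) y).toReal) (K z) := by
  refine integrable_toReal_of_lintegral_ne_top (measurable_envelope K hr.enorm).aemeasurable ?_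
  exact ((lintegral_envelope_le K hr.enorm z).trans_lt (hu z)).ne

include hr hu in
theorem integrable_valueIter (n : ℕ) (z : S) : Integrable (valueIter K r n) (K z) :=
  (integrable_toReal_envelope hr hu z).mono' (measurable_valueIter K hr n).aestronglyMeasurable
    (ae_of_all _ fun y => norm_valueIter_le hu n y)

include hr hu in
theorem monotone_valueIter : Monotone (valueIter K r) := by
  refine monotone_nat_of_le_succ fun n => ?_
  induction n with
  | zero => exact fun z => le_max_left _ _
  | succ n ih =>
    exact fun z => max_le_max le_rfl
      (integral_mono (integrable_valueIter hr hu n z) (integrable_valueIter hr hu (n + 1) z) ih)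

include hr hu in
theorem tendsto_valueIter (z : S) :
    Tendsto (fun n => valueIter K r n z) atTop (𝓝 (value K r z)) :=
  tendsto_atTop_ciSup (fun _ _ h => monotone_valueIter hr hu h z) (bddAbove_valueIter hu z)

include hr hu in
theorem enorm_value_le (z : S) : ‖value K r z‖ₑ ≤ envelope K (fun z => ‖r z‖ₑ) z :=
  le_of_tendsto ((tendsto_valueIter hr hu z).enorm)
    (Eventually.of_forall fun n => enorm_valueIter_le_envelope n z)

include hr hu in
theorem integrable_value (z : S) : Integrable (value K r) (K z) := by
  refine ⟨(measurable_value K hr).aestronglyMeasurable, ?_⟩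
  refine (lintegral_mono (enorm_value_le hr hu)).trans_lt ?_
  exact (lintegral_envelope_le K hr.enorm z).trans_lt (hu z)

include hr hu in
/-- The Wald-Bellman equation. -/
theorem value_eq_max (z : S) : value K r z = max (r z) (∫ y, value K r y ∂(K z)) := by
  -- Dominated convergence; the envelope is an integrable bound under `K z` because it is excessive
  -- and finite at `z`.
  have h1 : Tendsto (fun n => ∫ y, valueIter K r n y ∂(K z)) atTop
      (𝓝 (∫ y, value K r y ∂(K z))) :=
    tendsto_integral_of_dominated_convergence _
      (fun n => (measurable_valueIter K hr n).aestronglyMeasurable)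
      (integrable_toReal_envelope hr hu z)
      (fun n => ae_of_all _ fun y => norm_valueIter_le hu n y)
      (ae_of_all _ fun y => tendsto_valueIter hr hu y)
  have h2 := (tendsto_const_nhds (x := r z)).max h1
  have h3 := (tendsto_valueIter hr hu z).comp (tendsto_add_atTop_nat 1)
  exact tendsto_nhds_unique h3 h2

include hr in
theorem value_of_dirac {z : S} (hz : K z = Measure.dirac z) : value K r z = r z := by
  have h : ∀ n, valueIter K r n z = r z := by
    intro n
    induction n with
    | zero => rfl
    | succ n ih =>
      simp only [valueIter]
      rw [hz, integral_dirac' _ _ (measurable_valueIter K hr n).stronglyMeasurable, ih, max_self]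
  simp [value, h]

include hr in
theorem integral_value_of_dirac {z : S} (hz : K z = Measure.dirac z) :
    ∫ y, value K r y ∂(K z) = value K r z := by
  rw [hz, integral_dirac' _ _ (measurable_value K hr).stronglyMeasurable]

end Value

/-! ### Verification: the gap to the value as a sum of losses. -/

section Verification

variable {K : Kernel S S} {z : S} {Ω : Type*} [mΩ : MeasurableSpace Ω]
  {P : Measure Ω} {ℱ : Filtration ℕ mΩ} {Y : ℕ → Ω → S}

theorem IsChain.integral_start (hY : IsChain K z P ℱ Y) {ψ : S → ℝ} (hψ : Measurable ψ) :
    ∫ ω, ψ (Y 0 ω) ∂P = ψ z := by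
  rw [← integral_map (hY.measurable 0).aemeasurable hψ.aestronglyMeasurable, hY.start,
    integral_dirac' _ _ hψ.stronglyMeasurable]

/-- The Markov property as an identity of measures, from which it passes to integrable functions of
either sign. -/
theorem IsChain.map_step [SFinite P] (hY : IsChain K z P ℱ Y) (n : ℕ) {A : Set Ω}
    (hA : MeasurableSet[ℱ n] A) :
    (P.restrict A).map (Y (n + 1)) = K ∘ₘ ((P.restrict A).map (Y n)) := by
  ext s hs
  have h := hY.step n A hA (s.indicator 1) (measurable_one.indicator hs)
  rw [Measure.bind_apply hs K.aemeasurable,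
    lintegral_map (Kernel.measurable_coe K hs) (hY.measurable n),
    ← lintegral_indicator_one hs, lintegral_map (measurable_one.indicator hs) (hY.measurable _), h]
  simp [lintegral_indicator_one hs]

theorem IsChain.setIntegral_step [SFinite P] (hY : IsChain K z P ℱ Y) (n : ℕ) {A : Set Ω}
    (hA : MeasurableSet[ℱ n] A) {ψ : S → ℝ} (hψ : Measurable ψ)
    (hi : IntegrableOn (fun ω => ψ (Y (n + 1) ω)) A P) :
    IntegrableOn (fun ω => ∫ y, ψ y ∂(K (Y n ω))) A P ∧
    ∫ ω in A, ψ (Y (n + 1) ω) ∂P = ∫ ω in A, ∫ y, ψ y ∂(K (Y n ω)) ∂P := by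
  have hKψ : Measurable fun z => ∫ y, ψ y ∂(K z) :=
    (hψ.stronglyMeasurable.integral_kernel (κ := K)).measurable
  have hi' : Integrable ψ (K ∘ₘ ((P.restrict A).map (Y n))) := by
    rw [← hY.map_step n hA]
    exact (integrable_map_measure hψ.aestronglyMeasurable (hY.measurable _).aemeasurable).2 hi
  refine ⟨?_, ?_⟩
  · have := Measure.comp_eq_comp_const_apply (μ := (P.restrict A).map (Y n)) (κ := K)
    rw [this] at hi'
    have h2 := hi'.integral_comp
    rw [Kernel.const_apply] at h2
    exact (integrable_map_measure hKψ.aestronglyMeasurable (hY.measurable _).aemeasurable).1 h2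
  · rw [← integral_map (hY.measurable _).aemeasurable hψ.aestronglyMeasurable,
      hY.map_step n hA, Measure.comp_eq_comp_const_apply, Kernel.integral_comp
        (by rwa [← Measure.comp_eq_comp_const_apply]), Kernel.const_apply,
      integral_map (hY.measurable _).aemeasurable hKψ.aestronglyMeasurable]

variable {r : S → ℝ}

@[simp]
theorem untopA_natCast (n : ℕ) : ((n : ℕ) : WithTop ℕ).untopA = n := rfl

theorem measurable_stoppedValue {τ : Ω → WithTop ℕ} (hY : ∀ n, Measurable (Y n))
    (hτ : ∀ n : ℕ, MeasurableSet {ω | τ ω = n}) : Measurable (stoppedValue Y τ) := by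
  have hτm : Measurable fun ω => (τ ω).untopA := by
    refine measurable_to_countable' fun n => ?_
    have hT : MeasurableSet {ω | τ ω = ⊤} := by
      have : {ω | τ ω = ⊤} = (⋃ n : ℕ, {ω | τ ω = n})ᶜ := by
        ext ω
        induction h : τ ω using WithTop.recTopCoe <;> simp [h]
      rw [this]
      exact (MeasurableSet.iUnion hτ).compl
    -- At `⊤` the function `untopA` takes one fixed default value, so a fibre contains either all of
    -- {τ = ⊤} or none of it.
    have : (fun ω => (τ ω).untopA) ⁻¹' {n} =
        {ω | τ ω = n} ∪ {ω | τ ω = ⊤} ∩ {_ω | (⊤ : WithTop ℕ).untopA = n} := by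
      ext ω
      induction h : τ ω using WithTop.recTopCoe with
      | top => simp [h]
      | coe k =>
        replace h : τ ω = (k : ℕ) := h
        simp [h, untopA_natCast]
    rw [this]
    exact (hτ n).union (hT.inter (MeasurableSet.const _))
  exact (measurable_from_prod_countable_right (f := fun p : ℕ × Ω => Y p.1 p.2) hY).comp
    (hτm.prodMk measurable_id)

theorem IsChain.measurable_reward (hY : IsChain K z P ℱ Y) (hr : Measurable r)
    {τ : Ω → WithTop ℕ} (hτ : IsStoppingTime ℱ τ) :
    Measurable fun ω => r (stoppedValue Y τ ω) :=
  hr.comp (measurable_stoppedValue hY.measurable fun n => ℱ.le n _ (hτ.measurableSet_eq n))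

/-- Finiteness of `τ` plays no role: where `τ = ⊤`, the stopped value is the chain at a default
time, still below the supremum. -/
theorem IsChain.integrable_reward (hY : IsChain K z P ℱ Y) (hr : Measurable r)
    (hZ : ∫⁻ ω, ⨆ m, ‖r (Y m ω)‖ₑ ∂P < ⊤) {τ : Ω → WithTop ℕ} (hτ : IsStoppingTime ℱ τ) :
    Integrable (fun ω => r (stoppedValue Y τ ω)) P :=
  ⟨(hY.measurable_reward hr hτ).aestronglyMeasurable,
    (lintegral_mono fun ω => le_iSup (fun m => ‖r (Y m ω)‖ₑ) _).trans_lt hZ⟩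

variable (hY : IsChain K z P ℱ Y) (hr : Measurable r)
  (hu : ∀ z, envelope K (fun z => ‖r z‖ₑ) z < ⊤) (hZ : ∫⁻ ω, ⨆ m, ‖r (Y m ω)‖ₑ ∂P < ⊤)

include hY hr hu hZ in
theorem IsChain.integrable_value (n : ℕ) : Integrable (fun ω => value K r (Y n ω)) P := by
  refine ⟨((measurable_value K hr).comp (hY.measurable n)).aestronglyMeasurable, ?_⟩
  refine (lintegral_mono fun ω => enorm_value_le hr hu (Y n ω)).trans_lt ?_
  have := hY.setLIntegral_envelope_le hr.enorm n MeasurableSet.univ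
  simp only [setLIntegral_univ] at this
  exact this.trans_lt hZ

include hY hr hZ in
theorem IsChain.integrable_reward_at (n : ℕ) : Integrable (fun ω => r (Y n ω)) P :=
  ⟨(hr.comp (hY.measurable n)).aestronglyMeasurable,
    (lintegral_mono fun ω => le_iSup (fun m => ‖r (Y m ω)‖ₑ) n).trans_lt hZ⟩

include hY hr hu hZ in
-- The events {τ ≥ n} decrease to a null set, and the value integrated over them is dominated by the
-- integral of sup |r(Y_m)| over the same events.
theorem IsChain.tendsto_setIntegral_value [IsProbabilityMeasure P] {τ : Ω → WithTop ℕ}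
    (hτ : IsStoppingTime ℱ τ)
    (hfin : ∀ᵐ ω ∂P, τ ω < ⊤) :
    Tendsto (fun n : ℕ => ∫ ω in {ω | τ ω < n}ᶜ, value K r (Y n ω) ∂P) atTop (𝓝 0) := by
  have hm : ∀ n : ℕ, MeasurableSet[ℱ n] {ω | τ ω < n}ᶜ := fun n => (hτ.measurableSet_lt n).compl
  have h0 : Tendsto (fun n : ℕ => ∫⁻ ω in {ω | τ ω < n}ᶜ, ⨆ m, ‖r (Y m ω)‖ₑ ∂P) atTop (𝓝 0) := by
    refine tendsto_setLIntegral_zero hZ.ne ?_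
    have hanti : Antitone fun n : ℕ => {ω | τ ω < n}ᶜ := by
      intro n m hnm ω hω
      simp only [Set.mem_compl_iff, Set.mem_ofPred_eq, not_lt] at hω ⊢
      exact le_trans (by exact_mod_cast hnm) hω
    have h1 := tendsto_measure_iInter_atTop (μ := P)
      (fun n => (ℱ.le n _ (hm n)).nullMeasurableSet) hanti ⟨0, measure_ne_top _ _⟩
    have h2 : P (⋂ n : ℕ, {ω | τ ω < n}ᶜ) = 0 := by
      refine measure_mono_null ?_ hfin
      intro ω hω hlt
      lift τ ω to ℕ using hlt.ne with k hk
      have := Set.mem_iInter.1 hω (k + 1)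
      simp only [Set.mem_compl_iff, Set.mem_ofPred_eq, ← hk, not_lt] at this
      exact absurd (WithTop.coe_le_coe.1 this) (by simp)
    rwa [h2] at h1
  refine tendsto_zero_iff_enorm_tendsto_zero.2 ?_
  refine tendsto_of_tendsto_of_tendsto_of_le_of_le tendsto_const_nhds h0 (fun _ => zero_le) ?_
  intro n
  exact (enorm_integral_le_lintegral_enorm _).trans
    ((lintegral_mono fun ω => enorm_value_le hr hu _).trans
      (hY.setLIntegral_envelope_le hr.enorm n (hm n)))

/-- The loss of a stopping rule at time `n`: what is lost by stopping, and by continuing. -/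
noncomputable def loss (K : Kernel S S) (r : S → ℝ) (P : Measure Ω) (Y : ℕ → Ω → S)
    (τ : Ω → WithTop ℕ) (n : ℕ) : ℝ :=
  ∫ ω in {ω | τ ω = n}, (value K r (Y n ω) - r (Y n ω)) ∂P +
  ∫ ω in {ω | n < τ ω}, (value K r (Y n ω) - ∫ y, value K r y ∂(K (Y n ω))) ∂P

include hr hu in
theorem reward_le_value (z : S) : r z ≤ value K r z := by
  rw [value_eq_max hr hu z]; exact le_max_left _ _

include hr hu in
theorem integral_value_le (z : S) : ∫ y, value K r y ∂(K z) ≤ value K r z := by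
  rw [value_eq_max hr hu z]; exact le_max_right _ _

include hr hu in
theorem loss_nonneg (τ : Ω → WithTop ℕ) (n : ℕ) : 0 ≤ loss K r P Y τ n :=
  add_nonneg (integral_nonneg fun _ => sub_nonneg.2 (reward_le_value hr hu _))
    (integral_nonneg fun _ => sub_nonneg.2 (integral_value_le hr hu _))

include hY hr hu hZ in
-- On {τ = n} the value is the reward plus the loss from stopping; on {τ > n} it is the expected
-- next value plus the loss from continuing, and the Markov step turns the expected next value into
-- the value at time `n + 1`.
theorem IsChain.setIntegral_value_eq [IsProbabilityMeasure P] {τ : Ω → WithTop ℕ}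
    (hτ : IsStoppingTime ℱ τ) (n : ℕ) :
    ∫ ω in {ω | τ ω < n}ᶜ, value K r (Y n ω) ∂P =
      ∫ ω in {ω | τ ω = n}, r (Y n ω) ∂P + loss K r P Y τ n +
      ∫ ω in {ω | τ ω < (n + 1 : ℕ)}ᶜ, value K r (Y (n + 1) ω) ∂P := by
  have hv := hY.integrable_value hr hu hZ
  have heq : MeasurableSet {ω | τ ω = n} := ℱ.le n _ (hτ.measurableSet_eq n)
  have hgt : MeasurableSet[ℱ n] {ω | n < τ ω} := hτ.measurableSet_gt n
  have hset : {ω | τ ω < n}ᶜ = {ω | τ ω = n} ∪ {ω | n < τ ω} := by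
    ext ω
    simp only [Set.mem_compl_iff, Set.mem_ofPred_eq, not_lt, Set.mem_union]
    rw [le_iff_eq_or_lt, eq_comm]
  have hset' : {ω | τ ω < (n + 1 : ℕ)}ᶜ = {ω | n < τ ω} := by
    ext ω
    induction h : τ ω using WithTop.recTopCoe with
    | top => simp [h]
    | coe k =>
      replace h : τ ω = (k : ℕ) := h
      simp only [Set.mem_compl_iff, Set.mem_ofPred_eq, not_lt, h]
      rw [Nat.cast_le, Nat.cast_lt]
      exact Nat.succ_le_iff
  have hdisj : Disjoint {ω | τ ω = n} {ω | n < τ ω} := by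
    rw [Set.disjoint_left]
    intro ω h1 h2
    exact (ne_of_gt h2) h1
  obtain ⟨hi, hst⟩ := hY.setIntegral_step n hgt (measurable_value K hr) (hv (n + 1)).integrableOn
  rw [hset', hset, setIntegral_union hdisj (ℱ.le n _ hgt) (hv n).integrableOn (hv n).integrableOn,
    hst, loss, integral_sub (hv n).integrableOn (hY.integrable_reward_at hr hZ n).integrableOn,
    integral_sub (hv n).integrableOn hi]
  ring

include hY hr hu hZ in
-- The one-step balance telescopes: the first `n` losses sum to the value at `z`, minus the reward
-- collected on {τ < n}, minus the value still outstanding on {τ ≥ n}, which tends to 0. Upper bound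
-- and optimality criterion both follow from nonnegativity of the losses.
theorem IsChain.hasSum_loss [IsProbabilityMeasure P] {τ : Ω → WithTop ℕ} (hτ : IsStoppingTime ℱ τ)
    (hfin : ∀ᵐ ω ∂P, τ ω < ⊤) :
    HasSum (loss K r P Y τ) (value K r z - ∫ ω, r (stoppedValue Y τ ω) ∂P) := by
  rw [hasSum_iff_tendsto_nat_of_nonneg (loss_nonneg hr hu τ)]
  have hlt : ∀ n : ℕ, MeasurableSet {ω | τ ω < n} := fun n => ℱ.le n _ (hτ.measurableSet_lt n)
  have hri := hY.integrable_reward hr hZ hτ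
  have hsum : ∀ n : ℕ, ∑ i ∈ Finset.range n, loss K r P Y τ i =
      value K r z - ∫ ω in {ω | τ ω < n}, r (stoppedValue Y τ ω) ∂P -
        ∫ ω in {ω | τ ω < n}ᶜ, value K r (Y n ω) ∂P := by
    intro n
    induction n with
    | zero => simp [hY.integral_start (measurable_value K hr)]
    | succ n ih =>
      have hset : {ω | τ ω < (n + 1 : ℕ)} = {ω | τ ω < n} ∪ {ω | τ ω = n} := by
        ext ω
        induction h : τ ω using WithTop.recTopCoe with
        | top => simp [h]
        | coe k =>
          replace h : τ ω = (k : ℕ) := h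
          simp only [Set.mem_ofPred_eq, Set.mem_union, h]
          rw [Nat.cast_lt, Nat.cast_lt, Nat.cast_inj]
          exact Nat.lt_succ_iff_lt_or_eq
      have hdisj : Disjoint {ω | τ ω < n} {ω | τ ω = n} := by
        rw [Set.disjoint_left]
        intro ω h1 h2
        exact (ne_of_lt h1) h2
      have heq : MeasurableSet {ω | τ ω = n} := ℱ.le n _ (hτ.measurableSet_eq n)
      have hr' : ∫ ω in {ω | τ ω = n}, r (stoppedValue Y τ ω) ∂P =
          ∫ ω in {ω | τ ω = n}, r (Y n ω) ∂P := by
        refine setIntegral_congr_fun heq fun ω hω => ?_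
        have hω' : τ ω = n := hω
        simp [stoppedValue, hω']
      have hU : ∫ ω in {ω | τ ω < (n + 1 : ℕ)}, r (stoppedValue Y τ ω) ∂P =
          ∫ ω in {ω | τ ω < n}, r (stoppedValue Y τ ω) ∂P +
          ∫ ω in {ω | τ ω = n}, r (Y n ω) ∂P := by
        rw [hset, setIntegral_union hdisj heq hri.integrableOn hri.integrableOn, hr']
      rw [Finset.sum_range_succ, ih, hU, hY.setIntegral_value_eq hr hu hZ hτ n]
      ring
  simp_rw [hsum]
  have h1 : Tendsto (fun n : ℕ => ∫ ω in {ω | τ ω < n}, r (stoppedValue Y τ ω) ∂P) atTop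
      (𝓝 (∫ ω, r (stoppedValue Y τ ω) ∂P)) := by
    have hmono : Monotone fun n : ℕ => {ω | τ ω < n} := fun n m hnm ω hω =>
      lt_of_lt_of_le (show τ ω < n from hω) (by exact_mod_cast hnm)
    have := tendsto_setIntegral_of_monotone hlt hmono hri.integrableOn
    rwa [setIntegral_congr_set (t := Set.univ), setIntegral_univ] at this
    rw [ae_eq_univ]
    refine measure_mono_null ?_ hfin
    intro ω hω hlt
    apply hω
    lift τ ω to ℕ using hlt.ne with k hk
    refine Set.mem_iUnion.2 ⟨k + 1, ?_⟩
    simp only [Set.mem_ofPred_eq, ← hk]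
    exact WithTop.coe_lt_coe.2 k.lt_succ_self
  have h2 := hY.tendsto_setIntegral_value hr hu hZ hτ hfin
  simpa using (tendsto_const_nhds.sub h1).sub h2

include hY hr hu hZ in
theorem IsChain.integral_reward_le [IsProbabilityMeasure P] {τ : Ω → WithTop ℕ}
    (hτ : IsStoppingTime ℱ τ)
    (hfin : ∀ᵐ ω ∂P, τ ω < ⊤) : ∫ ω, r (stoppedValue Y τ ω) ∂P ≤ value K r z :=
  sub_nonneg.1 ((hY.hasSum_loss hr hu hZ hτ hfin).nonneg (loss_nonneg hr hu τ))

include hY hr hu hZ in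
theorem IsChain.integral_reward_eq_iff [IsProbabilityMeasure P] {τ : Ω → WithTop ℕ}
    (hτ : IsStoppingTime ℱ τ)
    (hfin : ∀ᵐ ω ∂P, τ ω < ⊤) :
    ∫ ω, r (stoppedValue Y τ ω) ∂P = value K r z ↔ ∀ n, loss K r P Y τ n = 0 := by
  have h := hY.hasSum_loss hr hu hZ hτ hfin
  constructor
  · intro he
    rw [he, sub_self] at h
    exact fun n => congrFun ((hasSum_zero_iff_of_nonneg (loss_nonneg hr hu τ)).1 h) n
  · intro h0
    have h' : HasSum (loss K r P Y τ) 0 := by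
      rw [show loss K r P Y τ = fun _ => 0 from funext h0]; exact hasSum_zero
    exact (sub_eq_zero.1 (h.unique h')).symm

include hY hr hu hZ in
/-- A stopping rule is optimal if it stops only where stopping is optimal and continues only where
continuing is optimal. -/
theorem IsChain.integral_reward_eq [IsProbabilityMeasure P] {τ : Ω → WithTop ℕ}
    (hτ : IsStoppingTime ℱ τ)
    (hfin : ∀ᵐ ω ∂P, τ ω < ⊤)
    (hhalt : ∀ n : ℕ, ∀ᵐ ω ∂P, τ ω = n → value K r (Y n ω) = r (Y n ω))
    (hcont : ∀ n : ℕ, ∀ᵐ ω ∂P, n < τ ω →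
      value K r (Y n ω) = ∫ y, value K r y ∂(K (Y n ω))) :
    ∫ ω, r (stoppedValue Y τ ω) ∂P = value K r z := by
  rw [hY.integral_reward_eq_iff hr hu hZ hτ hfin]
  intro n
  have heq : MeasurableSet {ω | τ ω = n} := ℱ.le n _ (hτ.measurableSet_eq n)
  have hgt : MeasurableSet {ω | n < τ ω} := ℱ.le n _ (hτ.measurableSet_gt n)
  have h1 : ∫ ω in {ω | τ ω = n}, (value K r (Y n ω) - r (Y n ω)) ∂P = 0 := by
    refine setIntegral_eq_zero_of_ae_eq_zero ?_
    filter_upwards [hhalt n] with ω h hω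
    exact sub_eq_zero.2 (h hω)
  have h2 : ∫ ω in {ω | n < τ ω}, (value K r (Y n ω) - ∫ y, value K r y ∂(K (Y n ω))) ∂P = 0 := by
    refine setIntegral_eq_zero_of_ae_eq_zero ?_
    filter_upwards [hcont n] with ω h hω
    exact sub_eq_zero.2 (h hω)
  rw [loss, h1, h2, add_zero]

include hY hr hu hZ in
/-- An optimal stopping rule stops immediately only if stopping is optimal and continues at time `0`
only if continuing is optimal. -/
theorem IsChain.optimal_at_start [IsProbabilityMeasure P] {τ : Ω → WithTop ℕ}
    (hτ : IsStoppingTime ℱ τ)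
    (hfin : ∀ᵐ ω ∂P, τ ω < ⊤) (hopt : ∫ ω, r (stoppedValue Y τ ω) ∂P = value K r z) :
    (P {ω | τ ω = 0} ≠ 0 → value K r z = r z) ∧
    (P {ω | 0 < τ ω} ≠ 0 → value K r z = ∫ y, value K r y ∂(K z)) := by
  have h0 := (hY.integral_reward_eq_iff hr hu hZ hτ hfin).1 hopt 0
  -- Singletons of `S` need not be measurable, so the initial condition is used only through real
  -- functions of `Y 0`.
  have hae : ∀ {ψ : S → ℝ}, Measurable ψ → ∀ᵐ ω ∂P, ψ (Y 0 ω) = ψ z := by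
    intro ψ hψ
    have hs : MeasurableSet {y | ψ y = ψ z} := hψ (measurableSet_singleton _)
    have : ∀ᵐ y ∂(P.map (Y 0)), ψ y = ψ z := by
      rw [hY.start, ae_dirac_iff hs]
    exact ae_of_ae_map (hY.measurable 0).aemeasurable this
  have hKv : Measurable fun z => ∫ y, value K r y ∂(K z) :=
    ((measurable_value K hr).stronglyMeasurable.integral_kernel (κ := K)).measurable
  -- At time 0 both integrands are constant, so the loss is P(τ = 0)(v - r)(z) + P(τ > 0)(v -
  -- Kv)(z), with nonnegative summands.
  have h1 : ∫ ω in {ω | τ ω = (0 : ℕ)}, (value K r (Y 0 ω) - r (Y 0 ω)) ∂P =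
      P.real {ω | τ ω = 0} * (value K r z - r z) := by
    rw [← smul_eq_mul, ← setIntegral_const]
    refine integral_congr_ae (ae_restrict_of_ae ?_)
    filter_upwards [hae (measurable_value K hr), hae hr] with ω h1 h2
    rw [h1, h2]
  have h2 : ∫ ω in {ω | (0 : ℕ) < τ ω}, (value K r (Y 0 ω) - ∫ y, value K r y ∂(K (Y 0 ω))) ∂P =
      P.real {ω | 0 < τ ω} * (value K r z - ∫ y, value K r y ∂(K z)) := by
    rw [← smul_eq_mul, ← setIntegral_const]
    refine integral_congr_ae (ae_restrict_of_ae ?_)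
    filter_upwards [hae (measurable_value K hr), hae hKv] with ω h1 h2
    rw [h1, h2]
  rw [loss, h1, h2] at h0
  have p1 := mul_nonneg (measureReal_nonneg (μ := P) (s := {ω | τ ω = 0}))
    (sub_nonneg.2 (reward_le_value hr hu z))
  have p2 := mul_nonneg (measureReal_nonneg (μ := P) (s := {ω | 0 < τ ω}))
    (sub_nonneg.2 (integral_value_le hr hu z))
  have q1 := (add_eq_zero_iff_of_nonneg p1 p2).1 h0
  have hne : ∀ s : Set Ω, P s ≠ 0 → P.real s ≠ 0 := fun s hs h =>
    hs ((measureReal_eq_zero_iff (measure_ne_top _ _)).1 h)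
  exact ⟨fun h => sub_eq_zero.1 ((mul_eq_zero.1 q1.1).resolve_left (hne _ h)),
    fun h => sub_eq_zero.1 ((mul_eq_zero.1 q1.2).resolve_left (hne _ h))⟩

end Verification

end OptimalStopping

namespace DynkinGame

open Filter Topology
open scoped ENNReal

/-! ### Resampling one coordinate of an i.i.d. sequence. -/

section Resample

theorem indepFun_comp_of_map {Ω Ω' β β' : Type*} [MeasurableSpace Ω] [MeasurableSpace Ω']
    [MeasurableSpace β] [MeasurableSpace β'] {P : Measure Ω} {T : Ω → Ω'} (hT : Measurable T)
    {f : Ω' → β} {g : Ω' → β'} (hf : Measurable f) (hg : Measurable g)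
    (h : IndepFun f g (P.map T)) : IndepFun (f ∘ T) (g ∘ T) P := by
  rw [indepFun_iff_measure_inter_preimage_eq_mul] at h ⊢
  intro s t hs ht
  have := h s t hs ht
  rwa [Measure.map_apply hT ((hf hs).inter (hg ht)), Measure.map_apply hT (hf hs),
    Measure.map_apply hT (hg ht)] at this

variable {N : Type*} [MeasurableSpace N] (ν : Measure N) [IsProbabilityMeasure ν]

theorem measurable_update_pair (n : ℕ) :
    Measurable fun p : N × (ℕ → N) => Function.update p.2 n p.1 := by
  refine measurable_pi_lambda _ fun k => ?_
  by_cases hk : k = n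
  · subst hk; simpa using measurable_fst
  · simp only [Function.update_of_ne hk]
    fun_prop

/-- A fresh draw in coordinate `n` does not change the product law; it suffices to compare both
measures on finite boxes. -/
theorem measurePreserving_update (n : ℕ) :
    MeasurePreserving (fun p : N × (ℕ → N) => Function.update p.2 n p.1)
      (ν.prod (Measure.infinitePi fun _ : ℕ => ν)) (Measure.infinitePi fun _ : ℕ => ν) := by
  refine ⟨measurable_update_pair n, ?_⟩
  refine Measure.eq_infinitePi _ fun s t ht => ?_
  rw [Measure.map_apply (measurable_update_pair n) (.pi s.countable_toSet fun _ _ => ht _)]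
  have hpre : (fun p : N × (ℕ → N) => Function.update p.2 n p.1) ⁻¹' ((s : Set ℕ).pi t) =
      (if n ∈ s then t n else Set.univ) ×ˢ ((s.erase n : Finset ℕ) : Set ℕ).pi t := by
    ext ⟨a, η⟩
    simp only [Set.mem_preimage, Set.mem_pi, Finset.mem_coe, Set.mem_prod, Finset.mem_erase]
    constructor
    · intro h
      refine ⟨?_, fun i hi => ?_⟩
      · split_ifs with hn
        · simpa using h n hn
        · trivial
      · simpa [Function.update_of_ne hi.1] using h i hi.2
    · rintro ⟨h1, h2⟩ i hi
      by_cases hin : i = n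
      · subst hin
        simpa [hi] using h1
      · simpa [Function.update_of_ne hin] using h2 i ⟨hin, hi⟩
  rw [hpre, Measure.prod_prod, Measure.infinitePi_pi _ (fun i _ => ht i)]
  split_ifs with hn
  · exact Finset.mul_prod_erase s (fun i => ν (t i)) hn
  · rw [measure_univ, one_mul, Finset.erase_eq_of_notMem hn]

/-- Here `q` is the part of the `n`-th noise to be isolated and `s` what is kept of that noise.
Redraw the coordinate: with everything else fixed, the joint event constrains only `q` and `s` of
the fresh draw, and these are independent under `ν`. -/
theorem indepFun_resample {Ξ B : Type*} [MeasurableSpace Ξ] [MeasurableSpace B] (μ : Measure Ξ)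
    [IsProbabilityMeasure μ] (n : ℕ) {q : N → B} (hq : Measurable q) {s : N → N} (hs : Measurable s)
    (h : IndepFun q s ν) :
    IndepFun (fun p : Ξ × (ℕ → N) => q (p.2 n))
      (fun p : Ξ × (ℕ → N) => (p.1, Function.update p.2 n (s (p.2 n))))
      (μ.prod (Measure.infinitePi fun _ : ℕ => ν)) := by
  set π := Measure.infinitePi fun _ : ℕ => ν
  have hcoord : Measurable fun p : Ξ × (ℕ → N) => p.2 n :=
    (measurable_pi_apply n).comp measurable_snd
  have hf : Measurable fun p : Ξ × (ℕ → N) => q (p.2 n) := hq.comp hcoord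
  have hg : Measurable fun p : Ξ × (ℕ → N) => (p.1, Function.update p.2 n (s (p.2 n))) :=
    measurable_fst.prodMk ((measurable_update_pair n).comp ((hs.comp hcoord).prodMk measurable_snd))
  have hR : MeasurePreserving (fun p : (Ξ × (ℕ → N)) × N => (p.1.1, Function.update p.1.2 n p.2))
      ((μ.prod π).prod ν) (μ.prod π) := by
    have h1 := (MeasurePreserving.id μ).prod
      ((measurePreserving_update ν n).comp (Measure.measurePreserving_swap (μ := π) (ν := ν)))
    exact h1.comp (measurePreserving_prodAssoc μ π ν)
  rw [indepFun_iff_measure_inter_preimage_eq_mul] at h ⊢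
  intro S T hS hT
  have key : ∀ (S : Set B) (T : Set (Ξ × (ℕ → N))), MeasurableSet S → MeasurableSet T →
      (μ.prod π) ((fun p : Ξ × (ℕ → N) => q (p.2 n)) ⁻¹' S ∩
        (fun p : Ξ × (ℕ → N) => (p.1, Function.update p.2 n (s (p.2 n)))) ⁻¹' T) =
      ν (q ⁻¹' S) * ∫⁻ p, ν (s ⁻¹' {a | (p.1, Function.update p.2 n a) ∈ T}) ∂(μ.prod π) := by
    intro S T hS hT
    have hTs : ∀ p : Ξ × (ℕ → N), MeasurableSet {a | (p.1, Function.update p.2 n a) ∈ T} :=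
      fun p => hT.preimage
        (measurable_const.prodMk ((measurable_update_pair n).comp
          (measurable_id.prodMk measurable_const)))
    have hm : MeasurableSet ((fun p : Ξ × (ℕ → N) => q (p.2 n)) ⁻¹' S ∩
        (fun p : Ξ × (ℕ → N) => (p.1, Function.update p.2 n (s (p.2 n)))) ⁻¹' T) :=
      (hf hS).inter (hg hT)
    rw [← hR.measure_preimage hm.nullMeasurableSet, Measure.prod_apply (hR.measurable hm),
      ← lintegral_const_mul' _ _ (measure_ne_top _ _)]
    refine lintegral_congr fun p => ?_
    rw [← h _ _ hS (hTs p)]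
    congr 1
    ext a
    simp
  rw [key S T hS hT]
  -- The two marginal probabilities are the special cases of `key` with one set trivial; comparing
  -- them with the joint formula gives the product.
  have h1 := key Set.univ T MeasurableSet.univ hT
  have h2 := key S Set.univ hS MeasurableSet.univ
  simp only [Set.preimage_univ, Set.univ_inter, measure_univ, one_mul] at h1
  simp only [Set.preimage_univ, Set.inter_univ, Set.mem_univ, Set.ofPred_true, measure_univ,
    lintegral_one, mul_one] at h2
  rw [h1, h2]

end Resample

/-- The Ionescu-Tulcea law restricted to times up to `n + 1` is the law up to `n` composed with the
last kernel. The function sees the whole past because events of the filtration do. -/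
theorem lintegral_chainLaw_succ {S : Type*} [MeasurableSpace S] (κ : Kernel S S) [IsMarkovKernel κ]
    (x : S) (n : ℕ) {F : (Finset.Iic n → S) × S → ℝ≥0∞} (hF : Measurable F) :
    ∫⁻ X, F (Preorder.frestrictLe (π := fun _ => S) n X, X (n + 1)) ∂(chainLaw κ x) =
      ∫⁻ X, ∫⁻ y, F (Preorder.frestrictLe (π := fun _ => S) n X, y) ∂(κ (X n)) ∂(chainLaw κ x) := by
  unfold chainLaw
  set K := (fun n : ℕ => κ.comap (fun h : (Finset.Iic n → S) => h ⟨n, Finset.mem_Iic.2 le_rfl⟩)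
      (measurable_pi_apply _)) with hK
  have h := Kernel.partialTraj_compProd_eq_map_traj (X := fun _ => S) (κ := K) (Nat.zero_le n)
    (x₀ := fun _ => x)
  have hmeas : Measurable fun X : ℕ → S => (Preorder.frestrictLe (π := fun _ => S) n X, X (n + 1)) := by
    fun_prop
  rw [← lintegral_map hF hmeas, ← h, Measure.lintegral_compProd hF,
    ← Kernel.traj_map_frestrictLe_apply, lintegral_map hF.lintegral_kernel_prod_right'
      (by fun_prop)]
  rfl

theorem map_zero_chainLaw {S : Type*} [MeasurableSpace S] (κ : Kernel S S) [IsMarkovKernel κ]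
    (x : S) : (chainLaw κ x).map (fun X => X 0) = Measure.dirac x := by
  unfold chainLaw
  have h1 : (fun X : ℕ → S => X 0) = (fun h : Finset.Iic 0 → S => h ⟨0, Finset.mem_Iic.2 le_rfl⟩) ∘
      (Preorder.frestrictLe (π := fun _ => S) 0) := rfl
  rw [h1, ← Measure.map_map (measurable_pi_apply _) (by fun_prop),
    Kernel.traj_map_frestrictLe_apply, Kernel.partialTraj_self, Kernel.id_apply,
    Measure.map_dirac' (measurable_pi_apply _)]

/-! ### Independence of device, coin and next state in the game space. -/

namespace GameSpace

variable {E Ω : Type*} [MeasurableSpace E] [mΩ : MeasurableSpace Ω] {κ : Kernel E E}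
  [IsMarkovKernel κ] {α : unitInterval} (G : GameSpace κ α Ω)

/-- The law of the noise at one time. -/
noncomputable abbrev noiseLaw (α : unitInterval) : Measure (unitInterval × unitInterval × Bool) :=
  (volume : Measure unitInterval).prod
    ((volume : Measure unitInterval).prod (bernoulliMeasure true false α))

/-- The chain and the noise. -/
def data (ω : Ω) : (ℕ → E) × (ℕ → unitInterval × unitInterval × Bool) :=
  (fun n => G.X n ω, fun n => (G.ξ₁ n ω, G.ξ₂ n ω, G.c n ω))

theorem measurable_data : Measurable G.data :=
  (measurable_pi_lambda _ G.measurable_X).prodMk (measurable_pi_lambda _ fun n =>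
    (G.measurable_ξ₁ n).prodMk ((G.measurable_ξ₂ n).prodMk (G.measurable_c n)))

instance : IsProbabilityMeasure (chainLaw κ x) := by
  unfold chainLaw; infer_instance

theorem map_data (x : E) : (G.P x).map G.data =
    (chainLaw κ x).prod (Measure.infinitePi fun _ : ℕ => noiseLaw α) := G.law x

instance (x : E) : IsProbabilityMeasure (G.P x) := by
  constructor
  have h := congrArg (fun μ => μ Set.univ) (G.map_data x)
  simpa [Measure.map_apply G.measurable_data MeasurableSet.univ] using h

theorem map_X_zero (x : E) : (G.P x).map (G.X 0) = Measure.dirac x := by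
  have h1 : G.X 0 = (fun X => X 0) ∘ Prod.fst ∘ G.data := rfl
  rw [h1, ← Measure.map_map (measurable_pi_apply 0) (measurable_fst.comp G.measurable_data),
    ← Measure.map_map measurable_fst G.measurable_data, G.map_data, Measure.map_fst_prod,
    measure_univ, one_smul, map_zero_chainLaw]

/-- The data without the coin at time `n`. -/
def forgetCoin (n : ℕ) (ω : Ω) : (ℕ → E) × (ℕ → unitInterval × unitInterval × Bool) :=
  ((G.data ω).1, Function.update (G.data ω).2 n
    (((G.data ω).2 n).1, ((G.data ω).2 n).2.1, true))

/-- The data without the randomization device of player 2 at time `n`. -/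
def forgetDevice (n : ℕ) (ω : Ω) : (ℕ → E) × (ℕ → unitInterval × unitInterval × Bool) :=
  ((G.data ω).1, Function.update (G.data ω).2 n
    (((G.data ω).2 n).1, 0, ((G.data ω).2 n).2.2))

/-- The chain up to time `n`, and all the noise. -/
def forgetFuture (n : ℕ) (ω : Ω) :
    (Finset.Iic n → E) × (ℕ → unitInterval × unitInterval × Bool) :=
  (Preorder.frestrictLe (π := fun _ => E) n (G.data ω).1, (G.data ω).2)

/-- Everything but the coin at time `n`. -/
abbrev exceptCoin (n : ℕ) : MeasurableSpace Ω :=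
  MeasurableSpace.comap (G.forgetCoin n) inferInstance

/-- Everything but the randomization device of player 2 at time `n`. -/
abbrev exceptDevice (n : ℕ) : MeasurableSpace Ω :=
  MeasurableSpace.comap (G.forgetDevice n) inferInstance

/-- The `σ`-algebra of the chain up to time `n` and all the noise. -/
abbrev pastAndNoise (n : ℕ) : MeasurableSpace Ω :=
  MeasurableSpace.comap (G.forgetFuture n) inferInstance

section

variable {G}

omit mΩ in
theorem measurable_comap_of_eq {β γ : Type*} [MeasurableSpace β] [MeasurableSpace γ] {W : Ω → β}
    {f : Ω → γ} (k : β → γ) (hk : Measurable k) (h : ∀ ω, f ω = k (W ω)) :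
    Measurable[MeasurableSpace.comap W inferInstance] f := by
  rw [show f = k ∘ W from funext h]
  exact hk.comp (comap_measurable W)

theorem measurable_exceptCoin_X (n k : ℕ) : Measurable[G.exceptCoin n] (G.X k) :=
  measurable_comap_of_eq (fun p : (ℕ → E) × (ℕ → unitInterval × unitInterval × Bool) => p.1 k)
    (by fun_prop) fun _ => rfl

theorem measurable_exceptCoin_ξ₁ (n k : ℕ) : Measurable[G.exceptCoin n] (G.ξ₁ k) :=
  measurable_comap_of_eq (fun p : (ℕ → E) × (ℕ → unitInterval × unitInterval × Bool) => (p.2 k).1)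
    (by fun_prop) fun ω => by
    by_cases h : k = n
    · subst h; simp [forgetCoin, data]
    · simp [forgetCoin, Function.update_of_ne h, data]

theorem measurable_exceptCoin_ξ₂ (n k : ℕ) : Measurable[G.exceptCoin n] (G.ξ₂ k) :=
  measurable_comap_of_eq (fun p : (ℕ → E) × (ℕ → unitInterval × unitInterval × Bool) => (p.2 k).2.1)
    (by fun_prop) fun ω => by
    by_cases h : k = n
    · subst h; simp [forgetCoin, data]
    · simp [forgetCoin, Function.update_of_ne h, data]

theorem measurable_exceptCoin_c {n k : ℕ} (h : k ≠ n) : Measurable[G.exceptCoin n] (G.c k) :=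
  measurable_comap_of_eq (fun p : (ℕ → E) × (ℕ → unitInterval × unitInterval × Bool) => (p.2 k).2.2)
    (by fun_prop) fun ω => by
    simp [forgetCoin, Function.update_of_ne h, data]

theorem measurable_exceptDevice_X (n k : ℕ) : Measurable[G.exceptDevice n] (G.X k) :=
  measurable_comap_of_eq (fun p : (ℕ → E) × (ℕ → unitInterval × unitInterval × Bool) => p.1 k)
    (by fun_prop) fun _ => rfl

theorem measurable_exceptDevice_ξ₁ (n k : ℕ) : Measurable[G.exceptDevice n] (G.ξ₁ k) :=
  measurable_comap_of_eq (fun p : (ℕ → E) × (ℕ → unitInterval × unitInterval × Bool) => (p.2 k).1)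
    (by fun_prop) fun ω => by
    by_cases h : k = n
    · subst h; simp [forgetDevice, data]
    · simp [forgetDevice, Function.update_of_ne h, data]

theorem measurable_exceptDevice_ξ₂ {n k : ℕ} (h : k ≠ n) : Measurable[G.exceptDevice n] (G.ξ₂ k) :=
  measurable_comap_of_eq (fun p : (ℕ → E) × (ℕ → unitInterval × unitInterval × Bool) => (p.2 k).2.1)
    (by fun_prop) fun ω => by
    simp [forgetDevice, Function.update_of_ne h, data]

theorem measurable_exceptDevice_c (n k : ℕ) : Measurable[G.exceptDevice n] (G.c k) :=
  measurable_comap_of_eq (fun p : (ℕ → E) × (ℕ → unitInterval × unitInterval × Bool) => (p.2 k).2.2)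
    (by fun_prop) fun ω => by
    by_cases h : k = n
    · subst h; simp [forgetDevice, data]
    · simp [forgetDevice, Function.update_of_ne h, data]

theorem measurable_pastAndNoise_X {n k : ℕ} (h : k ≤ n) : Measurable[G.pastAndNoise n] (G.X k) :=
  measurable_comap_of_eq (fun p : (Finset.Iic n → E) × (ℕ → unitInterval × unitInterval × Bool) => p.1 ⟨k, Finset.mem_Iic.2 h⟩)
    (by fun_prop) fun _ => rfl

theorem measurable_pastAndNoise_ξ₁ (n k : ℕ) : Measurable[G.pastAndNoise n] (G.ξ₁ k) :=
  measurable_comap_of_eq (fun p : (Finset.Iic n → E) × (ℕ → unitInterval × unitInterval × Bool) => (p.2 k).1)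
    (by fun_prop) fun _ => rfl

theorem measurable_pastAndNoise_ξ₂ (n k : ℕ) : Measurable[G.pastAndNoise n] (G.ξ₂ k) :=
  measurable_comap_of_eq (fun p : (Finset.Iic n → E) × (ℕ → unitInterval × unitInterval × Bool) => (p.2 k).2.1)
    (by fun_prop) fun _ => rfl

theorem measurable_pastAndNoise_c (n k : ℕ) : Measurable[G.pastAndNoise n] (G.c k) :=
  measurable_comap_of_eq (fun p : (Finset.Iic n → E) × (ℕ → unitInterval × unitInterval × Bool) => (p.2 k).2.2)
    (by fun_prop) fun _ => rfl

end

theorem measurable_forget {Ξ N : Type*} [MeasurableSpace Ξ] [MeasurableSpace N] (n : ℕ) {s : N → N}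
    (hs : Measurable s) :
    Measurable fun p : Ξ × (ℕ → N) => (p.1, Function.update p.2 n (s (p.2 n))) :=
  measurable_fst.prodMk ((measurable_update_pair n).comp
    ((hs.comp ((measurable_pi_apply n).comp measurable_snd)).prodMk measurable_snd))

theorem exceptCoin_le (n : ℕ) : G.exceptCoin n ≤ mΩ :=
  measurable_iff_comap_le.1 ((measurable_forget n
    (s := fun a : unitInterval × unitInterval × Bool => (a.1, a.2.1, true)) (by fun_prop)).comp
      G.measurable_data)

theorem exceptDevice_le (n : ℕ) : G.exceptDevice n ≤ mΩ :=
  measurable_iff_comap_le.1 ((measurable_forget n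
    (s := fun a : unitInterval × unitInterval × Bool => (a.1, 0, a.2.2)) (by fun_prop)).comp
      G.measurable_data)

/-- Within one noise triple, rebracketing the product isolates the coin as the last factor;
resampling carries this to the whole data. -/
theorem indep_coin (x : E) (n : ℕ) :
    Indep (MeasurableSpace.comap (G.c n) inferInstance) (G.exceptCoin n) (G.P x) := by
  have hν : IndepFun (fun a : unitInterval × unitInterval × Bool => a.2.2)
      (fun a => (a.1, a.2.1, true)) (noiseLaw α) := by
    have h := indepFun_prod (μ := (volume : Measure unitInterval).prod (volume : Measure unitInterval))
      (ν := bernoulliMeasure true false α)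
      (X := fun a => (a.1, a.2, true)) (Y := id) (by fun_prop) (by fun_prop)
    have hmp := (measurePreserving_prodAssoc (volume : Measure unitInterval)
      (volume : Measure unitInterval) (bernoulliMeasure true false α)).symm
    rw [← hmp.map_eq] at h
    exact (indepFun_comp_of_map hmp.measurable (by fun_prop) (by fun_prop) h).symm
  have h := indepFun_resample (noiseLaw α) (chainLaw κ x) n (by fun_prop)
    (Measurable.prodMk (by fun_prop) (by fun_prop)) hν
  rw [← G.map_data] at h
  exact indepFun_comp_of_map G.measurable_data (by fun_prop)
    (measurable_forget n (s := fun a : unitInterval × unitInterval × Bool => (a.1, a.2.1, true))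
      (by fun_prop)) h

theorem indep_device (x : E) (n : ℕ) :
    Indep (MeasurableSpace.comap (G.ξ₂ n) inferInstance) (G.exceptDevice n) (G.P x) := by
  have hν : IndepFun (fun a : unitInterval × unitInterval × Bool => a.2.1)
      (fun a => (a.1, (0 : unitInterval), a.2.2)) (noiseLaw α) := by
    -- The device of player 2 is the middle factor. Since both devices have the same law, exchanging
    -- them preserves the noise law and brings it to the front.
    have hmp : MeasurePreserving
        (fun a : unitInterval × unitInterval × Bool => (a.2.1, (a.1, a.2.2)))
        (noiseLaw α) (noiseLaw α) := by
      have e1 := (measurePreserving_prodAssoc (volume : Measure unitInterval)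
        (volume : Measure unitInterval) (bernoulliMeasure true false α)).symm
      have e2 := (Measure.measurePreserving_swap (μ := (volume : Measure unitInterval))
        (ν := (volume : Measure unitInterval))).prod
        (MeasurePreserving.id (bernoulliMeasure true false α))
      have e3 := measurePreserving_prodAssoc (volume : Measure unitInterval)
        (volume : Measure unitInterval) (bernoulliMeasure true false α)
      exact e3.comp (e2.comp e1)
    have h3 := indepFun_prod (μ := (volume : Measure unitInterval))
      (ν := (volume : Measure unitInterval).prod (bernoulliMeasure true false α))
      (X := id) (Y := fun a => (a.1, (0 : unitInterval), a.2)) (by fun_prop) (by fun_prop)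
    change IndepFun _ _ (noiseLaw α) at h3
    rw [← hmp.map_eq] at h3
    exact indepFun_comp_of_map hmp.measurable (by fun_prop) (by fun_prop) h3
  have h := indepFun_resample (noiseLaw α) (chainLaw κ x) n (by fun_prop)
    (Measurable.prodMk (by fun_prop) (by fun_prop)) hν
  rw [← G.map_data] at h
  exact indepFun_comp_of_map G.measurable_data (by fun_prop)
    (measurable_forget n (s := fun a : unitInterval × unitInterval × Bool => (a.1, 0, a.2.2))
      (by fun_prop)) h

theorem map_noise (x : E) (n : ℕ) :
    (G.P x).map (fun ω => (G.ξ₁ n ω, G.ξ₂ n ω, G.c n ω)) = noiseLaw α := by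
  have h1 : (fun ω => (G.ξ₁ n ω, G.ξ₂ n ω, G.c n ω)) = (fun η => η n) ∘ Prod.snd ∘ G.data := rfl
  rw [h1, ← Measure.map_map (measurable_pi_apply n) (measurable_snd.comp G.measurable_data),
    ← Measure.map_map measurable_snd G.measurable_data, G.map_data, Measure.map_snd_prod,
    measure_univ, one_smul, Measure.infinitePi_map_eval]

theorem measurable_noise (n : ℕ) : Measurable fun ω => (G.ξ₁ n ω, G.ξ₂ n ω, G.c n ω) :=
  (G.measurable_ξ₁ n).prodMk ((G.measurable_ξ₂ n).prodMk (G.measurable_c n))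

theorem map_ξ₁ (x : E) (n : ℕ) : (G.P x).map (G.ξ₁ n) = volume := by
  have h1 : G.ξ₁ n = Prod.fst ∘ fun ω => (G.ξ₁ n ω, G.ξ₂ n ω, G.c n ω) := rfl
  rw [h1, ← Measure.map_map measurable_fst (G.measurable_noise n), G.map_noise,
    Measure.map_fst_prod, measure_univ, one_smul]

theorem map_ξ₂ (x : E) (n : ℕ) : (G.P x).map (G.ξ₂ n) = volume := by
  have h1 : G.ξ₂ n = Prod.fst ∘ Prod.snd ∘ fun ω => (G.ξ₁ n ω, G.ξ₂ n ω, G.c n ω) := rfl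
  rw [h1, ← Measure.map_map measurable_fst (measurable_snd.comp (G.measurable_noise n)),
    ← Measure.map_map measurable_snd (G.measurable_noise n), G.map_noise,
    Measure.map_snd_prod, measure_univ, one_smul, Measure.map_fst_prod, measure_univ, one_smul]

theorem map_c (x : E) (n : ℕ) : (G.P x).map (G.c n) = bernoulliMeasure true false α := by
  have h1 : G.c n = Prod.snd ∘ Prod.snd ∘ fun ω => (G.ξ₁ n ω, G.ξ₂ n ω, G.c n ω) := rfl
  rw [h1, ← Measure.map_map measurable_snd (measurable_snd.comp (G.measurable_noise n)),
    ← Measure.map_map measurable_snd (G.measurable_noise n), G.map_noise,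
    Measure.map_snd_prod, measure_univ, one_smul, Measure.map_snd_prod, measure_univ, one_smul]

theorem measure_coin (x : E) (n : ℕ) (b : Bool) :
    G.P x {ω | G.c n ω = b} = ENNReal.ofReal (if b then α else 1 - α) := by
  have h : G.P x {ω | G.c n ω = b} = (bernoulliMeasure true false α) {b} := by
    rw [← G.map_c x n, Measure.map_apply (G.measurable_c n) (measurableSet_singleton b)]
    rfl
  rw [h, ← ofReal_measureReal, bernoulliMeasure_real_apply α (measurableSet_singleton b)]
  cases b <;> simp

theorem setLIntegral_coin (x : E) (n : ℕ) (b : Bool) {D : Ω → ℝ≥0∞}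
    (hD : Measurable[G.exceptCoin n] D) :
    ∫⁻ ω in {ω | G.c n ω = b}, D ω ∂(G.P x) =
      ENNReal.ofReal (if b then α else 1 - α) * ∫⁻ ω, D ω ∂(G.P x) := by
  have hs : MeasurableSet {ω | G.c n ω = b} := G.measurable_c n (measurableSet_singleton b)
  rw [← lintegral_indicator hs, ← G.measure_coin x n b]
  have h := lintegral_mul_eq_lintegral_mul_lintegral_of_independent_measurableSpace
    (μ := G.P x) (Mf := MeasurableSpace.comap (G.c n) inferInstance) (Mg := G.exceptCoin n)
    (f := {ω | G.c n ω = b}.indicator 1) (g := D)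
    (measurable_iff_comap_le.1 (G.measurable_c n)) (G.exceptCoin_le n) (G.indep_coin x n)
    ((@measurable_one _ _ _ (MeasurableSpace.comap (G.c n) inferInstance) _).indicator
      ⟨{b}, measurableSet_singleton b, rfl⟩) hD
  rw [lintegral_indicator_one hs] at h
  rw [← h]
  congr 1
  funext ω
  by_cases hω : ω ∈ {ω | G.c n ω = b} <;> simp [hω]

/-- By independence the threshold and the weight can be frozen while the uniform device is
integrated out, so the two events contribute the lengths of [0, a] and (a, 1]. -/
theorem setLIntegral_device (x : E) (n : ℕ) {a : Ω → unitInterval} {D : Ω → ℝ≥0∞}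
    (ha : Measurable[G.exceptDevice n] a) (hD : Measurable[G.exceptDevice n] D) :
    ∫⁻ ω in {ω | G.ξ₂ n ω ≤ a ω}, D ω ∂(G.P x) =
      ∫⁻ ω, ENNReal.ofReal (a ω) * D ω ∂(G.P x) ∧
    ∫⁻ ω in {ω | a ω < G.ξ₂ n ω}, D ω ∂(G.P x) =
      ∫⁻ ω, ENNReal.ofReal (1 - a ω) * D ω ∂(G.P x) := by
  have ha' := ha.mono (G.exceptDevice_le n) le_rfl
  have hD' := hD.mono (G.exceptDevice_le n) le_rfl
  have haD : Measurable[G.exceptDevice n] fun ω => (a ω, D ω) := ha.prodMk hD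
  have haD' : Measurable fun ω => (a ω, D ω) := ha'.prodMk hD'
  have hind : IndepFun (G.ξ₂ n) (fun ω => (a ω, D ω)) (G.P x) :=
    indep_of_indep_of_le_right (G.indep_device x n) (measurable_iff_comap_le.1 haD)
  have hmap := hind.map_prod_eq_prod_map_map (G.measurable_ξ₂ n).aemeasurable haD'.aemeasurable
  rw [G.map_ξ₂] at hmap
  have key : ∀ (Φ : unitInterval × (unitInterval × ℝ≥0∞) → ℝ≥0∞), Measurable Φ →
      ∫⁻ ω, Φ (G.ξ₂ n ω, a ω, D ω) ∂(G.P x) =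
        ∫⁻ ω, (∫⁻ u : unitInterval, Φ (u, a ω, D ω)) ∂(G.P x) := by
    intro Φ hΦ
    rw [← lintegral_map hΦ ((G.measurable_ξ₂ n).prodMk haD'), hmap, lintegral_prod_symm' _ hΦ,
      lintegral_map hΦ.lintegral_prod_left' haD']
  constructor
  · have hs : MeasurableSet {p : unitInterval × (unitInterval × ℝ≥0∞) | p.1 ≤ p.2.1} :=
      measurableSet_le (by fun_prop) (by fun_prop)
    have h := key ({p | p.1 ≤ p.2.1}.indicator fun p => p.2.2)
      ((by fun_prop : Measurable fun p : unitInterval × (unitInterval × ℝ≥0∞) => p.2.2).indicator hs)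
    rw [← lintegral_indicator (measurableSet_le (G.measurable_ξ₂ n) ha')]
    refine Eq.trans ?_ (h.trans ?_)
    · rfl
    · refine lintegral_congr fun ω => ?_
      have : (fun u : unitInterval => ({p : unitInterval × (unitInterval × ℝ≥0∞) |
          p.1 ≤ p.2.1}.indicator fun p => p.2.2) (u, a ω, D ω)) =
          (Set.Iic (a ω)).indicator fun _ => D ω := rfl
      rw [this, lintegral_indicator_const measurableSet_Iic, unitInterval.volume_Iic, mul_comm]
  · have hs : MeasurableSet {p : unitInterval × (unitInterval × ℝ≥0∞) | p.2.1 < p.1} :=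
      measurableSet_lt (by fun_prop) (by fun_prop)
    have h := key ({p | p.2.1 < p.1}.indicator fun p => p.2.2)
      ((by fun_prop : Measurable fun p : unitInterval × (unitInterval × ℝ≥0∞) => p.2.2).indicator hs)
    rw [← lintegral_indicator (measurableSet_lt ha' (G.measurable_ξ₂ n))]
    refine Eq.trans ?_ (h.trans ?_)
    · rfl
    · refine lintegral_congr fun ω => ?_
      have : (fun u : unitInterval => ({p : unitInterval × (unitInterval × ℝ≥0∞) |
          p.2.1 < p.1}.indicator fun p => p.2.2) (u, a ω, D ω)) =
          (Set.Ioi (a ω)).indicator fun _ => D ω := rfl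
      rw [this, lintegral_indicator_const measurableSet_Ioi, unitInterval.volume_Ioi, mul_comm]

/-- Conditioning on the whole noise, future included, is harmless because the noise is independent
of the chain: fix a noise sequence and apply the Markov property of `X` on that slice. -/
theorem setLIntegral_X_succ (x : E) (n : ℕ) {A : Set Ω} (hA : MeasurableSet[G.pastAndNoise n] A)
    {φ : E → ℝ≥0∞} (hφ : Measurable φ) :
    ∫⁻ ω in A, φ (G.X (n + 1) ω) ∂(G.P x) = ∫⁻ ω in A, ∫⁻ y, φ y ∂(κ (G.X n ω)) ∂(G.P x) := by
  obtain ⟨B, hB, rfl⟩ := hA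
  have hW : Measurable fun p : (ℕ → E) × (ℕ → unitInterval × unitInterval × Bool) =>
      (Preorder.frestrictLe (π := fun _ => E) n p.1, p.2) := by fun_prop
  have hA : MeasurableSet (G.forgetFuture n ⁻¹' B) := (hW.comp G.measurable_data) hB
  have hψ : Measurable fun x => ∫⁻ y, φ y ∂(κ x) := hφ.lintegral_kernel
  have e1 : ∀ Φ : (ℕ → E) → ℝ≥0∞, Measurable Φ →
      ∫⁻ ω in G.forgetFuture n ⁻¹' B,
        Φ (G.data ω).1 ∂(G.P x) =
      ∫⁻ η, ∫⁻ X, B.indicator (fun _ => (1 : ℝ≥0∞)) (Preorder.frestrictLe (π := fun _ => E) n X, η) * Φ X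
    ∂(chainLaw κ x)
        ∂(Measure.infinitePi fun _ : ℕ => noiseLaw α) := by
    intro Φ hΦ
    have hm : Measurable fun p : (ℕ → E) × (ℕ → unitInterval × unitInterval × Bool) =>
        B.indicator (fun _ => (1 : ℝ≥0∞)) (Preorder.frestrictLe (π := fun _ => E) n p.1, p.2) * Φ p.1 :=
      ((measurable_const.indicator hB).comp hW).mul (hΦ.comp measurable_fst)
    rw [← lintegral_prod_symm' _ hm, ← G.map_data, lintegral_map hm G.measurable_data,
      ← lintegral_indicator hA]
    congr 1
    funext ω
    by_cases hω : G.forgetFuture n ω ∈ B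
    · have hω' := hω
      simp only [forgetFuture] at hω'
      simp [Set.indicator, hω, hω']
    · have hω' := hω
      simp only [forgetFuture] at hω'
      simp [Set.indicator, hω, hω']
  refine (e1 (fun X => φ (X (n + 1))) (hφ.comp (measurable_pi_apply _))).trans
    (Eq.trans ?_ (e1 (fun X => ∫⁻ y, φ y ∂(κ (X n))) (hψ.comp (measurable_pi_apply _))).symm)
  refine lintegral_congr fun η => ?_
  have hF : Measurable fun p : (Finset.Iic n → E) × E =>
      B.indicator (fun _ => (1 : ℝ≥0∞)) (p.1, η) * φ p.2 :=
    ((measurable_const.indicator hB).comp (by fun_prop)).mul (hφ.comp measurable_snd)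
  refine (lintegral_chainLaw_succ κ x n hF).trans ?_
  refine lintegral_congr fun X => ?_
  exact lintegral_const_mul (B.indicator (fun _ => (1 : ℝ≥0∞))
    (Preorder.frestrictLe (π := fun _ => E) n X, η)) hφ

end GameSpace

end DynkinGame

/-! ### Paths of the killed and absorbed chain. -/

namespace DynkinGame

open Filter Topology OptimalStopping
open scoped ENNReal

section HatKernel

variable {E : Type*}

@[simp]
theorem stC_notMem_absorbing (x : E) : (stC x : HatState E) ∉ absorbing E := by
  simp [absorbing]

@[simp]
theorem stS_mem_absorbing (x : E) : (stS x : HatState E) ∈ absorbing E := by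
  simp [absorbing]

@[simp]
theorem stK_mem_absorbing : (stK : HatState E) ∈ absorbing E := by
  simp [absorbing]

variable [MeasurableSpace E]

theorem measurableSet_absorbing : MeasurableSet (absorbing E) := by
  have : absorbing E = Set.range Sum.inr := by
    ext y
    rcases y with y | y | y <;> simp [absorbing]
  rw [this]
  exact measurableSet_range_inr

theorem measurable_stC : Measurable (stC : E → HatState E) := measurable_inl

theorem measurable_stS : Measurable (stS : E → HatState E) := measurable_inr.comp measurable_inl

theorem measurable_hatReward {f g h : E → ℝ} (hf : Measurable f) (hg : Measurable g)
    (hh : Measurable h) (p₂ : Strategy E) : Measurable (hatReward f g h p₂) := by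
  have hp : Measurable fun x => (p₂.1 x : ℝ) := measurable_subtype_coe.comp p₂.2
  refine measurable_fun_sum ?_ (measurable_fun_sum hg measurable_const)
  exact ((measurable_const.sub hp).mul hf).add (hp.mul hh)

variable (κ : Kernel E E) [IsMarkovKernel κ] (α : unitInterval) (p₂ : Strategy E)

theorem hatKernel_of_mem_absorbing {z : HatState E} (hz : z ∈ absorbing E) :
    hatKernel κ α p₂ z = Measure.dirac z := by
  rcases hz with rfl | ⟨x, rfl⟩ <;> rfl

theorem lintegral_hatKernel_stC (x : E) {ψ : HatState E → ℝ≥0∞} (hψ : Measurable ψ) :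
    ∫⁻ y, ψ y ∂(hatKernel κ α p₂ (stC x)) =
      ENNReal.ofReal (p₂.1 x) * ψ (stS x) +
      ENNReal.ofReal ((1 - (p₂.1 x : ℝ)) * (1 - (α : ℝ))) * ψ stK +
      ENNReal.ofReal ((1 - (p₂.1 x : ℝ)) * (α : ℝ)) * ∫⁻ y, ψ (stC y) ∂(κ x) := by
  have h : hatKernel κ α p₂ (stC x) =
      ENNReal.ofReal (p₂.1 x) • Measure.dirac (stS x) +
        ENNReal.ofReal ((1 - (p₂.1 x : ℝ)) * (1 - (α : ℝ))) • Measure.dirac stK +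
        ENNReal.ofReal ((1 - (p₂.1 x : ℝ)) * (α : ℝ)) • (κ x).map stC := rfl
  rw [h, lintegral_add_measure, lintegral_add_measure, lintegral_smul_measure,
    lintegral_smul_measure, lintegral_smul_measure, lintegral_dirac' _ hψ, lintegral_dirac' _ hψ,
    lintegral_map hψ measurable_stC]
  rfl

end HatKernel

section HittingTime

variable {Ω β : Type*} {u : ℕ → Ω → β} {s : Set β} {ω : Ω} {n : ℕ}

theorem lt_hittingAfter_zero_iff : (n : WithTop ℕ) < hittingAfter u s 0 ω ↔ ∀ k ≤ n, u k ω ∉ s := by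
  rw [← not_le]
  have h := hittingAfter_le_iff (u := u) (s := s) (n := 0) (ω := ω) (i := n)
  exact (not_congr h).trans (by simp)

theorem le_hittingAfter_zero_iff : (n : WithTop ℕ) ≤ hittingAfter u s 0 ω ↔ ∀ k < n, u k ω ∉ s := by
  rw [← not_lt]
  have h := hittingAfter_lt_iff (u := u) (s := s) (n := 0) (ω := ω) (i := n)
  exact (not_congr h).trans (by simp)

theorem hittingAfter_zero_eq_iff :
    hittingAfter u s 0 ω = n ↔ u n ω ∈ s ∧ ∀ k < n, u k ω ∉ s := by
  rw [← le_hittingAfter_zero_iff]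
  constructor
  · intro h
    refine ⟨?_, h.ge⟩
    have h' := (not_congr (lt_hittingAfter_zero_iff (u := u) (s := s) (ω := ω) (n := n))).1 h.le.not_gt
    push Not at h'
    obtain ⟨k, hk, hks⟩ := h'
    rcases hk.lt_or_eq with hlt | rfl
    · exact absurd hks (le_hittingAfter_zero_iff.1 h.ge k hlt)
    · exact hks
  · rintro ⟨h1, h2⟩
    exact le_antisymm (hittingAfter_le_of_mem (Nat.zero_le _) h1) h2

end HittingTime

namespace GameSpace

variable {E Ω : Type*} [MeasurableSpace E] [mΩ : MeasurableSpace Ω] {κ : Kernel E E}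
  [IsMarkovKernel κ] {α : unitInterval} (G : GameSpace κ α Ω)

theorem time₁_eq_iff {p : Strategy E} {ω : Ω} {n : ℕ} : G.time₁ p ω = n ↔
    G.ξ₁ n ω ≤ p.1 (G.X n ω) ∧ ∀ k < n, p.1 (G.X k ω) < G.ξ₁ k ω := by
  simp [time₁, markovTime, hittingAfter_zero_eq_iff]

theorem lt_time₁_iff {p : Strategy E} {ω : Ω} {n : ℕ} : n < G.time₁ p ω ↔
    ∀ k ≤ n, p.1 (G.X k ω) < G.ξ₁ k ω := by
  simp [time₁, markovTime, lt_hittingAfter_zero_iff]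

theorem time₂_eq_iff {p : Strategy E} {ω : Ω} {n : ℕ} : G.time₂ p ω = n ↔
    G.ξ₂ n ω ≤ p.1 (G.X n ω) ∧ ∀ k < n, p.1 (G.X k ω) < G.ξ₂ k ω := by
  simp [time₂, markovTime, hittingAfter_zero_eq_iff]

theorem le_time₂_iff {p : Strategy E} {ω : Ω} {n : ℕ} : n ≤ G.time₂ p ω ↔
    ∀ k < n, p.1 (G.X k ω) < G.ξ₂ k ω := by
  simp [time₂, markovTime, le_hittingAfter_zero_iff]

theorem lt_time₂_iff {p : Strategy E} {ω : Ω} {n : ℕ} : n < G.time₂ p ω ↔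
    ∀ k ≤ n, p.1 (G.X k ω) < G.ξ₂ k ω := by
  simp [time₂, markovTime, lt_hittingAfter_zero_iff]

/-- The event that no coin has failed up to time `n`. -/
def survived (n : ℕ) : Set Ω := {ω | ∀ k, 1 ≤ k → k ≤ n → G.c k ω = true}

/-- The event that, at time `n`, player 2 has not stopped yet and no coin has failed. -/
def alive (p₂ : Strategy E) (n : ℕ) : Set Ω := {ω | n ≤ G.time₂ p₂ ω} ∩ G.survived n

theorem killed_of_survived {n : ℕ} {ω : Ω} (h : ω ∈ G.survived n) :
    G.killed n ω = some (G.X n ω) := if_pos h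

theorem killed_of_not_survived {n : ℕ} {ω : Ω} (h : ω ∉ G.survived n) :
    G.killed n ω = none := if_neg h

theorem survived_zero : G.survived 0 = Set.univ := by
  ext ω
  simp only [survived, Set.mem_ofPred_eq, Set.mem_univ, iff_true]
  intro k h1 h2
  omega

theorem survived_succ (n : ℕ) : G.survived (n + 1) = G.survived n ∩ {ω | G.c (n + 1) ω = true} := by
  ext ω
  constructor
  · exact fun h => ⟨fun k h1 h2 => h k h1 (by omega), h (n + 1) (by omega) le_rfl⟩
  · rintro ⟨h1, h2⟩ k hk1 hk2
    rcases Nat.lt_or_ge k (n + 1) with hlt | hge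
    · exact h1 k hk1 (by omega)
    · obtain rfl : k = n + 1 := by omega
      exact h2

theorem survived_anti : Antitone G.survived :=
  fun _ _ hnm _ h k h1 h2 => h k h1 (h2.trans hnm)

section Path

variable {p₂ : Strategy E} {x : E} {n : ℕ} {ω : Ω}

theorem hatX_of_mem_absorbing {z : HatState E} (hz : z ∈ absorbing E) :
    G.hatX p₂ z n ω = z := by
  induction n with
  | zero => simp [hatX, hz]
  | succ n ih => simp [hatX, ih, hz]

theorem hatX_succ_of_absorbed {z : HatState E} (h : G.hatX p₂ z n ω ∈ absorbing E) :
    G.hatX p₂ z (n + 1) ω = G.hatX p₂ z n ω := by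
  simp [hatX, h]

theorem alive_succ_iff : ω ∈ G.alive p₂ (n + 1) ↔
    ω ∈ G.alive p₂ n ∧ p₂.1 (G.X n ω) < G.ξ₂ n ω ∧ G.c (n + 1) ω = true := by
  simp only [alive, Set.mem_inter_iff, survived_succ, Set.mem_ofPred_eq, le_time₂_iff,
    Nat.lt_succ_iff_lt_or_eq]
  constructor
  · rintro ⟨h1, h2, h3⟩
    exact ⟨⟨fun k hk => h1 k (Or.inl hk), h2⟩, h1 n (Or.inr rfl), h3⟩
  · rintro ⟨⟨h1, h2⟩, h3, h4⟩
    refine ⟨fun k hk => ?_, h2, h4⟩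
    rcases hk with hk | rfl
    · exact h1 k hk
    · exact h3

theorem alive_zero : G.alive p₂ 0 = Set.univ := by
  ext ω
  simp [alive, survived_zero]

/-- The inequality in `alive` is weak, n ≤ τ₂: a stop of player 2 at time `n` moves the chain to `S`
only at time `n + 1`, so at time `n` the chain is still in `C`. -/
theorem hatX_alive_and_not (n : ℕ) :
    (ω ∈ G.alive p₂ n → G.hatX p₂ (stC x) n ω = stC (G.X n ω)) ∧
    (ω ∉ G.alive p₂ n → G.hatX p₂ (stC x) n ω ∈ absorbing E) := by
  induction n with
  | zero => simp [hatX, alive_zero]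
  | succ n ih =>
    by_cases ha : ω ∈ G.alive p₂ n
    · have hn := ih.1 ha
      by_cases ht : G.time₂ p₂ ω = n
      · have : ω ∉ G.alive p₂ (n + 1) := fun h =>
          absurd (G.time₂_eq_iff.1 ht).1 (not_le.2 (G.alive_succ_iff.1 h).2.1)
        simp [hatX, hn, ht, this]
      · have hlt : p₂.1 (G.X n ω) < G.ξ₂ n ω := by
          by_contra hc
          exact ht (G.time₂_eq_iff.2 ⟨not_lt.1 hc, G.le_time₂_iff.1 ha.1⟩)
        by_cases hs : ω ∈ G.survived (n + 1)
        · have hc : G.c (n + 1) ω = true := by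
            rw [survived_succ] at hs; exact hs.2
          have : ω ∈ G.alive p₂ (n + 1) := G.alive_succ_iff.2 ⟨ha, hlt, hc⟩
          simp [hatX, hn, ht, G.killed_of_survived hs, this]
        · have : ω ∉ G.alive p₂ (n + 1) := fun h => hs h.2
          simp [hatX, hn, ht, G.killed_of_not_survived hs, this]
    · have hn := ih.2 ha
      have : ω ∉ G.alive p₂ (n + 1) := fun h => ha (G.alive_succ_iff.1 h).1
      simp [hatX, hn, this]

theorem hatX_of_alive (h : ω ∈ G.alive p₂ n) : G.hatX p₂ (stC x) n ω = stC (G.X n ω) :=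
  (G.hatX_alive_and_not n).1 h

theorem hatX_of_not_alive (h : ω ∉ G.alive p₂ n) : G.hatX p₂ (stC x) n ω ∈ absorbing E :=
  (G.hatX_alive_and_not n).2 h

theorem hatX_mem_absorbing_iff : G.hatX p₂ (stC x) n ω ∈ absorbing E ↔ ω ∉ G.alive p₂ n := by
  by_cases h : ω ∈ G.alive p₂ n
  · simp [h, G.hatX_of_alive h]
  · simp [h, G.hatX_of_not_alive h]

theorem hatX_succ_stopped (h : ω ∈ G.alive p₂ n) (hξ : G.ξ₂ n ω ≤ p₂.1 (G.X n ω)) :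
    G.hatX p₂ (stC x) (n + 1) ω = stS (G.X n ω) := by
  have ht : G.time₂ p₂ ω = n := G.time₂_eq_iff.2 ⟨hξ, G.le_time₂_iff.1 h.1⟩
  simp [hatX, G.hatX_of_alive h, ht]

theorem hatX_succ_killed (h : ω ∈ G.alive p₂ n) (hξ : p₂.1 (G.X n ω) < G.ξ₂ n ω)
    (hc : G.c (n + 1) ω = false) : G.hatX p₂ (stC x) (n + 1) ω = stK := by
  have ht : G.time₂ p₂ ω ≠ n := fun he => absurd (G.time₂_eq_iff.1 he).1 (not_le.2 hξ)
  have hs : ω ∉ G.survived (n + 1) := by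
    rw [survived_succ]
    rintro ⟨-, h2⟩
    simp [show G.c (n + 1) ω = true from h2] at hc
  simp [hatX, G.hatX_of_alive h, ht, G.killed_of_not_survived hs]

end Path

end GameSpace

/-! ### The auxiliary process is a Markov chain with an integrable supremum of rewards. -/

namespace GameSpace

section Measurability

variable {E Ω : Type*} [MeasurableSpace E] {m : MeasurableSpace Ω} [mΩ : MeasurableSpace Ω]
  {κ : Kernel E E} [IsMarkovKernel κ] {α : unitInterval} (G : GameSpace κ α Ω) (p₂ : Strategy E)

theorem measurableSet_survived {n : ℕ}
    (hc : ∀ k, 1 ≤ k → k ≤ n → Measurable[m] (G.c k)) : MeasurableSet[m] (G.survived n) := by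
  simp only [survived, Set.ofPred_forall]
  exact MeasurableSet.iInter fun k => MeasurableSet.iInter fun h1 =>
    MeasurableSet.iInter fun h2 => hc k h1 h2 (measurableSet_singleton true)

theorem measurableSet_le_time₂ {n : ℕ}
    (hX : ∀ k < n, Measurable[m] (G.X k)) (hξ : ∀ k < n, Measurable[m] (G.ξ₂ k)) :
    MeasurableSet[m] {ω | n ≤ G.time₂ p₂ ω} := by
  simp only [le_time₂_iff, Set.ofPred_forall]
  exact MeasurableSet.iInter fun k => MeasurableSet.iInter fun h1 =>
    measurableSet_lt (p₂.2.comp (hX k h1)) (hξ k h1)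

theorem measurableSet_alive {n : ℕ}
    (hX : ∀ k < n, Measurable[m] (G.X k)) (hξ : ∀ k < n, Measurable[m] (G.ξ₂ k))
    (hc : ∀ k, 1 ≤ k → k ≤ n → Measurable[m] (G.c k)) : MeasurableSet[m] (G.alive p₂ n) :=
  (G.measurableSet_le_time₂ p₂ hX hξ).inter (G.measurableSet_survived hc)

/-- What matters is the index ranges: the state at time `n` uses the devices of player 2 strictly
before `n` and the coins from 1 to `n`. The device at `n` and the coin at `n + 1` therefore remain
free. The σ-algebra is arbitrary so that it can be each of those independent of a noise variable. -/
theorem measurable_hatX_of (x : E) {n : ℕ}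
    (hX : ∀ k ≤ n, Measurable[m] (G.X k)) (hξ : ∀ k < n, Measurable[m] (G.ξ₂ k))
    (hc : ∀ k, 1 ≤ k → k ≤ n → Measurable[m] (G.c k)) :
    Measurable[m] (G.hatX p₂ (stC x) n) := by
  induction n with
  | zero =>
    have : G.hatX p₂ (stC x) 0 = fun ω => stC (G.X 0 ω) := by
      funext ω
      simp [hatX]
    rw [this]
    exact measurable_stC.comp (hX 0 le_rfl)
  | succ n ih =>
    have ih' := ih (fun k hk => hX k (by omega)) (fun k hk => hξ k (by omega))
      (fun k h1 h2 => hc k h1 (by omega))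
    simp only [hatX]
    refine Measurable.ite (ih' measurableSet_absorbing) ih' (Measurable.ite ?_ ?_ ?_)
    · have h1 : MeasurableSet[m] {ω | G.ξ₂ n ω ≤ p₂.1 (G.X n ω)} :=
        measurableSet_le (hξ n (by omega)) (p₂.2.comp (hX n (by omega)))
      have h2 : MeasurableSet[m] {ω | n ≤ G.time₂ p₂ ω} :=
        G.measurableSet_le_time₂ p₂ (fun k hk => hX k (by omega)) (fun k hk => hξ k (by omega))
      have h3 : {ω | G.time₂ p₂ ω = n} =
          {ω | G.ξ₂ n ω ≤ p₂.1 (G.X n ω)} ∩ {ω | n ≤ G.time₂ p₂ ω} := by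
        ext ω
        simp only [Set.mem_ofPred_eq, Set.mem_inter_iff, time₂_eq_iff, le_time₂_iff]
      rw [h3]
      exact h1.inter h2
    · exact measurable_stS.comp (hX n (by omega))
    · classical
      have : (fun ω => (G.killed (n + 1) ω).elim stK stC) = fun ω =>
          if ω ∈ G.survived (n + 1) then (stC (G.X (n + 1) ω) : HatState E) else stK := by
        funext ω
        split_ifs with h
        · simp [G.killed_of_survived h]
        · simp [G.killed_of_not_survived h]
      rw [this]
      exact Measurable.ite (G.measurableSet_survived hc) (measurable_stC.comp (hX _ le_rfl))
        measurable_const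

theorem obsFiltration_le_of {S : Type*} [MeasurableSpace S] {Y : ℕ → Ω → S}
    {hY : ∀ n, Measurable (Y n)} {ξ : ℕ → Ω → unitInterval} {hξ : ∀ n, Measurable (ξ n)}
    {n : ℕ} (h1 : ∀ k ≤ n, Measurable[m] (Y k))
    (h2 : ∀ k ≤ n, Measurable[m] (ξ k)) : obsFiltration Y hY ξ hξ n ≤ m :=
  iSup₂_le fun k hk => sup_le (measurable_iff_comap_le.1 (h1 k hk))
    (measurable_iff_comap_le.1 (h2 k hk))

omit m in
theorem measurable_obsFiltration_left {S : Type*} [mS : MeasurableSpace S] {Y : ℕ → Ω → S}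
    {hY : ∀ n, Measurable (Y n)} {ξ : ℕ → Ω → unitInterval} {hξ : ∀ n, Measurable (ξ n)}
    {k n : ℕ} (h : k ≤ n) : Measurable[obsFiltration Y hY ξ hξ n] (Y k) :=
  measurable_iff_comap_le.2 (le_sup_left.trans (le_iSup₂_of_le
    (f := fun j (_ : j ≤ n) => MeasurableSpace.comap (Y j) mS ⊔
      MeasurableSpace.comap (ξ j) inferInstance) k h le_rfl))

omit m in
theorem measurable_obsFiltration_right {S : Type*} [mS : MeasurableSpace S] {Y : ℕ → Ω → S}
    {hY : ∀ n, Measurable (Y n)} {ξ : ℕ → Ω → unitInterval} {hξ : ∀ n, Measurable (ξ n)}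
    {k n : ℕ} (h : k ≤ n) : Measurable[obsFiltration Y hY ξ hξ n] (ξ k) :=
  measurable_iff_comap_le.2 (le_sup_right.trans (le_iSup₂_of_le
    (f := fun j (_ : j ≤ n) => MeasurableSpace.comap (Y j) mS ⊔
      MeasurableSpace.comap (ξ j) inferInstance) k h le_rfl))

/-- The filtration of the auxiliary problem. -/
noncomputable abbrev hatFiltration (z : HatState E) : Filtration ℕ mΩ :=
  obsFiltration (G.hatX p₂ z) (G.measurable_hatX p₂ z) G.ξ₁ G.measurable_ξ₁

theorem hatFiltration_le_of (x : E) {n : ℕ}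
    (hX : ∀ k ≤ n, Measurable[m] (G.X k)) (hξ₁ : ∀ k ≤ n, Measurable[m] (G.ξ₁ k))
    (hξ : ∀ k < n, Measurable[m] (G.ξ₂ k))
    (hc : ∀ k, 1 ≤ k → k ≤ n → Measurable[m] (G.c k)) :
    G.hatFiltration p₂ (stC x) n ≤ m :=
  obsFiltration_le_of (fun k hk => G.measurable_hatX_of p₂ x (fun j hj => hX j (by omega))
    (fun j hj => hξ j (by omega)) fun j h1 h2 => hc j h1 (by omega)) hξ₁

end Measurability

variable {E Ω : Type*} [MeasurableSpace E] [mΩ : MeasurableSpace Ω] {κ : Kernel E E}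
  [IsMarkovKernel κ] {α : unitInterval} (G : GameSpace κ α Ω)

section Chain

variable (p₂ : Strategy E)

/-- From a live state there are three outcomes: player 2 stops, the coin fails, or `X` moves on.
Their weights appear by integrating out the next state, then the coin, then the device, each against
a σ-algebra that still contains the events left over. -/
theorem setLIntegral_hatX_succ (x : E) (n : ℕ) {A : Set Ω}
    (hA : MeasurableSet[G.hatFiltration p₂ (stC x) n] A) (hAn : A ⊆ G.alive p₂ n)
    {ψ : HatState E → ℝ≥0∞} (hψ : Measurable ψ) :
    ∫⁻ ω in A, ψ (G.hatX p₂ (stC x) (n + 1) ω) ∂(G.P x) =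
      ∫⁻ ω in A, ∫⁻ y, ψ y ∂(hatKernel κ α p₂ (G.hatX p₂ (stC x) n ω)) ∂(G.P x) := by
  have hA₀ : MeasurableSet A := (G.hatFiltration p₂ (stC x)).le n _ hA
  -- An event of the auxiliary past lies in all three conditioning σ-algebras, since it involves
  -- neither the device at `n`, nor the coin at `n + 1`, nor the chain after `n`.
  have hAd : MeasurableSet[G.exceptDevice n] A := G.hatFiltration_le_of p₂ x
    (fun k _ => measurable_exceptDevice_X n k) (fun k _ => measurable_exceptDevice_ξ₁ n k)
    (fun k hk => measurable_exceptDevice_ξ₂ (by omega))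
    (fun k _ _ => measurable_exceptDevice_c n k) _ hA
  have hAc : MeasurableSet[G.exceptCoin (n + 1)] A := G.hatFiltration_le_of p₂ x
    (fun k _ => measurable_exceptCoin_X _ k) (fun k _ => measurable_exceptCoin_ξ₁ _ k)
    (fun k _ => measurable_exceptCoin_ξ₂ _ k)
    (fun k _ _ => measurable_exceptCoin_c (by omega)) _ hA
  have hAp : MeasurableSet[G.pastAndNoise n] A := G.hatFiltration_le_of p₂ x
    (fun k hk => measurable_pastAndNoise_X hk) (fun k _ => measurable_pastAndNoise_ξ₁ n k)
    (fun k _ => measurable_pastAndNoise_ξ₂ n k)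
    (fun k _ _ => measurable_pastAndNoise_c n k) _ hA
  set U := {ω | G.ξ₂ n ω ≤ p₂.1 (G.X n ω)} with hU
  set V := {ω | p₂.1 (G.X n ω) < G.ξ₂ n ω} with hV
  set T := fun b : Bool => {ω | G.c (n + 1) ω = b} with hT
  have hU₀ : MeasurableSet U := measurableSet_le (G.measurable_ξ₂ n) (p₂.2.comp (G.measurable_X n))
  have hVU : V = Uᶜ := by ext ω; simp [hU, hV]
  have hV₀ : MeasurableSet V := hVU ▸ hU₀.compl
  have hVc : MeasurableSet[G.exceptCoin (n + 1)] V :=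
    measurableSet_lt (p₂.2.comp (measurable_exceptCoin_X _ n)) (measurable_exceptCoin_ξ₂ _ n)
  have hVp : MeasurableSet[G.pastAndNoise n] V :=
    measurableSet_lt (p₂.2.comp (measurable_pastAndNoise_X le_rfl)) (measurable_pastAndNoise_ξ₂ _ n)
  have hT₀ : ∀ b, MeasurableSet (T b) := fun b => G.measurable_c _ (measurableSet_singleton b)
  have hTp : MeasurableSet[G.pastAndNoise n] (T true) :=
    measurable_pastAndNoise_c _ _ (measurableSet_singleton true)
  have hTT : T false = (T true)ᶜ := by ext ω; simp [hT]
  set χ : E → ℝ≥0∞ := fun y => ∫⁻ y', ψ (stC y') ∂(κ y) with hχ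
  have hχm : Measurable χ := (hψ.comp measurable_stC).lintegral_kernel
  have split : ∀ Φ : Ω → ℝ≥0∞, ∫⁻ ω in A, Φ ω ∂(G.P x) = ∫⁻ ω in A ∩ U, Φ ω ∂(G.P x) +
      (∫⁻ ω in A ∩ V ∩ T true, Φ ω ∂(G.P x) + ∫⁻ ω in A ∩ V ∩ T false, Φ ω ∂(G.P x)) := by
    intro Φ
    rw [hTT, ← Set.sdiff_eq, lintegral_inter_add_sdiff _ _ (hT₀ true), hVU, ← Set.sdiff_eq,
      lintegral_inter_add_sdiff _ _ hU₀]
  have inner : ∀ (B : Set Ω) (D : Ω → ℝ≥0∞) (s : Set Ω), MeasurableSet B →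
      ∫⁻ ω in B ∩ s, D ω ∂(G.P x) = ∫⁻ ω in s, B.indicator D ω ∂(G.P x) := by
    intro B D s hB
    rw [setLIntegral_indicator hB]
  have device : ∀ Φ : E → ℝ≥0∞, Measurable Φ →
      ∫⁻ ω in A ∩ U, Φ (G.X n ω) ∂(G.P x) =
        ∫⁻ ω in A, ENNReal.ofReal (p₂.1 (G.X n ω)) * Φ (G.X n ω) ∂(G.P x) ∧
      ∫⁻ ω in A ∩ V, Φ (G.X n ω) ∂(G.P x) =
        ∫⁻ ω in A, ENNReal.ofReal (1 - p₂.1 (G.X n ω)) * Φ (G.X n ω) ∂(G.P x) := by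
    intro Φ hΦ
    have h := G.setLIntegral_device x n (p₂.2.comp (measurable_exceptDevice_X n n))
      ((hΦ.comp (measurable_exceptDevice_X n n)).indicator hAd)
    refine ⟨(inner A _ U hA₀).trans (h.1.trans ?_), (inner A _ V hA₀).trans (h.2.trans ?_)⟩
    all_goals
      rw [← lintegral_indicator hA₀]
      congr 1
      funext ω
      by_cases hω : ω ∈ A <;> simp [hω]
  have coin : ∀ (Φ : E → ℝ≥0∞) (b : Bool), Measurable Φ →
      ∫⁻ ω in A ∩ V ∩ T b, Φ (G.X n ω) ∂(G.P x) =
        ENNReal.ofReal (if b then α else 1 - α) * ∫⁻ ω in A ∩ V, Φ (G.X n ω) ∂(G.P x) := by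
    intro Φ b hΦ
    have h := G.setLIntegral_coin x (n + 1) b
      ((hΦ.comp (measurable_exceptCoin_X (n + 1) n)).indicator (hAc.inter hVc))
    rw [inner _ _ _ (hA₀.inter hV₀)]
    refine h.trans ?_
    rw [lintegral_indicator (hA₀.inter hV₀)]
    rfl
  have e1 : ∫⁻ ω in A ∩ U, ψ (G.hatX p₂ (stC x) (n + 1) ω) ∂(G.P x) =
      ∫⁻ ω in A, ENNReal.ofReal (p₂.1 (G.X n ω)) * ψ (stS (G.X n ω)) ∂(G.P x) := by
    rw [← (device (fun y => ψ (stS y)) (hψ.comp measurable_stS)).1]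
    refine setLIntegral_congr_fun (hA₀.inter hU₀) fun ω hω => ?_
    simp only [G.hatX_succ_stopped (hAn hω.1) hω.2]
  have e2 : ∫⁻ ω in A ∩ V ∩ T true, ψ (G.hatX p₂ (stC x) (n + 1) ω) ∂(G.P x) =
      ENNReal.ofReal α * ∫⁻ ω in A, ENNReal.ofReal (1 - p₂.1 (G.X n ω)) * χ (G.X n ω) ∂(G.P x) := by
    rw [← (device χ hχm).2]
    have := coin χ true hχm
    simp only [if_true] at this
    rw [← this]
    -- The conditions on the device and on the coin are noise events, so they may stay in the domain
    -- while the next state is averaged.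
    refine Eq.trans ?_ (G.setLIntegral_X_succ x n ((hAp.inter hVp).inter hTp)
      (φ := fun y => ψ (stC y)) (hψ.comp measurable_stC))
    refine setLIntegral_congr_fun ((hA₀.inter hV₀).inter (hT₀ true)) fun ω hω => ?_
    have hal : ω ∈ G.alive p₂ (n + 1) := G.alive_succ_iff.2 ⟨hAn hω.1.1, hω.1.2, hω.2⟩
    simp only [G.hatX_of_alive hal]
  have e3 : ∫⁻ ω in A ∩ V ∩ T false, ψ (G.hatX p₂ (stC x) (n + 1) ω) ∂(G.P x) =
      ENNReal.ofReal (1 - α) *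
        ∫⁻ ω in A, ENNReal.ofReal (1 - p₂.1 (G.X n ω)) * ψ stK ∂(G.P x) := by
    rw [← (device (fun _ => ψ stK) measurable_const).2]
    have := coin (fun _ => ψ stK) false measurable_const
    simp only [Bool.false_eq_true, if_false] at this
    rw [← this]
    refine setLIntegral_congr_fun ((hA₀.inter hV₀).inter (hT₀ false)) fun ω hω => ?_
    simp only [G.hatX_succ_killed (hAn hω.1.1) hω.1.2 hω.2]
  have hp : Measurable fun ω => (p₂.1 (G.X n ω) : ℝ) :=
    measurable_subtype_coe.comp (p₂.2.comp (G.measurable_X n))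
  have hψS : Measurable fun ω => ψ (stS (G.X n ω)) :=
    hψ.comp (measurable_stS.comp (G.measurable_X n))
  have hχX : Measurable fun ω => χ (G.X n ω) := hχm.comp (G.measurable_X n)
  have h1p : Measurable fun ω => ENNReal.ofReal (1 - (p₂.1 (G.X n ω) : ℝ)) :=
    (measurable_const.sub hp).ennreal_ofReal
  have m1 : Measurable fun ω => ENNReal.ofReal (1 - (p₂.1 (G.X n ω) : ℝ)) * χ (G.X n ω) :=
    h1p.mul hχX
  have m2 : Measurable fun ω => ENNReal.ofReal (1 - (p₂.1 (G.X n ω) : ℝ)) * ψ stK :=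
    h1p.mul measurable_const
  have m3 : Measurable fun ω => ENNReal.ofReal (p₂.1 (G.X n ω) : ℝ) * ψ (stS (G.X n ω)) :=
    hp.ennreal_ofReal.mul hψS
  rw [split, e1, e2, e3, ← lintegral_const_mul _ m1, ← lintegral_const_mul _ m2,
    ← lintegral_add_left (m1.const_mul _), ← lintegral_add_left m3]
  refine setLIntegral_congr_fun hA₀ fun ω hω => ?_
  simp only [G.hatX_of_alive (hAn hω)]
  rw [lintegral_hatKernel_stC κ α p₂ _ hψ, ENNReal.ofReal_mul (sub_nonneg.2 (p₂.1 (G.X n ω)).2.2),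
    ENNReal.ofReal_mul (sub_nonneg.2 (p₂.1 (G.X n ω)).2.2)]
  ring

theorem isChain_hatX_stC (x : E) :
    IsChain (hatKernel κ α p₂) (stC x) (G.P x) (G.hatFiltration p₂ (stC x))
      (G.hatX p₂ (stC x)) where
  adapted n := measurable_obsFiltration_left le_rfl
  start := by
    have : G.hatX p₂ (stC x) 0 = stC ∘ G.X 0 := by
      funext ω
      simp [hatX]
    rw [this, ← Measure.map_map measurable_stC (G.measurable_X 0), G.map_X_zero,
      Measure.map_dirac' measurable_stC]
  step n A hA ψ hψ := by
    have hY : Measurable[G.hatFiltration p₂ (stC x) n] (G.hatX p₂ (stC x) n) :=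
      measurable_obsFiltration_left le_rfl
    have hB : MeasurableSet[G.hatFiltration p₂ (stC x) n] {ω | G.hatX p₂ (stC x) n ω ∈ absorbing E} :=
      hY measurableSet_absorbing
    have hB₀ := (G.hatFiltration p₂ (stC x)).le n _ hB
    have hA₀ := (G.hatFiltration p₂ (stC x)).le n _ hA
    rw [← lintegral_inter_add_sdiff _ A hB₀, ← lintegral_inter_add_sdiff
      (fun ω => ∫⁻ y, ψ y ∂(hatKernel κ α p₂ (G.hatX p₂ (stC x) n ω))) A hB₀]
    congr 1
    · refine setLIntegral_congr_fun (hA₀.inter hB₀) fun ω hω => ?_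
      simp only [G.hatX_succ_of_absorbed hω.2, hatKernel_of_mem_absorbing κ α p₂ hω.2,
        lintegral_dirac' _ hψ]
    · refine G.setLIntegral_hatX_succ p₂ x n (hA.diff hB) (fun ω hω => ?_) hψ
      by_contra hc
      exact hω.2 (G.hatX_of_not_alive hc)

/-- While alive, the reward is a convex combination of `f` and `h` at the killed chain. On entering
`S` at time `n + 1` it is `g` at `X n`, a point of the killed chain because the coins up to `n`
succeeded. At `K` it is 0, and after absorption it repeats. -/
theorem iSup_enorm_hatReward_le (f g h : E → ℝ) (x : E) (ω : Ω) :
    ⨆ n, ‖hatReward f g h p₂ (G.hatX p₂ (stC x) n ω)‖ₑ ≤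
      (⨆ n, ‖(G.killed n ω).elim 0 f‖ₑ) + (⨆ n, ‖(G.killed n ω).elim 0 g‖ₑ) +
        ⨆ n, ‖(G.killed n ω).elim 0 h‖ₑ := by
  have hle : ∀ {φ : E → ℝ} {k : ℕ}, ω ∈ G.survived k →
      ‖φ (G.X k ω)‖ₑ ≤ ⨆ n, ‖(G.killed n ω).elim 0 φ‖ₑ := by
    intro φ k hk
    refine le_trans (le_of_eq ?_) (le_iSup (fun n => ‖(G.killed n ω).elim 0 φ‖ₑ) k)
    simp [G.killed_of_survived hk]
  have hC : ∀ y : E, ‖hatReward f g h p₂ (stC y)‖ₑ ≤ ‖f y‖ₑ + ‖h y‖ₑ := by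
    intro y
    have hp := (p₂.1 y).2
    have e : ∀ {a b : ℝ}, 0 ≤ a → a ≤ 1 → ‖a * b‖ₑ ≤ ‖b‖ₑ := by
      intro a b h0 h1
      rw [enorm_mul]
      refine mul_le_of_le_one_left zero_le ?_
      rw [Real.enorm_eq_ofReal h0]
      exact ENNReal.ofReal_le_one.2 h1
    exact (enorm_add_le _ _).trans (add_le_add
      (e (sub_nonneg.2 hp.2) (by linarith [hp.1])) (e hp.1 hp.2))
  have hal : ∀ n, ω ∈ G.alive p₂ n → ‖hatReward f g h p₂ (G.hatX p₂ (stC x) n ω)‖ₑ ≤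
      (⨆ n, ‖(G.killed n ω).elim 0 f‖ₑ) + (⨆ n, ‖(G.killed n ω).elim 0 g‖ₑ) +
        ⨆ n, ‖(G.killed n ω).elim 0 h‖ₑ := by
    intro n hn
    rw [G.hatX_of_alive hn]
    exact (hC _).trans (add_le_add ((hle hn.2).trans le_self_add) (hle hn.2))
  refine iSup_le fun n => ?_
  induction n with
  | zero => exact hal 0 (by simp [alive_zero])
  | succ n ih =>
    by_cases hn : ω ∈ G.alive p₂ n
    · rcases le_or_gt (G.ξ₂ n ω) (p₂.1 (G.X n ω)) with hξ | hξ
      · rw [G.hatX_succ_stopped hn hξ]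
        exact (hle (φ := g) hn.2).trans (le_add_self.trans le_self_add)
      · cases hc : G.c (n + 1) ω with
        | false =>
          rw [G.hatX_succ_killed hn hξ hc]
          simp [hatReward]
        | true => exact hal _ (G.alive_succ_iff.2 ⟨hn, hξ, hc⟩)
    · rwa [G.hatX_succ_of_absorbed (G.hatX_of_not_alive hn)]

theorem measurable_iSup_killed {φ : E → ℝ} (hφ : Measurable φ) :
    Measurable fun ω => ⨆ n, ‖(G.killed n ω).elim 0 φ‖ₑ := by
  classical
  refine Measurable.iSup fun n => Measurable.enorm ?_
  have : (fun ω => (G.killed n ω).elim 0 φ) = fun ω =>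
      if ω ∈ G.survived n then φ (G.X n ω) else 0 := by
    funext ω
    split_ifs with h
    · simp [G.killed_of_survived h]
    · simp [G.killed_of_not_survived h]
  rw [this]
  exact Measurable.ite (G.measurableSet_survived fun k _ _ => G.measurable_c k)
    (hφ.comp (G.measurable_X n)) measurable_const

/-- The coins are peeled off one at a time. Measurability of `D` without each single coin suffices,
because survival up to `n` does not involve coin `n + 1`. This identity trades the discount for
survival. -/
theorem lintegral_survived (x : E) (n : ℕ) {D : Ω → ℝ≥0∞}
    (hD : ∀ k, Measurable[G.exceptCoin k] D) :
    ∫⁻ ω in G.survived n, D ω ∂(G.P x) = ENNReal.ofReal ((α : ℝ) ^ n) * ∫⁻ ω, D ω ∂(G.P x) := by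
  induction n with
  | zero => simp [survived_zero]
  | succ n ih =>
    have hs : MeasurableSet[G.exceptCoin (n + 1)] (G.survived n) :=
      G.measurableSet_survived fun k _ _ => measurable_exceptCoin_c (by omega)
    have hs₀ : MeasurableSet (G.survived n) := G.exceptCoin_le _ _ hs
    have h := G.setLIntegral_coin x (n + 1) true ((hD (n + 1)).indicator hs)
    rw [setLIntegral_indicator hs₀, lintegral_indicator hs₀, ih, if_pos rfl, ← mul_assoc,
      ← ENNReal.ofReal_mul α.2.1, ← pow_succ'] at h
    rw [survived_succ, h]

variable [Nonempty E]

instance (z : HatState E) : IsProbabilityMeasure (G.hatP z) := by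
  rcases z with x | x | x
  · exact inferInstanceAs (IsProbabilityMeasure (G.P x))
  · exact inferInstanceAs (IsProbabilityMeasure (G.P x))
  · exact inferInstanceAs (IsProbabilityMeasure (G.P _))

theorem isChain_hatX (z : HatState E) :
    IsChain (hatKernel κ α p₂) z (G.hatP z) (G.hatFiltration p₂ z) (G.hatX p₂ z) := by
  by_cases hz : z ∈ absorbing E
  · have hX : ∀ n, G.hatX p₂ z n = fun _ => z := fun n => funext fun ω => G.hatX_of_mem_absorbing hz
    refine ⟨fun n => measurable_obsFiltration_left le_rfl, ?_, fun n A hA ψ hψ => ?_⟩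
    · rw [hX, Measure.map_const, measure_univ, one_smul]
    · simp only [hX, hatKernel_of_mem_absorbing κ α p₂ hz, lintegral_dirac' _ hψ]
  · rcases z with x | x | x
    · exact G.isChain_hatX_stC p₂ x
    · exact absurd (stS_mem_absorbing x) hz
    · exact absurd stK_mem_absorbing hz

theorem lintegral_iSup_hatReward_lt_top {f g h : E → ℝ} (hf : Measurable f) (hg : Measurable g)
    (hfi : G.SupIntegrable f) (hgi : G.SupIntegrable g) (hhi : G.SupIntegrable h)
    (z : HatState E) :
    ∫⁻ ω, ⨆ n, ‖hatReward f g h p₂ (G.hatX p₂ z n ω)‖ₑ ∂(G.hatP z) < ⊤ := by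
  by_cases hz : z ∈ absorbing E
  · simp [G.hatX_of_mem_absorbing hz]
  · rcases z with x | x | x
    · refine (lintegral_mono fun ω => G.iSup_enorm_hatReward_le p₂ f g h x ω).trans_lt ?_
      change ∫⁻ ω, _ ∂(G.P x) < ⊤
      have hm : Measurable fun ω => (⨆ n, ‖(G.killed n ω).elim 0 f‖ₑ) +
          ⨆ n, ‖(G.killed n ω).elim 0 g‖ₑ :=
        (G.measurable_iSup_killed hf).add (G.measurable_iSup_killed hg)
      rw [lintegral_add_left hm, lintegral_add_left (G.measurable_iSup_killed hf)]
      exact ENNReal.add_lt_top.2 ⟨ENNReal.add_lt_top.2 ⟨hfi x, hgi x⟩, hhi x⟩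
    · exact absurd (stS_mem_absorbing x) hz
    · exact absurd stK_mem_absorbing hz

end Chain

end GameSpace

end DynkinGame

/-! ### Capping at absorption: from the game filtration to the auxiliary one. -/

namespace DynkinGame

open Filter Topology OptimalStopping
open scoped ENNReal

namespace GameSpace

variable {E Ω : Type*} [MeasurableSpace E] [mΩ : MeasurableSpace Ω] {κ : Kernel E E}
  [IsMarkovKernel κ] {α : unitInterval} (G : GameSpace κ α Ω) (p₂ : Strategy E)

section Admissible

variable {p₂} in
theorem alive_anti : Antitone (G.alive p₂) :=
  antitone_nat_of_succ_le fun _ _ h => (G.alive_succ_iff.1 h).1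

theorem entryTime_of_mem {z : HatState E} {A : Set (HatState E)} (hz : z ∈ absorbing E)
    (hA : absorbing E ⊆ A) (ω : Ω) : G.entryTime p₂ z A ω = 0 := by
  have h : G.entryTime p₂ z A ω = (0 : ℕ) :=
    hittingAfter_zero_eq_iff.2 ⟨hA (by rwa [G.hatX_of_mem_absorbing hz]), by simp⟩
  simpa using h

theorem lt_entryTime_absorbing_iff {x : E} {ω : Ω} {n : ℕ} :
    n < G.entryTime p₂ (stC x) (absorbing E) ω ↔ ω ∈ G.alive p₂ n := by
  simp only [entryTime, lt_hittingAfter_zero_iff, hatX_mem_absorbing_iff, not_not]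
  exact ⟨fun h => h n le_rfl, fun h k hk => G.alive_anti hk h⟩

theorem isStoppingTime_entryTime (z : HatState E) {A : Set (HatState E)} (hA : MeasurableSet A) :
    IsStoppingTime (G.hatFiltration p₂ z) (G.entryTime p₂ z A) :=
  Adapted.isStoppingTime_hittingAfter (fun _ => measurable_obsFiltration_left le_rfl) hA

/-- This is where α < 1 enters: it makes absorption certain, and with it the finiteness of all
capped stopping times. -/
theorem measure_iInter_survived (hα1 : α < 1) (x : E) : G.P x (⋂ n, G.survived n) = 0 := by
  have h1 : ∀ n, G.P x (G.survived n) = ENNReal.ofReal ((α : ℝ) ^ n) := by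
    intro n
    have := G.lintegral_survived x n (D := fun _ => 1) (fun k => measurable_const)
    simpa using this
  have h2 : Tendsto (fun n => ENNReal.ofReal ((α : ℝ) ^ n)) atTop (𝓝 0) := by
    rw [← ENNReal.ofReal_zero]
    exact ENNReal.tendsto_ofReal (tendsto_pow_atTop_nhds_zero_of_lt_one α.2.1 hα1)
  refine le_antisymm (ge_of_tendsto' h2 fun n => ?_) zero_le
  rw [← h1 n]
  exact measure_mono (Set.iInter_subset _ n)

theorem ae_entryTime_lt_top [Nonempty E] (hα1 : α < 1) (z : HatState E) :
    ∀ᵐ ω ∂(G.hatP z), G.entryTime p₂ z (absorbing E) ω < ⊤ := by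
  by_cases hz : z ∈ absorbing E
  · refine ae_of_all _ fun ω => ?_
    rw [G.entryTime_of_mem p₂ hz subset_rfl]
    exact WithTop.coe_lt_top 0
  · rcases z with x | x | x
    · refine measure_mono_null (fun ω hω => ?_) (G.measure_iInter_survived hα1 x)
      refine Set.mem_iInter.2 fun n => ?_
      have htop : G.entryTime p₂ (stC x) (absorbing E) ω = ⊤ := not_lt_top_iff.1 hω
      exact ((G.lt_entryTime_absorbing_iff p₂ (x := x) (n := n)).1
        (by rw [htop]; exact WithTop.coe_lt_top n)).2
    · exact absurd (stS_mem_absorbing x) hz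
    · exact absurd stK_mem_absorbing hz

/-- As long as the auxiliary chain is alive, its states up to `n` reveal `X` up to `n`, so on this
event the two filtrations have comparable traces. -/
theorem measurableSet_inter_alive (x : E) {n : ℕ} {B : Set Ω}
    (hB : MeasurableSet[obsFiltration G.X G.measurable_X G.ξ₁ G.measurable_ξ₁ n] B) :
    MeasurableSet[G.hatFiltration p₂ (stC x) n] (B ∩ G.alive p₂ n) := by
  set C := G.alive p₂ n with hC
  have hCm : MeasurableSet[G.hatFiltration p₂ (stC x) n] C := by
    have h : MeasurableSet[G.hatFiltration p₂ (stC x) n]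
        (G.hatX p₂ (stC x) n ⁻¹' (absorbing E)ᶜ) :=
      (measurable_obsFiltration_left (Y := G.hatX p₂ (stC x)) le_rfl) measurableSet_absorbing.compl
    have he : G.hatX p₂ (stC x) n ⁻¹' (absorbing E)ᶜ = C := by
      ext ω
      simp [hatX_mem_absorbing_iff, hC]
    rwa [he] at h
  -- The right-hand side is the σ-algebra of all sets whose trace on `C` is the trace of an
  -- auxiliary event; it is enough to check the generators.
  have hle : obsFiltration G.X G.measurable_X G.ξ₁ G.measurable_ξ₁ n ≤
      (MeasurableSpace.comap (Subtype.val : C → Ω)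
        (G.hatFiltration p₂ (stC x) n)).map Subtype.val := by
    refine obsFiltration_le_of (fun k hk s hs => ?_) (fun k hk s hs => ?_)
    · refine ⟨G.hatX p₂ (stC x) k ⁻¹' (Sum.inl '' s),
        measurable_obsFiltration_left (Y := G.hatX p₂ (stC x)) hk hs.inl_image, ?_⟩
      ext ω
      simp [G.hatX_of_alive (G.alive_anti hk ω.2)]
    · exact ⟨G.ξ₁ k ⁻¹' s, measurable_obsFiltration_right (ξ := G.ξ₁) hk hs, rfl⟩
  obtain ⟨B', hB', he⟩ := hle B hB
  have : B ∩ C = B' ∩ C := by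
    rw [Set.inter_comm, Set.inter_comm B', ← Subtype.image_preimage_coe,
      ← Subtype.image_preimage_coe, he]
  rw [this]
  exact hB'.inter hCm

/-- Stopping at the latest at absorption turns a stopping time of the game into a stopping time of
the auxiliary problem. -/
theorem min_entryTime_mem_hatAdmissible [Nonempty E] (hα1 : α < 1) {τ : Ω → WithTop ℕ}
    (hτ : τ ∈ G.admissible) (z : HatState E) :
    (fun ω => min (τ ω) (G.entryTime p₂ z (absorbing E) ω)) ∈ G.hatAdmissible p₂ z := by
  refine ⟨?_, ?_⟩
  · by_cases hz : z ∈ absorbing E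
    · have : (fun ω => min (τ ω) (G.entryTime p₂ z (absorbing E) ω)) = fun _ => ((0 : ℕ) : WithTop ℕ) := by
        funext ω
        rw [G.entryTime_of_mem p₂ hz subset_rfl]
        exact min_eq_right bot_le
      rw [this]
      exact isStoppingTime_const _ 0
    · rcases z with x | x | x
      · intro n
        -- The capped time is at most `n` either because absorption has occurred by `n`, or because
        -- τ ≤ n while the chain is still alive at `n`.
        have h1 := G.isStoppingTime_entryTime p₂ (stC x) measurableSet_absorbing n
        have h2 := G.measurableSet_inter_alive p₂ x (hτ n)
        convert h1.union h2 using 1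
        ext ω
        have h3 := G.lt_entryTime_absorbing_iff p₂ (x := x) (ω := ω) (n := n)
        change min _ _ ≤ (n : WithTop ℕ) ↔ _ ≤ (n : WithTop ℕ) ∨ _ ≤ (n : WithTop ℕ) ∧ _
        rw [min_le_iff, ← h3, ← not_le]
        change _ ∨ G.entryTime p₂ (stC x) (absorbing E) ω ≤ n ↔ _
        tauto
      · exact absurd (stS_mem_absorbing x) hz
      · exact absurd stK_mem_absorbing hz
  · filter_upwards [G.ae_entryTime_lt_top p₂ hα1 z] with ω hω
    exact (min_le_right _ _).trans_lt hω

theorem time₁_mem_admissible (p : Strategy E) : G.time₁ p ∈ G.admissible :=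
  Adapted.isStoppingTime_hittingAfter (fun _ => (measurable_obsFiltration_left le_rfl).prodMk
    (measurable_obsFiltration_right le_rfl))
    (measurableSet_le measurable_snd (p.2.comp measurable_fst))

theorem hatTime_mem_hatAdmissible [Nonempty E] (hα1 : α < 1) (p : Strategy E) (z : HatState E) :
    G.hatTime p₂ z p ∈ G.hatAdmissible p₂ z :=
  G.min_entryTime_mem_hatAdmissible p₂ hα1 (G.time₁_mem_admissible p) z

end Admissible

/-! ### Equality of the rewards in the two problems. -/

section Payoff

variable {f g h : E → ℝ}

theorem natCast_or_top (t : WithTop ℕ) : (∃ n : ℕ, t = n) ∨ t = ⊤ := by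
  induction t using WithTop.recTopCoe with
  | top => exact Or.inr rfl
  | coe n => exact Or.inl ⟨n, rfl⟩

/-- Sorting by the time at which the game ends leaves at most one nonzero term. Working with
`ENNReal.ofReal` lets sum and integral be exchanged before integrability is known. -/
theorem ofReal_payoff_eq_tsum (τ τ' : Ω → WithTop ℕ) (ω : Ω) :
    ENNReal.ofReal (G.payoff f g h τ τ' ω) = ∑' n : ℕ,
      (({ω | τ ω = n} ∩ {ω | n < τ' ω}).indicator
          (fun ω => ENNReal.ofReal ((α : ℝ) ^ n * f (G.X n ω))) ω +
        ({ω | τ' ω = n} ∩ {ω | n < τ ω}).indicator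
          (fun ω => ENNReal.ofReal ((α : ℝ) ^ n * g (G.X n ω))) ω +
        ({ω | τ ω = n} ∩ {ω | τ' ω = n}).indicator
          (fun ω => ENNReal.ofReal ((α : ℝ) ^ n * h (G.X n ω))) ω) := by
  classical
  simp only [Set.indicator, Set.mem_inter_iff, Set.mem_ofPred_eq, payoff]
  rcases natCast_or_top (τ ω) with ⟨a, ha⟩ | ha <;> rcases natCast_or_top (τ' ω) with ⟨b, hb⟩ | hb
  · rcases lt_trichotomy a b with hab | rfl | hab
    · rw [tsum_eq_single a]
      · simp [ha, hb, hab, hab.not_gt, hab.ne, hab.ne']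
      · intro n hn
        simp only [ha, hb, Nat.cast_inj, Nat.cast_lt]
        rw [if_neg (by omega), if_neg (by omega), if_neg (by omega)]
        simp
    · rw [tsum_eq_single a]
      · simp [ha, hb]
      · intro n hn
        simp only [ha, hb, Nat.cast_inj, Nat.cast_lt]
        rw [if_neg (by omega), if_neg (by omega), if_neg (by omega)]
        simp
    · rw [tsum_eq_single b]
      · simp [ha, hb, hab, hab.not_gt, hab.ne']
      · intro n hn
        simp only [ha, hb, Nat.cast_inj, Nat.cast_lt]
        rw [if_neg (by omega), if_neg (by omega), if_neg (by omega)]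
        simp
  · rw [tsum_eq_single a]
    · simp [ha, hb]
    · intro n hn
      have : a ≠ n := fun h => hn h.symm
      simp [ha, hb, this]
  · rw [tsum_eq_single b]
    · simp [ha, hb]
    · intro n hn
      have : b ≠ n := fun h => hn h.symm
      simp [ha, hb, this]
  · simp [ha, hb]

/-- The matching decomposition for the auxiliary problem. If the capped time finds the chain alive,
player 1 has stopped. Otherwise the chain was absorbed just then, and the reward is indexed by the
time of the opponent's stop, one unit before the entry into `S`. -/
theorem ofReal_hatReward_eq_tsum (x : E) (τ : Ω → WithTop ℕ) {ω : Ω}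
    (hω : G.entryTime p₂ (stC x) (absorbing E) ω < ⊤) :
    ENNReal.ofReal (hatReward f g h p₂ (stoppedValue (G.hatX p₂ (stC x))
      (fun ω => min (τ ω) (G.entryTime p₂ (stC x) (absorbing E) ω)) ω)) = ∑' n : ℕ,
      (({ω | τ ω = n} ∩ G.alive p₂ n).indicator
          (fun ω => ENNReal.ofReal (hatReward f g h p₂ (stC (G.X n ω)))) ω +
        (({ω | G.time₂ p₂ ω = n} ∩ {ω | n < τ ω}) ∩ G.survived n).indicator
          (fun ω => ENNReal.ofReal (g (G.X n ω))) ω) := by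
  classical
  set e := G.entryTime p₂ (stC x) (absorbing E) ω with he
  have hlt : ∀ n : ℕ, n < e ↔ ω ∈ G.alive p₂ n := fun n => G.lt_entryTime_absorbing_iff p₂
  obtain ⟨k, hk⟩ : ∃ k : ℕ, min (τ ω) e = k := by
    rcases natCast_or_top (min (τ ω) e) with h | h
    · exact h
    · exact absurd h ((min_le_right _ _).trans_lt hω).ne
  have hval : stoppedValue (G.hatX p₂ (stC x))
      (fun ω => min (τ ω) (G.entryTime p₂ (stC x) (absorbing E) ω)) ω = G.hatX p₂ (stC x) k ω := by
    simp only [stoppedValue]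
    rw [← he, hk, untopA_natCast]
  have hkτ : (k : WithTop ℕ) ≤ τ ω := hk ▸ min_le_left _ _
  have hke : (k : WithTop ℕ) ≤ e := hk ▸ min_le_right _ _
  rw [hval]
  simp only [Set.indicator, Set.mem_inter_iff, Set.mem_ofPred_eq]
  by_cases ha : ω ∈ G.alive p₂ k
  · have hτk : τ ω = k := by
      rcases min_choice (τ ω) e with hc | hc
      · rw [← hc, hk]
      · exact absurd ((hlt k).2 ha) (by rw [← hc, hk]; exact lt_irrefl _)
    have h2 : ∀ n : ℕ, ¬ (G.time₂ p₂ ω = n ∧ (n : WithTop ℕ) < k) := by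
      rintro n ⟨h1, h2⟩
      have h3 : (k : WithTop ℕ) ≤ G.time₂ p₂ ω := ha.1
      rw [h1] at h3
      exact h2.not_ge h3
    rw [tsum_eq_single k, hτk, G.hatX_of_alive ha]
    · rw [if_pos ⟨rfl, ha⟩, if_neg fun h => h2 k h.1, add_zero]
    · intro n hn
      rw [hτk, if_neg, if_neg fun h => h2 n h.1, add_zero]
      rintro ⟨h, -⟩
      exact hn (Nat.cast_inj.1 h).symm
  · have h1 : ∀ n : ℕ, ¬ (τ ω = n ∧ ω ∈ G.alive p₂ n) := by
      rintro n ⟨h, h'⟩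
      rw [h, Nat.cast_le] at hkτ
      exact ha (G.alive_anti hkτ h')
    -- The chain is always alive at time 0, so absorption happens at a successor `m + 1` with the
    -- chain alive at `m`.
    obtain ⟨m, rfl⟩ : ∃ m, k = m + 1 :=
      Nat.exists_eq_succ_of_ne_zero fun h0 => ha (by rw [h0, alive_zero]; trivial)
    have hm : ω ∈ G.alive p₂ m :=
      (hlt m).1 (lt_of_lt_of_le (Nat.cast_lt.2 m.lt_succ_self) hke)
    have hmτ : (m : WithTop ℕ) < τ ω := lt_of_lt_of_le (Nat.cast_lt.2 m.lt_succ_self) hkτ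
    simp only [if_neg (h1 _), zero_add]
    rcases le_or_gt (G.ξ₂ m ω) (p₂.1 (G.X m ω)) with hξ | hξ
    · have ht : G.time₂ p₂ ω = m := G.time₂_eq_iff.2 ⟨hξ, G.le_time₂_iff.1 hm.1⟩
      rw [G.hatX_succ_stopped hm hξ, tsum_eq_single m, if_pos ⟨⟨ht, hmτ⟩, hm.2⟩]
      · rfl
      · intro n hn
        rw [if_neg]
        rintro ⟨⟨h, -⟩, -⟩
        rw [ht] at h
        exact hn (Nat.cast_inj.1 h).symm
    · have hc : G.c (m + 1) ω = false := by
        by_contra hc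
        exact ha (G.alive_succ_iff.2 ⟨hm, hξ, by simpa using hc⟩)
      rw [G.hatX_succ_killed hm hξ hc]
      -- After a failed coin at `m + 1` the series vanishes too: player 2 stops only after `m`, and
      -- survival up to that time would need this coin.
      have : ∀ n : ℕ, ¬ ((G.time₂ p₂ ω = n ∧ (n : WithTop ℕ) < τ ω) ∧ ω ∈ G.survived n) := by
        rintro n ⟨⟨h, -⟩, h'⟩
        have h3 : (m : WithTop ℕ) < G.time₂ p₂ ω := G.lt_time₂_iff.2 fun j hj => by
          rcases hj.lt_or_eq with hj | rfl
          · exact G.le_time₂_iff.1 hm.1 j hj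
          · exact hξ
        rw [h, Nat.cast_lt] at h3
        have h4 := G.survived_anti h3 h'
        rw [survived_succ] at h4
        simp [show G.c (m + 1) ω = true from h4.2] at hc
      simp [hatReward, this]

variable {τ : Ω → WithTop ℕ}

theorem measurableSet_admissible_le {m : ℕ → MeasurableSpace Ω} (hτ : τ ∈ G.admissible)
    {n : ℕ} (k : ℕ)
    (hX : ∀ j ≤ n, Measurable[m k] (G.X j)) (hξ : ∀ j ≤ n, Measurable[m k] (G.ξ₁ j)) :
    MeasurableSet[m k] {ω | τ ω = n} ∧ MeasurableSet[m k] {ω | n < τ ω} := by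
  have hle : obsFiltration G.X G.measurable_X G.ξ₁ G.measurable_ξ₁ n ≤ m k :=
    obsFiltration_le_of hX hξ
  have hτ' : IsStoppingTime (obsFiltration G.X G.measurable_X G.ξ₁ G.measurable_ξ₁) τ := hτ
  exact ⟨hle _ (hτ'.measurableSet_eq n), hle _ (hτ'.measurableSet_gt n)⟩

/-- The event {τ = n ≤ τ₂} involves neither the device of player 2 at `n` nor any coin. On the left,
integrating out this device mixes `f` and `h` with weights 1 - p₂ and p₂; on the right, integrating
out the coins produces α^n. Nonnegativity lets `ENNReal.ofReal` commute with the mixture. -/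
theorem lintegral_stop_eq (hf : Measurable f) (hh : Measurable h) (hf0 : 0 ≤ f) (hh0 : 0 ≤ h)
    (hτ : τ ∈ G.admissible) (x : E) (n : ℕ) :
    ∫⁻ ω in {ω | τ ω = n} ∩ {ω | n < G.time₂ p₂ ω},
        ENNReal.ofReal ((α : ℝ) ^ n * f (G.X n ω)) ∂(G.P x) +
      ∫⁻ ω in {ω | τ ω = n} ∩ {ω | G.time₂ p₂ ω = n},
        ENNReal.ofReal ((α : ℝ) ^ n * h (G.X n ω)) ∂(G.P x) =
      ∫⁻ ω in {ω | τ ω = n} ∩ G.alive p₂ n,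
        ENNReal.ofReal (hatReward f g h p₂ (stC (G.X n ω))) ∂(G.P x) := by
  set B := {ω | τ ω = n} ∩ {ω | n ≤ G.time₂ p₂ ω} with hB
  have hBd : MeasurableSet[G.exceptDevice n] B :=
    (G.measurableSet_admissible_le (m := G.exceptDevice) hτ n
      (fun j _ => measurable_exceptDevice_X n j) (fun j _ => measurable_exceptDevice_ξ₁ n j)).1.inter
    (G.measurableSet_le_time₂ p₂ (fun j _ => measurable_exceptDevice_X n j)
      (fun j hj => measurable_exceptDevice_ξ₂ (by omega)))
  have hBc : ∀ k, MeasurableSet[G.exceptCoin k] B := fun k =>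
    (G.measurableSet_admissible_le (m := G.exceptCoin) hτ k
      (fun j _ => measurable_exceptCoin_X k j) (fun j _ => measurable_exceptCoin_ξ₁ k j)).1.inter
    (G.measurableSet_le_time₂ p₂ (fun j _ => measurable_exceptCoin_X k j)
      (fun j _ => measurable_exceptCoin_ξ₂ k j))
  have hB₀ : MeasurableSet B := G.exceptDevice_le n _ hBd
  have hαn : 0 ≤ (α : ℝ) ^ n := pow_nonneg α.2.1 n
  have device : ∀ φ : E → ℝ, Measurable φ → _ := fun φ hφ =>
    G.setLIntegral_device x n (p₂.2.comp (measurable_exceptDevice_X n n))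
      (((hφ.const_mul ((α : ℝ) ^ n)).ennreal_ofReal.comp
        (measurable_exceptDevice_X n n)).indicator hBd)
  have e1 : {ω | τ ω = n} ∩ {ω | n < G.time₂ p₂ ω} = B ∩ {ω | p₂.1 (G.X n ω) < G.ξ₂ n ω} := by
    ext ω
    simp only [hB, Set.mem_inter_iff, Set.mem_ofPred_eq, lt_time₂_iff, le_time₂_iff, and_assoc]
    refine and_congr_right fun _ => ⟨fun h => ⟨fun k hk => h k hk.le, h n le_rfl⟩, fun h k hk => ?_⟩
    rcases hk.lt_or_eq with hk | rfl
    · exact h.1 k hk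
    · exact h.2
  have e2 : {ω | τ ω = n} ∩ {ω | G.time₂ p₂ ω = n} = B ∩ {ω | G.ξ₂ n ω ≤ p₂.1 (G.X n ω)} := by
    ext ω
    simp only [hB, Set.mem_inter_iff, Set.mem_ofPred_eq, time₂_eq_iff, le_time₂_iff, and_assoc]
    tauto
  have e3 : {ω | τ ω = n} ∩ G.alive p₂ n = B ∩ G.survived n := by
    rw [hB, alive, Set.inter_assoc]
  have hX := G.measurable_X n
  have hr : Measurable fun y : E => hatReward f g h p₂ (stC y) := by
    have hp : Measurable fun x => (p₂.1 x : ℝ) := measurable_subtype_coe.comp p₂.2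
    exact ((measurable_const.sub hp).mul hf).add (hp.mul hh)
  have hs := G.lintegral_survived x n
    (D := B.indicator fun ω => ENNReal.ofReal (hatReward f g h p₂ (stC (G.X n ω)))) fun k =>
      (hr.ennreal_ofReal.comp (measurable_exceptCoin_X k n)).indicator (hBc k)
  rw [e1, e2, e3, ← setLIntegral_indicator hB₀, ← setLIntegral_indicator hB₀,
    ← setLIntegral_indicator hB₀, hs]
  refine (congrArg₂ (· + ·) (device f hf).2 (device h hh).1).trans ?_
  have hD : ∀ φ : E → ℝ, Measurable φ → Measurable (B.indicator
      ((fun y => ENNReal.ofReal ((α : ℝ) ^ n * φ y)) ∘ G.X n)) := fun φ hφ =>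
    (((hφ.const_mul ((α : ℝ) ^ n)).ennreal_ofReal.comp hX).indicator hB₀)
  have hp : Measurable fun ω => (p₂.1 (G.X n ω) : ℝ) :=
    measurable_subtype_coe.comp (p₂.2.comp hX)
  have m1 : Measurable fun ω => ENNReal.ofReal (1 - (p₂.1 (G.X n ω) : ℝ)) * B.indicator
      ((fun y => ENNReal.ofReal ((α : ℝ) ^ n * f y)) ∘ G.X n) ω :=
    (measurable_const.sub hp).ennreal_ofReal.mul (hD f hf)
  have m2 : Measurable (B.indicator
      fun ω => ENNReal.ofReal (hatReward f g h p₂ (stC (G.X n ω)))) :=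
    (hr.ennreal_ofReal.comp hX).indicator hB₀
  rw [← lintegral_const_mul _ m2]
  refine (lintegral_add_left m1 _).symm.trans (lintegral_congr fun ω => ?_)
  by_cases hω : ω ∈ B
  · simp only [Set.indicator_of_mem hω, Function.comp]
    have hp1 := (p₂.1 (G.X n ω)).2.2
    have hp0 := (p₂.1 (G.X n ω)).2.1
    have hfX := hf0 (G.X n ω)
    have hhX := hh0 (G.X n ω)
    simp only [Pi.zero_apply] at hfX hhX
    rw [← ENNReal.ofReal_mul (sub_nonneg.2 hp1), ← ENNReal.ofReal_mul hp0,
      ← ENNReal.ofReal_mul hαn, ← ENNReal.ofReal_add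
        (mul_nonneg (sub_nonneg.2 hp1) (mul_nonneg hαn hfX))
        (mul_nonneg hp0 (mul_nonneg hαn hhX))]
    congr 1
    simp only [hatReward]
    ring
  · simp [hω]

/-- Here only the coins are integrated out: the event that player 2 stops first, at time `n`, does
not involve them. -/
theorem lintegral_stopped_eq (hg : Measurable g) (hτ : τ ∈ G.admissible) (x : E) (n : ℕ) :
    ∫⁻ ω in {ω | G.time₂ p₂ ω = n} ∩ {ω | n < τ ω},
        ENNReal.ofReal ((α : ℝ) ^ n * g (G.X n ω)) ∂(G.P x) =
      ∫⁻ ω in ({ω | G.time₂ p₂ ω = n} ∩ {ω | n < τ ω}) ∩ G.survived n,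
        ENNReal.ofReal (g (G.X n ω)) ∂(G.P x) := by
  set B := {ω | G.time₂ p₂ ω = n} ∩ {ω | n < τ ω} with hB
  have hBc : ∀ k, MeasurableSet[G.exceptCoin k] B := by
    intro k
    have h1 : MeasurableSet[G.exceptCoin k] {ω | G.ξ₂ n ω ≤ p₂.1 (G.X n ω)} :=
      measurableSet_le (measurable_exceptCoin_ξ₂ k n) (p₂.2.comp (measurable_exceptCoin_X k n))
    have h2 : MeasurableSet[G.exceptCoin k] {ω | n ≤ G.time₂ p₂ ω} :=
      G.measurableSet_le_time₂ p₂ (fun j _ => measurable_exceptCoin_X k j)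
        (fun j _ => measurable_exceptCoin_ξ₂ k j)
    have h3 : {ω | G.time₂ p₂ ω = n} =
        {ω | G.ξ₂ n ω ≤ p₂.1 (G.X n ω)} ∩ {ω | n ≤ G.time₂ p₂ ω} := by
      ext ω
      simp only [Set.mem_ofPred_eq, Set.mem_inter_iff, time₂_eq_iff, le_time₂_iff]
    rw [hB, h3]
    exact (h1.inter h2).inter (G.measurableSet_admissible_le (m := G.exceptCoin) hτ k
      (fun j _ => measurable_exceptCoin_X k j) (fun j _ => measurable_exceptCoin_ξ₁ k j)).2
  have hB₀ : MeasurableSet B := G.exceptCoin_le 0 _ (hBc 0)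
  have hs := G.lintegral_survived x n
    (D := B.indicator fun ω => ENNReal.ofReal (g (G.X n ω))) fun k =>
      (hg.ennreal_ofReal.comp (measurable_exceptCoin_X k n)).indicator (hBc k)
  have hgX : Measurable fun ω => ENNReal.ofReal (g (G.X n ω)) :=
    (hg.comp (G.measurable_X n)).ennreal_ofReal
  rw [← setLIntegral_indicator hB₀, hs, lintegral_indicator hB₀,
    ← lintegral_const_mul _ hgX]
  refine lintegral_congr fun ω => ?_
  rw [ENNReal.ofReal_mul (pow_nonneg α.2.1 n)]

theorem measurableSet_time₂_eq (n : ℕ) : MeasurableSet {ω | G.time₂ p₂ ω = n} :=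
  measurableSet_markovTime_eq G.X G.measurable_X G.ξ₂ G.measurable_ξ₂ p₂ n

theorem measurableSet_lt_time₂ (n : ℕ) : MeasurableSet {ω | n < G.time₂ p₂ ω} := by
  have h : {ω | (n : WithTop ℕ) < G.time₂ p₂ ω} = {ω | ((n + 1 : ℕ) : WithTop ℕ) ≤ G.time₂ p₂ ω} := by
    ext ω
    simp only [Set.mem_ofPred_eq, lt_time₂_iff, le_time₂_iff, Nat.lt_succ_iff]
  rw [h]
  exact G.measurableSet_le_time₂ p₂ (fun k _ => G.measurable_X k) (fun k _ => G.measurable_ξ₂ k)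

theorem measurable_ofReal_payoff (hf : Measurable f) (hg : Measurable g) (hh : Measurable h)
    (hτ : τ ∈ G.admissible) :
    (∀ n : ℕ, Measurable (({ω | τ ω = n} ∩ {ω | n < G.time₂ p₂ ω}).indicator
          (fun ω => ENNReal.ofReal ((α : ℝ) ^ n * f (G.X n ω))))) ∧
    (∀ n : ℕ, Measurable (({ω | G.time₂ p₂ ω = n} ∩ {ω | n < τ ω}).indicator
          (fun ω => ENNReal.ofReal ((α : ℝ) ^ n * g (G.X n ω))))) ∧
    (∀ n : ℕ, Measurable (({ω | τ ω = n} ∩ {ω | G.time₂ p₂ ω = n}).indicator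
          (fun ω => ENNReal.ofReal ((α : ℝ) ^ n * h (G.X n ω))))) := by
  have hτm : ∀ n : ℕ, MeasurableSet {ω | τ ω = n} ∧ MeasurableSet {ω | n < τ ω} := fun n =>
    G.measurableSet_admissible_le (m := fun _ => mΩ) hτ 0 (fun j _ => G.measurable_X j)
      (fun j _ => G.measurable_ξ₁ j)
  have hφ : ∀ (φ : E → ℝ) (n : ℕ), Measurable φ →
      Measurable fun ω => ENNReal.ofReal ((α : ℝ) ^ n * φ (G.X n ω)) := fun φ n hφ =>
    ((hφ.comp (G.measurable_X n)).const_mul _).ennreal_ofReal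
  exact ⟨fun n => (hφ f n hf).indicator ((hτm n).1.inter (G.measurableSet_lt_time₂ p₂ n)),
    fun n => (hφ g n hg).indicator ((G.measurableSet_time₂_eq p₂ n).inter (hτm n).2),
    fun n => (hφ h n hh).indicator ((hτm n).1.inter (G.measurableSet_time₂_eq p₂ n))⟩

theorem lintegral_payoff_eq [Nonempty E] (hα1 : α < 1) (hf : Measurable f) (hg : Measurable g)
    (hh : Measurable h) (hf0 : 0 ≤ f) (hh0 : 0 ≤ h) (hτ : τ ∈ G.admissible) (x : E) :
    ∫⁻ ω, ENNReal.ofReal (G.payoff f g h τ (G.time₂ p₂) ω) ∂(G.P x) =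
      ∫⁻ ω, ENNReal.ofReal (hatReward f g h p₂ (stoppedValue (G.hatX p₂ (stC x))
        (fun ω => min (τ ω) (G.entryTime p₂ (stC x) (absorbing E) ω)) ω)) ∂(G.P x) := by
  have hτm : ∀ n : ℕ, MeasurableSet {ω | τ ω = n} ∧ MeasurableSet {ω | n < τ ω} := fun n =>
    G.measurableSet_admissible_le (m := fun _ => mΩ) hτ 0 (fun j _ => G.measurable_X j)
      (fun j _ => G.measurable_ξ₁ j)
  obtain ⟨m1, m2, m3⟩ := G.measurable_ofReal_payoff p₂ hf hg hh hτ
  have hae : ∀ᵐ ω ∂(G.P x), G.entryTime p₂ (stC x) (absorbing E) ω < ⊤ :=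
    G.ae_entryTime_lt_top p₂ hα1 (stC x)
  have hsm : ∀ n, MeasurableSet (G.survived n) := fun n =>
    G.measurableSet_survived fun k _ _ => G.measurable_c k
  have ham : ∀ n, MeasurableSet (G.alive p₂ n) := fun n =>
    G.measurableSet_alive p₂ (fun k _ => G.measurable_X k) (fun k _ => G.measurable_ξ₂ k)
      (fun k _ _ => G.measurable_c k)
  have hr : Measurable fun y : E => hatReward f g h p₂ (stC y) :=
    (measurable_hatReward hf hg hh p₂).comp measurable_stC
  have m4 : ∀ n : ℕ, Measurable (({ω | τ ω = n} ∩ G.alive p₂ n).indicator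
          (fun ω => ENNReal.ofReal (hatReward f g h p₂ (stC (G.X n ω))))) := fun n =>
    (hr.comp (G.measurable_X n)).ennreal_ofReal.indicator ((hτm n).1.inter (ham n))
  have m5 : ∀ n : ℕ, Measurable ((({ω | G.time₂ p₂ ω = n} ∩ {ω | n < τ ω}) ∩
      G.survived n).indicator (fun ω => ENNReal.ofReal (g (G.X n ω)))) := fun n =>
    (hg.comp (G.measurable_X n)).ennreal_ofReal.indicator
      (((G.measurableSet_time₂_eq p₂ n).inter (hτm n).2).inter (hsm n))
  rw [lintegral_congr_ae (hae.mono fun ω hω => G.ofReal_hatReward_eq_tsum p₂ x τ hω)]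
  simp_rw [ofReal_payoff_eq_tsum]
  refine (lintegral_tsum fun n => (((m1 n).add (m2 n)).add (m3 n)).aemeasurable).trans
    (Eq.trans ?_ (lintegral_tsum fun n => ((m4 n).add (m5 n)).aemeasurable).symm)
  refine tsum_congr fun n => ?_
  simp only [Pi.add_apply]
  have h12 : Measurable fun ω => ({ω | τ ω = n} ∩ {ω | n < G.time₂ p₂ ω}).indicator
      (fun ω => ENNReal.ofReal ((α : ℝ) ^ n * f (G.X n ω))) ω +
      ({ω | G.time₂ p₂ ω = n} ∩ {ω | n < τ ω}).indicator
          (fun ω => ENNReal.ofReal ((α : ℝ) ^ n * g (G.X n ω))) ω := (m1 n).add (m2 n)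
  rw [lintegral_add_left h12, lintegral_add_left (m1 n), lintegral_add_left (m4 n),
    lintegral_indicator ((hτm n).1.inter (G.measurableSet_lt_time₂ p₂ n)),
    lintegral_indicator ((G.measurableSet_time₂_eq p₂ n).inter (hτm n).2),
    lintegral_indicator ((hτm n).1.inter (G.measurableSet_time₂_eq p₂ n)),
    lintegral_indicator ((hτm n).1.inter (ham n)),
    lintegral_indicator (((G.measurableSet_time₂_eq p₂ n).inter (hτm n).2).inter (hsm n)),
    ← G.lintegral_stop_eq p₂ hf hh hf0 hh0 hτ, ← G.lintegral_stopped_eq p₂ hg hτ]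
  rw [add_right_comm]

theorem payoff_nonneg (hf0 : 0 ≤ f) (hg0 : 0 ≤ g) (hh0 : 0 ≤ h) (τ τ' : Ω → WithTop ℕ) (ω : Ω) :
    0 ≤ G.payoff f g h τ τ' ω := by
  have e : ∀ {φ : E → ℝ}, 0 ≤ φ → ∀ n y, 0 ≤ (α : ℝ) ^ n * φ y := fun hφ n y =>
    mul_nonneg (pow_nonneg α.2.1 n) (hφ y)
  unfold payoff
  refine add_nonneg (add_nonneg ?_ ?_) ?_
  · split_ifs
    exacts [e hf0 _ _, le_rfl]
  · split_ifs
    exacts [e hg0 _ _, le_rfl]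
  · split_ifs
    exacts [e hh0 _ _, le_rfl]

omit mΩ in
theorem hatReward_nonneg (hf0 : 0 ≤ f) (hg0 : 0 ≤ g) (hh0 : 0 ≤ h) (z : HatState E) :
    0 ≤ hatReward f g h p₂ z := by
  rcases z with y | y | y
  · have hp := (p₂.1 y).2
    exact add_nonneg (mul_nonneg (sub_nonneg.2 hp.2) (hf0 y)) (mul_nonneg hp.1 (hh0 y))
  · exact hg0 y
  · exact le_rfl

/-- Measurability is read off the series; nonnegativity recovers the payoff from its image under
`ENNReal.ofReal`. -/
theorem measurable_payoff (hf : Measurable f) (hg : Measurable g)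
    (hh : Measurable h) (hf0 : 0 ≤ f) (hg0 : 0 ≤ g) (hh0 : 0 ≤ h) (hτ : τ ∈ G.admissible) :
    Measurable (G.payoff f g h τ (G.time₂ p₂)) := by
  have h1 : Measurable fun ω => ENNReal.ofReal (G.payoff f g h τ (G.time₂ p₂) ω) := by
    obtain ⟨m1, m2, m3⟩ := G.measurable_ofReal_payoff p₂ hf hg hh hτ
    simp_rw [ofReal_payoff_eq_tsum]
    exact Measurable.tsum fun n => ((m1 n).add (m2 n)).add (m3 n)
  have h2 := h1.ennreal_toReal
  simpa only [ENNReal.toReal_ofReal (G.payoff_nonneg hf0 hg0 hh0 _ _ _)] using h2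

variable [Nonempty E]

theorem integral_payoff_eq_of_nonneg (hα1 : α < 1) (hf : Measurable f) (hg : Measurable g)
    (hh : Measurable h) (hf0 : 0 ≤ f) (hg0 : 0 ≤ g) (hh0 : 0 ≤ h) (hfi : G.SupIntegrable f)
    (hgi : G.SupIntegrable g) (hhi : G.SupIntegrable h) (hτ : τ ∈ G.admissible) (x : E) :
    Integrable (G.payoff f g h τ (G.time₂ p₂)) (G.P x) ∧
    ∫ ω, G.payoff f g h τ (G.time₂ p₂) ω ∂(G.P x) =
      ∫ ω, hatReward f g h p₂ (stoppedValue (G.hatX p₂ (stC x))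
        (fun ω => min (τ ω) (G.entryTime p₂ (stC x) (absorbing E) ω)) ω) ∂(G.P x) := by
  have hσ := (G.min_entryTime_mem_hatAdmissible p₂ hα1 hτ (stC x)).1
  have hr := (G.isChain_hatX_stC p₂ x).measurable_reward (measurable_hatReward hf hg hh p₂) hσ
  have hp := G.measurable_payoff p₂ hf hg hh hf0 hg0 hh0 hτ
  have heq := G.lintegral_payoff_eq p₂ hα1 hf hg hh hf0 hh0 hτ x
  have hi := (G.isChain_hatX_stC p₂ x).integrable_reward (measurable_hatReward hf hg hh p₂)
    (G.lintegral_iSup_hatReward_lt_top p₂ hf hg hfi hgi hhi (stC x)) hσ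
  refine ⟨⟨hp.aestronglyMeasurable, ?_⟩, ?_⟩
  · rw [hasFiniteIntegral_iff_ofReal (ae_of_all _ (G.payoff_nonneg hf0 hg0 hh0 _ _)), heq,
      ← hasFiniteIntegral_iff_ofReal (ae_of_all _ fun ω => hatReward_nonneg p₂ hf0 hg0 hh0 _)]
    exact hi.2
  · rw [integral_eq_lintegral_of_nonneg_ae (ae_of_all _ (G.payoff_nonneg hf0 hg0 hh0 _ _))
      hp.aestronglyMeasurable, heq, integral_eq_lintegral_of_nonneg_ae
      (ae_of_all _ fun ω => hatReward_nonneg p₂ hf0 hg0 hh0 _) hr.aestronglyMeasurable]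

variable {G} in
omit [Nonempty E] in
theorem SupIntegrable.mono {φ ψ : E → ℝ} (hφ : G.SupIntegrable φ) (h : ∀ y, |ψ y| ≤ |φ y|) :
    G.SupIntegrable ψ := by
  refine fun x => (lintegral_mono fun ω => iSup_mono fun n => ?_).trans_lt (hφ x)
  rcases G.killed n ω with _ | y
  · simp
  · exact enorm_le_iff_norm_le.2 (h y)

omit [Nonempty E] in
theorem payoff_sub (f' g' h' : E → ℝ) (τ τ' : Ω → WithTop ℕ) (ω : Ω) :
    G.payoff (f - f') (g - g') (h - h') τ τ' ω =
      G.payoff f g h τ τ' ω - G.payoff f' g' h' τ τ' ω := by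
  unfold payoff
  simp only [Pi.sub_apply]
  split_ifs <;> ring

omit mΩ [Nonempty E] in
theorem hatReward_sub (f' g' h' : E → ℝ) (z : HatState E) :
    hatReward (f - f') (g - g') (h - h') p₂ z =
      hatReward f g h p₂ z - hatReward f' g' h' p₂ z := by
  rcases z with y | y | y <;> simp only [hatReward, Pi.sub_apply] <;> ring

/-- The reward in the game is the reward in the auxiliary problem of stopping at the latest at
absorption. -/
theorem integral_payoff_eq (hα1 : α < 1) (hf : Measurable f) (hg : Measurable g)
    (hh : Measurable h) (hfi : G.SupIntegrable f)
    (hgi : G.SupIntegrable g) (hhi : G.SupIntegrable h) (hτ : τ ∈ G.admissible) (x : E) :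
    Integrable (G.payoff f g h τ (G.time₂ p₂)) (G.P x) ∧
    G.J f g h x τ (G.time₂ p₂) = G.hatJ f g h p₂ (stC x)
        (fun ω => min (τ ω) (G.entryTime p₂ (stC x) (absorbing E) ω)) := by
  -- Both the payoff and the auxiliary reward are linear in the triple (f, g, h), so the positive
  -- and negative parts are taken of these functions and not of the mixed reward.
  have hdec : ∀ φ : E → ℝ, (fun y => max (φ y) 0) - (fun y => max (-φ y) 0) = φ := fun φ =>
    funext fun y => max_zero_sub_max_neg_zero_eq_self (φ y)
  have hpos : ∀ φ : E → ℝ, ∀ y, |max (φ y) 0| ≤ |φ y| := fun φ y => by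
    rw [abs_of_nonneg (le_max_right _ _)]
    exact max_le (le_abs_self _) (abs_nonneg _)
  have hneg : ∀ φ : E → ℝ, ∀ y, |max (-φ y) 0| ≤ |φ y| := fun φ y => by
    rw [abs_of_nonneg (le_max_right _ _)]
    exact max_le (neg_le_abs _) (abs_nonneg _)
  have hP := fun {φ : E → ℝ} (hφ : Measurable φ) => hφ.max (measurable_const (a := (0 : ℝ)))
  have hN := fun {φ : E → ℝ} (hφ : Measurable φ) => hφ.neg.max (measurable_const (a := (0 : ℝ)))
  have h0 : ∀ φ : E → ℝ, (0 : E → ℝ) ≤ fun y => max (φ y) 0 := fun φ y => le_max_right _ _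
  obtain ⟨i1, e1⟩ := G.integral_payoff_eq_of_nonneg p₂ hα1 (hP hf) (hP hg) (hP hh) (h0 f) (h0 g)
    (h0 h) (hfi.mono (hpos f)) (hgi.mono (hpos g)) (hhi.mono (hpos h)) hτ x
  obtain ⟨i2, e2⟩ := G.integral_payoff_eq_of_nonneg p₂ hα1 (hN hf) (hN hg) (hN hh) (h0 (-f))
    (h0 (-g)) (h0 (-h)) (hfi.mono (hneg f)) (hgi.mono (hneg g)) (hhi.mono (hneg h)) hτ x
  have hσ := (G.min_entryTime_mem_hatAdmissible p₂ hα1 hτ (stC x)).1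
  have j1 := (G.isChain_hatX_stC p₂ x).integrable_reward
    (measurable_hatReward (hP hf) (hP hg) (hP hh) p₂) (G.lintegral_iSup_hatReward_lt_top p₂ (hP hf)
      (hP hg) (hfi.mono (hpos f)) (hgi.mono (hpos g)) (hhi.mono (hpos h)) (stC x)) hσ
  have j2 := (G.isChain_hatX_stC p₂ x).integrable_reward
    (measurable_hatReward (hN hf) (hN hg) (hN hh) p₂) (G.lintegral_iSup_hatReward_lt_top p₂ (hN hf)
      (hN hg) (hfi.mono (hneg f)) (hgi.mono (hneg g)) (hhi.mono (hneg h)) (stC x)) hσ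
  have hpay : G.payoff f g h τ (G.time₂ p₂) = fun ω =>
      G.payoff (fun y => max (f y) 0) (fun y => max (g y) 0) (fun y => max (h y) 0)
        τ (G.time₂ p₂) ω -
      G.payoff (fun y => max (-f y) 0) (fun y => max (-g y) 0) (fun y => max (-h y) 0)
        τ (G.time₂ p₂) ω := by
    funext ω
    rw [← payoff_sub, hdec, hdec, hdec]
  have hrew : hatReward f g h p₂ = fun z =>
      hatReward (fun y => max (f y) 0) (fun y => max (g y) 0) (fun y => max (h y) 0) p₂ z -
      hatReward (fun y => max (-f y) 0) (fun y => max (-g y) 0) (fun y => max (-h y) 0) p₂ z := by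
    funext z
    rw [← hatReward_sub, hdec, hdec, hdec]
  refine ⟨hpay ▸ i1.sub i2, ?_⟩
  unfold J hatJ
  rw [hpay, hrew]
  exact (integral_sub i1 i2).trans ((congrArg₂ (· - ·) e1 e2).trans (integral_sub j1 j2).symm)

end Payoff

end GameSpace

end DynkinGame

/-! ### Optimal stopping of the auxiliary chain. -/

namespace DynkinGame

open Filter Topology OptimalStopping
open scoped ENNReal

namespace GameSpace

variable {E Ω : Type*} [MeasurableSpace E] [Nonempty E] [mΩ : MeasurableSpace Ω] {κ : Kernel E E}
  [IsMarkovKernel κ] {α : unitInterval} (G : GameSpace κ α Ω) {p₂ : Strategy E}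

section Optimality

variable (κ α) in
/-- The value of the auxiliary problem as the limit of the values with finite horizons. -/
noncomputable abbrev hatValue (f g h : E → ℝ) (p₂ : Strategy E) : HatState E → ℝ :=
  value (hatKernel κ α p₂) (hatReward f g h p₂)

variable (κ α) in
/-- The states in which stopping is at least as good as going on. -/
def stopSet (f g h : E → ℝ) (p₂ : Strategy E) : Set (HatState E) :=
  {z | ∫ y, hatValue κ α f g h p₂ y ∂(hatKernel κ α p₂ z) ≤ hatReward f g h p₂ z}

variable {f g h : E → ℝ} (hα1 : α < 1) (hf : Measurable f) (hg : Measurable g) (hh : Measurable h)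
  (hfi : G.SupIntegrable f) (hgi : G.SupIntegrable g) (hhi : G.SupIntegrable h)

include hf hg hh hfi hgi hhi in
-- Every state `z` is the start of a realized chain with integrable supremum of rewards, so the
-- envelope is finite everywhere and not only along one path.
theorem envelope_hatReward_lt_top (z : HatState E) :
    envelope (hatKernel κ α p₂) (fun z => ‖hatReward f g h p₂ z‖ₑ) z < ⊤ :=
  ((G.isChain_hatX p₂ z).envelope_le (measurable_hatReward hf hg hh p₂).enorm).trans_lt
    (G.lintegral_iSup_hatReward_lt_top p₂ hf hg hfi hgi hhi z)

include hf hg hh hfi hgi hhi in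
theorem integrable_hatReward {z : HatState E} {τ : Ω → WithTop ℕ}
    (hτ : τ ∈ G.hatAdmissible p₂ z) :
    Integrable (fun ω => hatReward f g h p₂ (stoppedValue (G.hatX p₂ z) τ ω)) (G.hatP z) :=
  (G.isChain_hatX p₂ z).integrable_reward (measurable_hatReward hf hg hh p₂)
    (G.lintegral_iSup_hatReward_lt_top p₂ hf hg hfi hgi hhi z) hτ.1

include hf hg hh hfi hgi hhi in
theorem hatJ_le_hatValue {z : HatState E} {τ : Ω → WithTop ℕ} (hτ : τ ∈ G.hatAdmissible p₂ z) :
    G.hatJ f g h p₂ z τ ≤ hatValue κ α f g h p₂ z :=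
  (G.isChain_hatX p₂ z).integral_reward_le (measurable_hatReward hf hg hh p₂)
    (G.envelope_hatReward_lt_top hf hg hh hfi hgi hhi)
    (G.lintegral_iSup_hatReward_lt_top p₂ hf hg hfi hgi hhi z) hτ.1 hτ.2

include hf hg hh hfi hgi hhi in
theorem hatValue_eq_max (z : HatState E) : hatValue κ α f g h p₂ z =
    max (hatReward f g h p₂ z) (∫ y, hatValue κ α f g h p₂ y ∂(hatKernel κ α p₂ z)) :=
  value_eq_max (measurable_hatReward hf hg hh p₂)
    (G.envelope_hatReward_lt_top hf hg hh hfi hgi hhi) z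

include hf hg hh hfi hgi hhi in
/-- A stopping time is optimal if it stops and goes on only where this is optimal. -/
theorem hatJ_eq_hatValue {z : HatState E} {τ : Ω → WithTop ℕ} (hτ : τ ∈ G.hatAdmissible p₂ z)
    (hhalt : ∀ᵐ ω ∂(G.hatP z), ∀ n : ℕ, τ ω = n → G.hatX p₂ z n ω ∈ stopSet κ α f g h p₂)
    (hcont : ∀ᵐ ω ∂(G.hatP z), ∀ n : ℕ, n < τ ω → hatReward f g h p₂ (G.hatX p₂ z n ω) ≤
      ∫ y, hatValue κ α f g h p₂ y ∂(hatKernel κ α p₂ (G.hatX p₂ z n ω))) :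
    G.hatJ f g h p₂ z τ = hatValue κ α f g h p₂ z := by
  refine (G.isChain_hatX p₂ z).integral_reward_eq (measurable_hatReward hf hg hh p₂)
    (G.envelope_hatReward_lt_top hf hg hh hfi hgi hhi)
    (G.lintegral_iSup_hatReward_lt_top p₂ hf hg hfi hgi hhi z) hτ.1 hτ.2 (fun n => ?_) fun n => ?_
  · filter_upwards [hhalt] with ω hω hn
    exact (G.hatValue_eq_max hf hg hh hfi hgi hhi _).trans (max_eq_left (hω n hn))
  · filter_upwards [hcont] with ω hω hn
    exact (G.hatValue_eq_max hf hg hh hfi hgi hhi _).trans (max_eq_right (hω n hn))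

omit [Nonempty E] in
include hf hg hh in
theorem measurableSet_stopSet : MeasurableSet (stopSet κ α f g h p₂) :=
  measurableSet_le (((measurable_value _ (measurable_hatReward hf hg hh p₂)).stronglyMeasurable.integral_kernel
    (κ := hatKernel κ α p₂)).measurable) (measurable_hatReward hf hg hh p₂)

omit [Nonempty E] in
include hf hg hh in
theorem absorbing_subset_stopSet : absorbing E ⊆ stopSet κ α f g h p₂ := by
  intro z hz
  have hK := hatKernel_of_mem_absorbing κ α p₂ hz
  exact ((integral_value_of_dirac (measurable_hatReward hf hg hh p₂) hK).trans
    (value_of_dirac (measurable_hatReward hf hg hh p₂) hK)).le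

include hα1 hf hg hh in
theorem entryTime_stopSet_mem (z : HatState E) :
    G.entryTime p₂ z (stopSet κ α f g h p₂) ∈ G.hatAdmissible p₂ z := by
  refine ⟨G.isStoppingTime_entryTime p₂ z (measurableSet_stopSet hf hg hh), ?_⟩
  filter_upwards [G.ae_entryTime_lt_top p₂ hα1 z] with ω hω
  exact lt_of_le_of_lt (hittingAfter_anti _ 0 (absorbing_subset_stopSet hf hg hh) ω) hω

include hα1 hf hg hh hfi hgi hhi in
-- The entry time stops inside the set and goes on only outside it, so no loss ever occurs.
theorem hatJ_entryTime_stopSet (z : HatState E) :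
    G.hatJ f g h p₂ z (G.entryTime p₂ z (stopSet κ α f g h p₂)) = hatValue κ α f g h p₂ z := by
  refine G.hatJ_eq_hatValue hf hg hh hfi hgi hhi (G.entryTime_stopSet_mem hα1 hf hg hh z)
    (ae_of_all _ fun ω n hn => (hittingAfter_zero_eq_iff.1 hn).1) (ae_of_all _ fun ω n hn => ?_)
  exact (not_le.1 (lt_hittingAfter_zero_iff.1 hn n le_rfl)).le

include hα1 hf hg hh hfi hgi hhi in
theorem isGreatest_hatRewards (z : HatState E) :
    IsGreatest (G.hatRewards f g h p₂ z) (hatValue κ α f g h p₂ z) := by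
  refine ⟨⟨_, G.entryTime_stopSet_mem hα1 hf hg hh z,
    G.hatJ_entryTime_stopSet hα1 hf hg hh hfi hgi hhi z⟩, ?_⟩
  rintro _ ⟨τ, hτ, rfl⟩
  exact G.hatJ_le_hatValue hf hg hh hfi hgi hhi hτ

include hα1 hf hg hh hfi hgi hhi in
-- Measurability, integrability and the Wald-Bellman equation, not visible from a supremum over
-- stopping times, pass to `hatV` through this identity.
theorem hatV_eq : G.hatV f g h p₂ = hatValue κ α f g h p₂ :=
  funext fun z => (G.isGreatest_hatRewards hα1 hf hg hh hfi hgi hhi z).csSup_eq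

include hα1 hf hg hh hfi hgi hhi in
theorem hatPV_eq (z : HatState E) :
    G.hatPV f g h p₂ z = ∫ y, hatValue κ α f g h p₂ y ∂(hatKernel κ α p₂ z) := by
  rw [hatPV, G.hatV_eq hα1 hf hg hh hfi hgi hhi]

include hα1 hf hg hh hfi hgi hhi in
theorem isHatOptimal_iff {z : HatState E} {τ : Ω → WithTop ℕ} (hτ : τ ∈ G.hatAdmissible p₂ z) :
    G.IsHatOptimal f g h p₂ z τ ↔ G.hatJ f g h p₂ z τ = hatValue κ α f g h p₂ z := by
  refine ⟨fun hopt => le_antisymm (G.hatJ_le_hatValue hf hg hh hfi hgi hhi hτ) ?_,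
    fun he => ⟨hτ, fun σ hσ => he ▸ G.hatJ_le_hatValue hf hg hh hfi hgi hhi hσ⟩⟩
  rw [← G.hatJ_entryTime_stopSet hα1 hf hg hh hfi hgi hhi z]
  exact hopt.2 _ (G.entryTime_stopSet_mem hα1 hf hg hh z)

include hα1 hf hg hh hfi hgi hhi in
theorem stC_mem_hatD_union_hatI_iff (y : E) :
    stC y ∈ G.hatD f g h p₂ ∪ G.hatI f g h p₂ ↔ stC y ∈ stopSet κ α f g h p₂ := by
  have hPV := G.hatPV_eq (p₂ := p₂) hα1 hf hg hh hfi hgi hhi (stC y)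
  simp only [Set.mem_union, hatD, hatI, Set.mem_ofPred_eq, stopSet, hPV, le_iff_lt_or_eq]
  constructor
  · rintro (⟨_, _, h⟩ | ⟨_, _, h⟩)
    exacts [Or.inl h, Or.inr h]
  · exact Or.imp (fun h => ⟨y, rfl, h⟩) fun h => ⟨y, rfl, h⟩

include hα1 hf hg hh hfi hgi hhi in
theorem hatD_union_hatI_union_absorbing :
    G.hatD f g h p₂ ∪ G.hatI f g h p₂ ∪ absorbing E = stopSet κ α f g h p₂ := by
  ext z
  by_cases hz : z ∈ absorbing E
  · exact iff_of_true (Or.inr hz) (absorbing_subset_stopSet hf hg hh hz)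
  · rcases z with y | y | y
    · rw [Set.mem_union, or_iff_left hz]
      exact G.stC_mem_hatD_union_hatI_iff hα1 hf hg hh hfi hgi hhi y
    · exact absurd (stS_mem_absorbing y) hz
    · exact absurd stK_mem_absorbing hz

end Optimality

/-! ### Markovian stopping times and the transfer to the game. -/

section Markov

omit [Nonempty E] in
-- The rule stops when p ≥ ξ, so even p = 0 stops at ξ = 0. This null event is why entry time and
-- Markovian time agree only almost surely.
theorem ae_forall_ξ₁_pos (x : E) : ∀ᵐ ω ∂(G.P x), ∀ n, 0 < G.ξ₁ n ω := by
  refine ae_all_iff.2 fun n => ?_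
  have h : ∀ᵐ u ∂((G.P x).map (G.ξ₁ n)), 0 < u := by
    rw [G.map_ξ₁, ae_iff]
    have : {u : unitInterval | ¬ 0 < u} = Set.Iic 0 := by ext; simp
    rw [this, unitInterval.volume_Iic]
    simp
  exact ae_of_ae_map (G.measurable_ξ₁ n).aemeasurable h

omit [Nonempty E] in
theorem measure_ξ₁_zero_le (p : Strategy E) (x : E) :
    G.P x {ω | G.ξ₁ 0 ω ≤ p.1 (G.X 0 ω)} = ENNReal.ofReal (p.1 x) ∧
    G.P x {ω | p.1 (G.X 0 ω) < G.ξ₁ 0 ω} = ENNReal.ofReal (1 - p.1 x) := by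
  have hX : ∀ᵐ ω ∂(G.P x), p.1 (G.X 0 ω) = p.1 x := by
    have : ∀ᵐ y ∂((G.P x).map (G.X 0)), p.1 y = p.1 x := by
      rw [G.map_X_zero]
      exact (ae_dirac_iff (p.2 (measurableSet_singleton (p.1 x)))).2 rfl
    exact ae_of_ae_map (G.measurable_X 0).aemeasurable this
  constructor
  · rw [← unitInterval.volume_Iic, ← G.map_ξ₁ x 0, Measure.map_apply (G.measurable_ξ₁ 0)
      measurableSet_Iic]
    refine measure_congr (hX.mono fun ω hω => ?_)
    exact propext (show G.ξ₁ 0 ω ≤ p.1 (G.X 0 ω) ↔ G.ξ₁ 0 ω ≤ p.1 x by rw [hω])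
  · rw [← unitInterval.volume_Ioi, ← G.map_ξ₁ x 0, Measure.map_apply (G.measurable_ξ₁ 0)
      measurableSet_Ioi]
    refine measure_congr (hX.mono fun ω hω => ?_)
    exact propext (show p.1 (G.X 0 ω) < G.ξ₁ 0 ω ↔ p.1 x < G.ξ₁ 0 ω by rw [hω])

omit [Nonempty E] in
variable (p₂) in
theorem lt_hatTime_stC_iff {p : Strategy E} {x : E} {ω : Ω} {n : ℕ} :
    n < G.hatTime p₂ (stC x) p ω ↔
      (∀ k ≤ n, p.1 (G.X k ω) < G.ξ₁ k ω) ∧ ω ∈ G.alive p₂ n := by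
  rw [hatTime, lt_min_iff, G.lt_time₁_iff, G.lt_entryTime_absorbing_iff]

omit [Nonempty E] in
variable (p₂) in
theorem hatTime_stC_eq_imp {p : Strategy E} {x : E} {ω : Ω} {n : ℕ}
    (hn : G.hatTime p₂ (stC x) p ω = n) :
    G.ξ₁ n ω ≤ p.1 (G.X n ω) ∨ ω ∉ G.alive p₂ n := by
  rcases min_choice (G.time₁ p ω) (G.entryTime p₂ (stC x) (absorbing E) ω) with hm | hm
  · exact Or.inl (G.time₁_eq_iff.1 (hm.symm.trans hn)).1
  · exact Or.inr fun ha => ((G.lt_entryTime_absorbing_iff p₂ (x := x)).2 ha).ne'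
      (hm.symm.trans hn)

omit [Nonempty E] in
variable (p₂) in
theorem hatTime_stC_eq_zero_iff {p : Strategy E} {x : E} {ω : Ω} :
    G.hatTime p₂ (stC x) p ω = 0 ↔ G.ξ₁ 0 ω ≤ p.1 (G.X 0 ω) := by
  have h := G.lt_hatTime_stC_iff p₂ (p := p) (x := x) (ω := ω) (n := 0)
  simp only [Nat.le_zero, forall_eq, alive_zero, Set.mem_univ, and_true] at h
  have h' := not_congr h
  rwa [not_lt, not_lt, Nat.cast_zero, nonpos_iff_eq_zero] at h'

variable {f g h : E → ℝ} (hα1 : α < 1) (hf : Measurable f) (hg : Measurable g) (hh : Measurable h)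
  (hfi : G.SupIntegrable f) (hgi : G.SupIntegrable g) (hhi : G.SupIntegrable h)

include hα1 hf hg hh hfi hgi hhi in
-- Stopping at a live state requires ξ ≤ p with ξ > 0 almost surely, so p ≠ 0 and the state lies in
-- D ∪ I; continuing requires p < ξ ≤ 1, so the state is outside D. No loss occurs in either case,
-- whatever p does on I.
theorem hatJ_hatTime_eq (p : Strategy E) (x : E)
    (h1 : ∀ y, stC y ∈ G.hatD f g h p₂ → p.1 y = 1)
    (h0 : ∀ y, stC y ∉ G.hatD f g h p₂ ∪ G.hatI f g h p₂ → p.1 y = 0) :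
    G.hatJ f g h p₂ (stC x) (G.hatTime p₂ (stC x) p) = hatValue κ α f g h p₂ (stC x) := by
  refine G.hatJ_eq_hatValue hf hg hh hfi hgi hhi (G.hatTime_mem_hatAdmissible p₂ hα1 p _) ?_ ?_
  · filter_upwards [G.ae_forall_ξ₁_pos x] with ω hω n hn
    by_cases ha : ω ∈ G.alive p₂ n
    · rw [G.hatX_of_alive ha, ← G.stC_mem_hatD_union_hatI_iff hα1 hf hg hh hfi hgi hhi]
      by_contra hc
      have hle := (G.hatTime_stC_eq_imp p₂ hn).resolve_right (not_not.2 ha)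
      rw [h0 _ hc] at hle
      exact absurd (hω n) (not_lt.2 hle)
    · exact absorbing_subset_stopSet hf hg hh (G.hatX_of_not_alive ha)
  · refine ae_of_all _ fun ω n hn => ?_
    obtain ⟨hlt, ha⟩ := (G.lt_hatTime_stC_iff p₂).1 hn
    rw [G.hatX_of_alive ha, ← G.hatPV_eq hα1 hf hg hh hfi hgi hhi]
    by_contra hc
    have := hlt n le_rfl
    rw [h1 _ ⟨_, rfl, not_le.1 hc⟩] at this
    exact absurd this (not_lt.2 unitInterval.le_one')

include hα1 hf hg hh hfi hgi hhi in
/-- A Markovian strategy that is optimal from `(y, C)` makes the right decision in `y`. -/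
theorem strategy_eq_of_hatJ_hatTime_eq (p : Strategy E) (y : E)
    (hopt : G.hatJ f g h p₂ (stC y) (G.hatTime p₂ (stC y) p) = hatValue κ α f g h p₂ (stC y)) :
    (stC y ∈ G.hatD f g h p₂ → p.1 y = 1) ∧
    (stC y ∉ G.hatD f g h p₂ ∪ G.hatI f g h p₂ → p.1 y = 0) := by
  have hτ := G.hatTime_mem_hatAdmissible p₂ hα1 p (stC y)
  obtain ⟨hs, hc⟩ := (G.isChain_hatX p₂ (stC y)).optimal_at_start (measurable_hatReward hf hg hh p₂)
    (G.envelope_hatReward_lt_top hf hg hh hfi hgi hhi)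
    (G.lintegral_iSup_hatReward_lt_top p₂ hf hg hfi hgi hhi (stC y)) hτ.1 hτ.2 hopt
  -- Started in (y, C), the rule stops at time 0 with probability p(y) and continues with
  -- probability 1 - p(y). A wrong decision must therefore have probability 0.
  obtain ⟨m0, m1⟩ := G.measure_ξ₁_zero_le p y
  have e0 : {ω | G.hatTime p₂ (stC y) p ω = 0} = {ω | G.ξ₁ 0 ω ≤ p.1 (G.X 0 ω)} :=
    Set.ext fun ω => G.hatTime_stC_eq_zero_iff p₂
  have e1 : {ω | 0 < G.hatTime p₂ (stC y) p ω} = {ω | p.1 (G.X 0 ω) < G.ξ₁ 0 ω} :=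
    Set.ext fun ω => pos_iff_ne_zero.trans ((not_congr (G.hatTime_stC_eq_zero_iff p₂)).trans not_le)
  rw [e0, show G.hatP (stC y) = G.P y from rfl, m0] at hs
  rw [e1, show G.hatP (stC y) = G.P y from rfl, m1] at hc
  have hmax := G.hatValue_eq_max (p₂ := p₂) hf hg hh hfi hgi hhi (stC y)
  constructor
  · rintro ⟨_, -, hD⟩
    rw [G.hatPV_eq hα1 hf hg hh hfi hgi hhi] at hD
    have h1 : ENNReal.ofReal (1 - p.1 y) = 0 := by
      by_contra hne
      have := hc hne
      rw [hatValue, max_eq_left hD.le] at hmax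
      exact hD.ne (this.symm.trans hmax)
    rw [ENNReal.ofReal_eq_zero, sub_nonpos] at h1
    exact le_antisymm unitInterval.le_one' h1
  · intro hn
    rw [G.stC_mem_hatD_union_hatI_iff hα1 hf hg hh hfi hgi hhi] at hn
    have hlt : hatReward f g h p₂ (stC y) <
        ∫ z, hatValue κ α f g h p₂ z ∂(hatKernel κ α p₂ (stC y)) := not_le.1 hn
    have h0 : ENNReal.ofReal (p.1 y) = 0 := by
      by_contra hne
      have := hs hne
      rw [hatValue, max_eq_right hlt.le] at hmax
      exact hlt.ne (this.symm.trans hmax)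
    rw [ENNReal.ofReal_eq_zero] at h0
    exact le_antisymm h0 unitInterval.nonneg'

include hα1 hf hg hh hfi hgi hhi in
/-- The first entry into the stopping set is a Markovian stopping time capped at absorption. -/
theorem exists_strategy_entryTime_eq : ∃ p : Strategy E,
    (∀ y, stC y ∈ G.hatD f g h p₂ ∪ G.hatI f g h p₂ → p.1 y = 1) ∧
    (∀ y, stC y ∉ G.hatD f g h p₂ ∪ G.hatI f g h p₂ → p.1 y = 0) ∧
    ∀ z, G.entryTime p₂ z (G.hatD f g h p₂ ∪ G.hatI f g h p₂ ∪ absorbing E)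
      =ᵐ[G.hatP z] G.hatTime p₂ z p := by
  classical
  have hmem := G.stC_mem_hatD_union_hatI_iff (p₂ := p₂) hα1 hf hg hh hfi hgi hhi
  have hm : MeasurableSet {y : E | stC y ∈ stopSet κ α f g h p₂} :=
    measurable_stC (measurableSet_stopSet hf hg hh)
  let p : Strategy E := ⟨fun y => if stC y ∈ stopSet κ α f g h p₂ then 1 else 0,
    Measurable.ite hm measurable_const measurable_const⟩
  have h1 : ∀ y, stC y ∈ stopSet κ α f g h p₂ → p.1 y = 1 := fun y hy => if_pos hy
  have h0 : ∀ y, stC y ∉ stopSet κ α f g h p₂ → p.1 y = 0 := fun y hy => if_neg hy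
  refine ⟨p, fun y hy => h1 y ((hmem y).1 hy), fun y hy => h0 y fun hy' => hy ((hmem y).2 hy'),
    fun z => ?_⟩
  rw [G.hatD_union_hatI_union_absorbing hα1 hf hg hh hfi hgi hhi]
  by_cases hz : z ∈ absorbing E
  · refine ae_of_all _ fun ω => ?_
    rw [G.entryTime_of_mem p₂ hz (absorbing_subset_stopSet hf hg hh), hatTime,
      G.entryTime_of_mem p₂ hz subset_rfl]
    exact (min_eq_right bot_le).symm
  rcases z with x | x | x
  · filter_upwards [show ∀ᵐ ω ∂(G.hatP (stC x)), ∀ n, 0 < G.ξ₁ n ω from G.ae_forall_ξ₁_pos x]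
      with ω hω
    -- Times in ℕ ∪ {∞} are determined by the natural numbers strictly below them. Both conditions
    -- say that up to `n` the chain is alive and has visited only states where p = 0.
    have hiff : ∀ n : ℕ, n < G.entryTime p₂ (stC x) (stopSet κ α f g h p₂) ω ↔
        n < G.hatTime p₂ (stC x) p ω := by
      intro n
      rw [G.lt_hatTime_stC_iff, entryTime, lt_hittingAfter_zero_iff]
      constructor
      · intro hk
        have ha : ∀ k ≤ n, ω ∈ G.alive p₂ k := fun k hkn => by
          by_contra hna
          exact hk k hkn (absorbing_subset_stopSet hf hg hh (G.hatX_of_not_alive hna))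
        refine ⟨fun k hkn => ?_, ha n le_rfl⟩
        have hks := hk k hkn
        rw [G.hatX_of_alive (ha k hkn)] at hks
        rw [h0 _ hks]
        exact hω k
      · rintro ⟨hk, ha⟩ k hkn hks
        rw [G.hatX_of_alive (G.alive_anti hkn ha)] at hks
        have := hk k hkn
        rw [h1 _ hks] at this
        exact absurd this (not_lt.2 unitInterval.le_one')
    have hnat : ∀ s t : WithTop ℕ, (∀ n : ℕ, n < s ↔ n < t) → s ≤ t := by
      intro s t hst
      by_contra hlt
      rw [not_le] at hlt
      rcases natCast_or_top t with ⟨n, rfl⟩ | rfl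
      · exact lt_irrefl _ ((hst n).1 hlt)
      · exact not_top_lt hlt
    exact le_antisymm (hnat _ _ hiff) (hnat _ _ fun n => (hiff n).symm)
  · exact absurd (stS_mem_absorbing x) hz
  · exact absurd stK_mem_absorbing hz

include hα1 hf hg hh hfi hgi hhi in
theorem J_le_hatValue (x : E) {τ : Ω → WithTop ℕ} (hτ : τ ∈ G.admissible) :
    G.J f g h x τ (G.time₂ p₂) ≤ hatValue κ α f g h p₂ (stC x) := by
  rw [(G.integral_payoff_eq p₂ hα1 hf hg hh hfi hgi hhi hτ x).2]
  exact G.hatJ_le_hatValue hf hg hh hfi hgi hhi (G.min_entryTime_mem_hatAdmissible p₂ hα1 hτ _)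

variable (p₂) in
include hα1 hf hg hh hfi hgi hhi in
theorem J_time₁_eq (p : Strategy E) (x : E) : G.J f g h x (G.time₁ p) (G.time₂ p₂) =
    G.hatJ f g h p₂ (stC x) (G.hatTime p₂ (stC x) p) :=
  (G.integral_payoff_eq p₂ hα1 hf hg hh hfi hgi hhi (G.time₁_mem_admissible p) x).2

variable (p₂) in
include hα1 hf hg hh hfi hgi hhi in
-- Capped game times are only some of the admissible times of the auxiliary problem, so the upper
-- bound alone does not give equal values. The optimal entry time is a.s. a capped Markovian time,
-- and the uncapped one attains the bound in the game.
theorem isGreatest_gameRewards (x : E) :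
    IsGreatest (G.gameRewards f g h p₂ x) (hatValue κ α f g h p₂ (stC x)) := by
  obtain ⟨p, h1, h0, -⟩ :=
    G.exists_strategy_entryTime_eq (p₂ := p₂) hα1 hf hg hh hfi hgi hhi
  refine ⟨⟨G.time₁ p, G.time₁_mem_admissible p, ?_⟩, ?_⟩
  · exact (G.J_time₁_eq p₂ hα1 hf hg hh hfi hgi hhi p x).trans
      (G.hatJ_hatTime_eq hα1 hf hg hh hfi hgi hhi p x (fun y hy => h1 y (Or.inl hy)) h0)
  · rintro _ ⟨τ, hτ, rfl⟩
    exact G.J_le_hatValue hα1 hf hg hh hfi hgi hhi x hτ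

include hα1 hf hg hh hfi hgi hhi in
theorem isOptimal_time₁_iff (p : Strategy E) (x : E) :
    G.IsOptimal f g h p₂ x (G.time₁ p) ↔
      G.hatJ f g h p₂ (stC x) (G.hatTime p₂ (stC x) p) = hatValue κ α f g h p₂ (stC x) := by
  rw [← G.J_time₁_eq p₂ hα1 hf hg hh hfi hgi hhi p x]
  constructor
  · intro hopt
    obtain ⟨τ, hτ, he⟩ := (G.isGreatest_gameRewards p₂ hα1 hf hg hh hfi hgi hhi x).1
    exact le_antisymm (G.J_le_hatValue hα1 hf hg hh hfi hgi hhi x (G.time₁_mem_admissible p))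
      (he ▸ hopt.2 τ hτ)
  · exact fun he => ⟨G.time₁_mem_admissible p, fun σ hσ =>
      he ▸ G.J_le_hatValue hα1 hf hg hh hfi hgi hhi x hσ⟩

end Markov

end GameSpace

end DynkinGame

theorem mainTheorem9 {E Ω : Type*} [MeasurableSpace E] [Nonempty E] [MeasurableSpace Ω]
    (κ : ProbabilityTheory.Kernel E E) [ProbabilityTheory.IsMarkovKernel κ]
    (α : unitInterval) (hα0 : 0 < α) (hα1 : α < 1)
    (G : DynkinGame.GameSpace κ α Ω)
    (f g h : E → ℝ) (hf : Measurable f) (hg : Measurable g) (hh : Measurable h)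
    (hfi : G.SupIntegrable f) (hgi : G.SupIntegrable g) (hhi : G.SupIntegrable h)
    (p₂ : DynkinGame.Strategy E) :
    -- the stopping times are admissible; all expectations and suprema are well defined and finite
    ((∀ p : DynkinGame.Strategy E, G.time₁ p ∈ G.admissible) ∧
      (∀ (p : DynkinGame.Strategy E) (z : DynkinGame.HatState E),
        G.hatTime p₂ z p ∈ G.hatAdmissible p₂ z) ∧
      (∀ x, ∀ τ ∈ G.admissible,
        MeasureTheory.Integrable (G.payoff f g h τ (G.time₂ p₂)) (G.P x)) ∧
      (∀ x, BddAbove (G.gameRewards f g h p₂ x)) ∧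
      (∀ z, ∀ τ ∈ G.hatAdmissible p₂ z,
        MeasureTheory.Integrable (fun ω => DynkinGame.hatReward f g h p₂
          (MeasureTheory.stoppedValue (G.hatX p₂ z) τ ω)) (G.hatP z)) ∧
      (∀ z, BddAbove (G.hatRewards f g h p₂ z)) ∧
      (∀ z, MeasureTheory.Integrable (G.hatV f g h p₂) (DynkinGame.hatKernel κ α p₂ z))) ∧
    -- the first entry time into the stopping set is optimal, and the Wald-Bellman equation holds
    ((∀ z, G.IsHatOptimal f g h p₂ z
        (G.entryTime p₂ z (G.hatD f g h p₂ ∪ G.hatI f g h p₂ ∪ DynkinGame.absorbing E))) ∧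
      (∀ z, G.hatV f g h p₂ z =
        max (G.hatPV f g h p₂ z) (DynkinGame.hatReward f g h p₂ z))) ∧
    -- this entry time is a Markovian stopping time capped at absorption
    (∃ p : DynkinGame.Strategy E,
      (∀ y, DynkinGame.stC y ∈ G.hatD f g h p₂ ∪ G.hatI f g h p₂ → p.1 y = 1) ∧
      (∀ y, DynkinGame.stC y ∉ G.hatD f g h p₂ ∪ G.hatI f g h p₂ → p.1 y = 0) ∧
      ∀ z, G.entryTime p₂ z (G.hatD f g h p₂ ∪ G.hatI f g h p₂ ∪ DynkinGame.absorbing E)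
        =ᵐ[G.hatP z] G.hatTime p₂ z p) ∧
    -- the Markovian strategies that are optimal for all non-absorbed initial states
    (∀ p : DynkinGame.Strategy E,
      (∀ x, G.IsHatOptimal f g h p₂ (DynkinGame.stC x)
          (G.hatTime p₂ (DynkinGame.stC x) p)) ↔
        ((∀ y, DynkinGame.stC y ∈ G.hatD f g h p₂ → p.1 y = 1) ∧
          (∀ y, DynkinGame.stC y ∉ G.hatD f g h p₂ ∪ G.hatI f g h p₂ → p.1 y = 0))) ∧
    -- equivalence of the two stopping problems
    ((∀ (p : DynkinGame.Strategy E) (x : E),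
        G.IsOptimal f g h p₂ x (G.time₁ p) ↔
          G.IsHatOptimal f g h p₂ (DynkinGame.stC x) (G.hatTime p₂ (DynkinGame.stC x) p)) ∧
      (∀ x, sSup (G.gameRewards f g h p₂ x) =
        sSup (G.hatRewards f g h p₂ (DynkinGame.stC x)))) := by
  have hiff := fun {z : DynkinGame.HatState E} {τ : Ω → WithTop ℕ} =>
    G.isHatOptimal_iff (p₂ := p₂) (z := z) (τ := τ) hα1 hf hg hh hfi hgi hhi
  have htime := G.hatTime_mem_hatAdmissible p₂ hα1
  have hV := G.hatV_eq (p₂ := p₂) hα1 hf hg hh hfi hgi hhi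
  refine ⟨⟨G.time₁_mem_admissible, htime, fun x τ hτ =>
      (G.integral_payoff_eq p₂ hα1 hf hg hh hfi hgi hhi hτ x).1,
      fun x => (G.isGreatest_gameRewards p₂ hα1 hf hg hh hfi hgi hhi x).bddAbove,
      fun z τ hτ => G.integrable_hatReward hf hg hh hfi hgi hhi hτ,
      fun z => (G.isGreatest_hatRewards hα1 hf hg hh hfi hgi hhi z).bddAbove, fun z => ?_⟩,
    ⟨fun z => ?_, fun z => ?_⟩, G.exists_strategy_entryTime_eq hα1 hf hg hh hfi hgi hhi,
    fun p => ⟨fun hopt => ?_, fun hp x => ?_⟩, fun p x => ?_, fun x => ?_⟩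
  · rw [hV]
    exact OptimalStopping.integrable_value (DynkinGame.measurable_hatReward hf hg hh p₂)
      (G.envelope_hatReward_lt_top hf hg hh hfi hgi hhi) z
  · rw [G.hatD_union_hatI_union_absorbing hα1 hf hg hh hfi hgi hhi]
    exact (hiff (G.entryTime_stopSet_mem hα1 hf hg hh z)).2
      (G.hatJ_entryTime_stopSet hα1 hf hg hh hfi hgi hhi z)
  · rw [hV, G.hatPV_eq hα1 hf hg hh hfi hgi hhi, max_comm]
    exact G.hatValue_eq_max hf hg hh hfi hgi hhi z
  -- Necessity is pointwise: optimality from (y, C) alone fixes the decision in y, so all starting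
  -- points together determine p off I.
  · have hy := fun y => G.strategy_eq_of_hatJ_hatTime_eq hα1 hf hg hh hfi hgi hhi p y
      ((hiff (htime p _)).1 (hopt y))
    exact ⟨fun y => (hy y).1, fun y => (hy y).2⟩
  · exact (hiff (htime p _)).2 (G.hatJ_hatTime_eq hα1 hf hg hh hfi hgi hhi p x hp.1 hp.2)
  · exact (G.isOptimal_time₁_iff hα1 hf hg hh hfi hgi hhi p x).trans (hiff (htime p _)).symm
  · rw [(G.isGreatest_gameRewards p₂ hα1 hf hg hh hfi hgi hhi x).csSup_eq,
      (G.isGreatest_hatRewards hα1 hf hg hh hfi hgi hhi _).csSup_eq]
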